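/- **Setting.** Let $A$ be a (multi)set of $n\ge 1$ points in $\mathbb{R}^d$, $d\ge 1$, and let $k\ge 1$. A $k$-clustering of $A$ is a partition of $A$ into clusters $C_1,\dots,C_k$ (empty clusters are allowed); its min-sum cost is $\sum_{i=1}^k\sum_{\{p,q\}\subseteq C_i}\|p-q\|_2^2$, the inner sum being over unordered pairs. Let $\mathrm{OPT}$ be the minimum cost of a $k$-clustering of $A$. For a cluster $C_i$ let $\mu_i=\frac{1}{|C_i|}\sum_{p\in C_i}p$ and $\Delta_i=\frac{1}{|C_i|}\sum_{p\in C_i}\|p-\mu_i\|^2$, so that the cost is $\sum_i|C_i|^2\Delta_i$. A non-empty finite set of centers $M\subset\mathbb{R}^d$ *$\varepsilon$-covers* $C_i$ if $$|C_i|^2\cdot\min_{m\in M}\|\mu_i-m\|^2\;\le\;\frac{\varepsilon}{2}\left(\frac{1}{k}\,\mathrm{OPT}+|C_i|^2\Delta_i\right).$$ Algorithms run on a randomized real RAM: one step per arithmetic operation on or comparison of real numbers, per addition, subtraction or comparison of natural numbers, per direct or indirect memory access, per control step of the program, and per toss of a fair coin. **Lemma.** There are an absolute constant $\eta>0$, functions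 $g(n)=n^{o(1)}$ and $f(n)=n^{1+o(1)}$ of $n$ alone, and a randomized algorithm with the following properties. Given $n,d,k\ge 1$, $0<\varepsilon<1$, $\delta>0$ and $A$ as above, the algorithm always halts after at most $$f(n)\cdot d\cdot 2^{\eta\cdot k^2\cdot\varepsilon^{-12}\log^2(k/(\varepsilon\delta))}$$ steps and outputs a collection of at most $$g(n)\cdot 2^{\eta\cdot k^2\cdot\varepsilon^{-12}\log^2(k/(\varepsilon\delta))}$$ sets of at most $k$ centers each. For every optimal min-sum $k$-clustering $C_1,\dots,C_k$ of $A$, with probability at least $1-\delta$ at least one of the sets that are output $\varepsilon$-covers every $C_i$, $i=1,\dots,k$. -/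

import Mathlib

open Filter Topology Finset

noncomputable section

namespace MinSum

/-! ### Clusterings and coverage -/

/-- Points of `ℝ^d` with the Euclidean norm. -/
abbrev Point (d : ℕ) : Type := EuclideanSpace ℝ (Fin d)

/-- A `k`-clustering of points indexed by `Fin n` is a labelling `C : Fin n → Fin k`; this is its
`i`-th cluster. Clusters may be empty. -/
def cluster {n k : ℕ} (C : Fin n → Fin k) (i : Fin k) : Finset (Fin n) :=
  univ.filter (fun p => C p = i)

/-- Min-sum cost: the sum of `‖p - q‖ ^ 2` over all unordered pairs inside a common cluster. -/
def cost {n d k : ℕ} (A : Fin n → Point d) (C : Fin n → Fin k) : ℝ :=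
  ∑ i, (1 / 2 : ℝ) * ∑ p ∈ cluster C i, ∑ q ∈ cluster C i, ‖A p - A q‖ ^ 2

/-- The optimal min-sum `k`-clustering cost. -/
def opt {n d : ℕ} (A : Fin n → Point d) (k : ℕ) : ℝ :=
  ⨅ C : Fin n → Fin k, cost A C

/-- `C` is an optimal min-sum `k`-clustering of `A`. -/
def IsOptimal {n d k : ℕ} (A : Fin n → Point d) (C : Fin n → Fin k) : Prop :=
  cost A C = opt A k

/-- The mean `μ_i` of the `i`-th cluster. -/
def mean {n d k : ℕ} (A : Fin n → Point d) (C : Fin n → Fin k) (i : Fin k) : Point d :=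
  ((#(cluster C i) : ℝ))⁻¹ • ∑ p ∈ cluster C i, A p

/-- `Δ_i`: the average squared distance of the `i`-th cluster to its mean. -/
def avgSqDist {n d k : ℕ} (A : Fin n → Point d) (C : Fin n → Fin k) (i : Fin k) : ℝ :=
  (∑ p ∈ cluster C i, ‖A p - mean A C i‖ ^ 2) / (#(cluster C i) : ℝ)

/-- The `i`-th cluster is `ε`-covered by the finite set of centers `M`:
`|C_i|² · min_{m ∈ M} ‖μ_i - m‖² ≤ (ε / 2) · (OPT / k + |C_i|² · Δ_i)`.
The bound on the minimum is expressed by a center attaining it, so that the empty set of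
centers covers nothing. -/
def Covers {n d k : ℕ} (ε : ℝ) (A : Fin n → Point d) (C : Fin n → Fin k)
    (M : Finset (Point d)) (i : Fin k) : Prop :=
  ∃ m ∈ M, (#(cluster C i) : ℝ) ^ 2 * ‖mean A C i - m‖ ^ 2 ≤
    ε / 2 * (1 / (k : ℝ) * opt A k + (#(cluster C i) : ℝ) ^ 2 * avgSqDist A C i)

/-! ### Randomized real RAM

Integer and real registers, and finitely many (per program) integer and real arrays with indirect
addressing. Integers can only be added and subtracted; reals can be added, subtracted, multiplied,
divided and compared exactly. There is no rounding from reals to integers, and the only program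
constants are natural numbers. The only source of randomness is the toss of a fair coin.
Every instruction and every test takes one step. -/

/-- Contents of the memory. -/
structure Store where
  /-- integer registers -/
  nat : ℕ → ℕ
  /-- real registers -/
  real : ℕ → ℝ
  /-- integer arrays: `natArr a i` is cell `i` of array `a` -/
  natArr : ℕ → ℕ → ℕ
  /-- real arrays -/
  realArr : ℕ → ℕ → ℝ

namespace Store

/-- Write an integer register. -/
def setNat (s : Store) (x v : ℕ) : Store :=
  { s with nat := Function.update s.nat x v }

/-- Write a real register. -/
def setReal (s : Store) (x : ℕ) (v : ℝ) : Store :=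
  { s with real := Function.update s.real x v }

/-- Write a cell of an integer array. -/
def setNatArr (s : Store) (a i v : ℕ) : Store :=
  { s with natArr := Function.update s.natArr a (Function.update (s.natArr a) i v) }

/-- Write a cell of a real array. -/
def setRealArr (s : Store) (a i : ℕ) (v : ℝ) : Store :=
  { s with realArr := Function.update s.realArr a (Function.update (s.realArr a) i v) }

end Store

/-- Deterministic instructions. The arguments are register numbers, except that `c` is a literal
and `a` is the number of an array. -/
inductive Instr : Type
  /-- `x := c` -/
  | natConst (x c : ℕ)
  /-- `x := y` -/
  | natCopy (x y : ℕ)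
  /-- `x := y + z` -/
  | natAdd (x y z : ℕ)
  /-- `x := max (y - z) 0` -/
  | natSub (x y z : ℕ)
  /-- `x := a[i]` -/
  | natLoad (x a i : ℕ)
  /-- `a[i] := x` -/
  | natStore (a i x : ℕ)
  /-- `r := c` -/
  | realConst (r c : ℕ)
  /-- `r := x`, for an integer register `x` -/
  | realOfNat (r x : ℕ)
  /-- `r := u` -/
  | realCopy (r u : ℕ)
  /-- `r := u + v` -/
  | realAdd (r u v : ℕ)
  /-- `r := u - v` -/
  | realSub (r u v : ℕ)
  /-- `r := u * v` -/
  | realMul (r u v : ℕ)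
  /-- `r := u / v` (and `0` if `v = 0`) -/
  | realDiv (r u v : ℕ)
  /-- `r := a[i]` -/
  | realLoad (r a i : ℕ)
  /-- `a[i] := r` -/
  | realStore (a i r : ℕ)

/-- Effect of an instruction. -/
def Instr.exec : Instr → Store → Store
  | natConst x c, s => s.setNat x c
  | natCopy x y, s => s.setNat x (s.nat y)
  | natAdd x y z, s => s.setNat x (s.nat y + s.nat z)
  | natSub x y z, s => s.setNat x (s.nat y - s.nat z)
  | natLoad x a i, s => s.setNat x (s.natArr a (s.nat i))
  | natStore a i x, s => s.setNatArr a (s.nat i) (s.nat x)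
  | realConst r c, s => s.setReal r (c : ℝ)
  | realOfNat r x, s => s.setReal r (s.nat x : ℝ)
  | realCopy r u, s => s.setReal r (s.real u)
  | realAdd r u v, s => s.setReal r (s.real u + s.real v)
  | realSub r u v, s => s.setReal r (s.real u - s.real v)
  | realMul r u v, s => s.setReal r (s.real u * s.real v)
  | realDiv r u v, s => s.setReal r (s.real u / s.real v)
  | realLoad r a i, s => s.setReal r (s.realArr a (s.nat i))
  | realStore a i r, s => s.setRealArr a (s.nat i) (s.real r)

/-- Tests: comparison of two integer registers or of two real registers. -/
inductive Test : Type
  | natLe (x y : ℕ)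
  | realLe (u v : ℕ)

/-- Truth of a test. -/
def Test.Holds : Test → Store → Prop
  | natLe x y, s => s.nat x ≤ s.nat y
  | realLe u v, s => s.real u ≤ s.real v

/-- Programs. `coin x` writes a fair random bit to the integer register `x`. -/
inductive Program : Type
  | instr (o : Instr)
  | coin (x : ℕ)
  | seq (P Q : Program)
  | ite (t : Test) (P Q : Program)
  | loop (t : Test) (P : Program)

/-- A configuration: the programs still to be run, first one first, and the memory. -/
abbrev Config : Type := List Program × Store

open Classical in
/-- One step of the machine. A configuration with nothing left to run has halted. -/
def step : Config → PMF Config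
  | ([], s) => PMF.pure ([], s)
  | (.instr o :: K, s) => PMF.pure (K, o.exec s)
  | (.coin x :: K, s) =>
      (PMF.uniformOfFintype Bool).map (fun b => (K, s.setNat x (if b then 1 else 0)))
  | (.seq P Q :: K, s) => PMF.pure (P :: Q :: K, s)
  | (.ite t P Q :: K, s) => PMF.pure (if t.Holds s then (P :: K, s) else (Q :: K, s))
  | (.loop t P :: K, s) =>
      PMF.pure (if t.Holds s then (P :: .loop t P :: K, s) else (K, s))

/-- Distribution of the configuration after `T` steps. -/
def runFor : ℕ → Config → PMF Config
  | 0, c => PMF.pure c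
  | T + 1, c => (step c).bind (runFor T)

/-- Initial memory: `n, d, k` in the integer registers `0, 1, 2`; `ε, δ` in the real registers
`0, 1`; coordinate `c` of point `p` in cell `p * d + c` of the real array `0`; `0` elsewhere. -/
def input {n d : ℕ} (k : ℕ) (ε δ : ℝ) (A : Fin n → Point d) : Store where
  nat x := if x = 0 then n else if x = 1 then d else if x = 2 then k else 0
  real r := if r = 0 then ε else if r = 1 then δ else 0
  natArr _ _ := 0
  realArr a i :=
    if a = 0 then
      if h : i < n * d then
        A (finProdFinEquiv.symm ⟨i, h⟩).1 (finProdFinEquiv.symm ⟨i, h⟩).2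
      else 0
    else 0

open Classical in
/-- The `l`-th set of centers that is output: its members are listed (possibly with repetitions)
as `k` consecutive points, coordinate `c` of the `j`-th one being in cell `(l * k + j) * d + c` of
the real array `1`. -/
def outputSet (k d : ℕ) (s : Store) (l : ℕ) : Finset (Point d) :=
  univ.image (fun j : Fin k =>
    WithLp.toLp 2 (fun c : Fin d => s.realArr 1 ((l * k + j) * d + c)))

/-- The collection of sets of centers that is output; integer register `0` holds its length. -/
def output (k d : ℕ) (s : Store) : List (Finset (Point d)) :=
  (List.range (s.nat 0)).map (outputSet k d s)

/-- `f n = n ^ (c + o(1))` as `n → ∞`. -/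
def IsPowAddLittleO (c : ℝ) (f : ℕ → ℝ) : Prop :=
  ∃ o : ℕ → ℝ, Tendsto o atTop (𝓝 0) ∧ ∀ᶠ n in atTop, f n = (n : ℝ) ^ (c + o n)

/-- The factor `2 ^ (η · k² · ε⁻¹² · log² (k / (ε δ)))`. -/
def expFactor (η : ℝ) (k : ℕ) (ε δ : ℝ) : ℝ :=
  (2 : ℝ) ^ (η * (k : ℝ) ^ 2 * (ε ^ 12)⁻¹ * Real.log ((k : ℝ) / (ε * δ)) ^ 2)

end MinSum

end

/-! The algorithm keeps `k` current centers and makes `N` attempts to replace all of them in turn. A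
new center is the mean of `m` random draws, with `m` just above `8 / ε`, and every attempt outputs
its `k` centers. A draw guesses an exponent `v` up to `log n` and takes the farthest from the
current centers among `2 ^ v - 1` random points, or a random center if there are no rounds. No
distribution proportional to distances or enumeration of subsets is needed.

Fix an optimal clustering and treat its clusters by decreasing size. Suppose the larger ones are
covered, let `N` now be the size of the next cluster, and call a point far if its squared distance
to the centers exceeds `ρ = ε OPT / (12 k N²)`. A covered cluster contains at most `24 k N / ε` far
points, since its total squared distance to its center is at most `2 OPT / N`; an uncovered one
contains at most `N` points anyway. So there are `O(k² N / ε)` far points (`card_far_le`). For the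
right `v`, the tournament selects each of `f` far points with probability of order `1 / f`
(`tournament_find`, `sampleDist_far`).

Moving every near point of the cluster to a center within `√ρ` perturbs the mean and the variance
only slightly. A draw dominates `θ` times the uniform distribution on this modified cluster, with
`θ` of order `ε / (k² log n)` (`sampleDist_dominates`). Hence with probability at least `θ ^ m / 2`
the mean of `m` draws obeys Markov's inequality for uniform samples and covers the cluster
(`meanDist_prob`, `roundDist_prob`). All `k` rounds succeed with probability at least `p = (θ ^ m /
2) ^ k`, from any earlier centers, and `1 / (p δ)` attempts suffice (`searchDist_good`).

The logarithm of the number of attempts is of order `(k / ε) (log log n + log (k / ε)) + log (1 /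
δ)`. The product of `k / ε` and `log log n` is split by the inequality between means: `(log log n)²`
goes into `n ^ o(1)`, the rest into the exponential factor (`exponent_le`).

That the program realizes this process is expressed by `Run`, a refinement relation with rules for
composition and loops. It bounds expectations at the halted memory from below, which is enough for
both success probability and sure termination. -/

open scoped ENNReal

noncomputable section

namespace MinSum

/-! ### Expectations -/

section Expectation

variable {α β : Type*}

/-- Expectation of a nonnegative function. -/
def ev (p : PMF α) (y : α → ℝ≥0∞) : ℝ≥0∞ := ∑' a, p a * y a

theorem ev_pure (a : α) (y : α → ℝ≥0∞) : ev (PMF.pure a) y = y a := by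
  unfold ev
  rw [tsum_eq_single a]
  · simp
  · intro b hb
    simp [hb]

theorem ev_bind (p : PMF α) (f : α → PMF β) (y : β → ℝ≥0∞) :
    ev (p.bind f) y = ev p (fun a => ev (f a) y) := by
  unfold ev
  simp only [PMF.bind_apply, ← ENNReal.tsum_mul_right, ← ENNReal.tsum_mul_left]
  rw [ENNReal.tsum_comm]
  simp only [mul_assoc]

theorem ev_map (p : PMF α) (f : α → β) (y : β → ℝ≥0∞) :
    ev (p.map f) y = ev p (fun a => y (f a)) := by
  simp only [PMF.map, ev_bind, Function.comp_apply, ev_pure]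

theorem ev_mono (p : PMF α) {y z : α → ℝ≥0∞} (h : ∀ a, y a ≤ z a) : ev p y ≤ ev p z :=
  ENNReal.tsum_le_tsum fun a => mul_le_mul_right (h a) _

theorem ev_const (p : PMF α) (x : ℝ≥0∞) : ev p (fun _ => x) = x := by
  unfold ev
  rw [ENNReal.tsum_mul_right, p.tsum_coe, one_mul]

theorem ev_add (p : PMF α) (y z : α → ℝ≥0∞) : ev p (fun a => y a + z a) = ev p y + ev p z := by
  unfold ev
  simp only [mul_add, ENNReal.tsum_add]

theorem ev_const_mul (p : PMF α) (x : ℝ≥0∞) (y : α → ℝ≥0∞) :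
    ev p (fun a => x * y a) = x * ev p y := by
  unfold ev
  simp only [← ENNReal.tsum_mul_left, mul_left_comm]

theorem sum_le_ev (p : PMF α) (s : Finset α) (y : α → ℝ≥0∞) : ∑ a ∈ s, p a * y a ≤ ev p y :=
  ENNReal.sum_le_tsum s

theorem apply_eq_ev [DecidableEq α] (p : PMF α) (a : α) : p a = ev p (fun b => if b = a then 1 else 0) := by
  unfold ev
  rw [tsum_eq_single a]
  · simp
  · intro b hb
    simp [hb]

/-- `m` steps of a time-dependent random iteration, starting at time `i`. -/
def iter (κ : ℕ → α → PMF α) : ℕ → ℕ → α → PMF α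
  | _, 0, a => PMF.pure a
  | i, m + 1, a => (κ i a).bind (iter κ (i + 1) m)

end Expectation

/-! ### Expected value of a function of the final memory -/

open Classical in
/-- Expectation of `F` at the final memory, restricted to the runs that halt within `T` steps. -/
def reach (T : ℕ) (F : Store → ℝ≥0∞) (c : Config) : ℝ≥0∞ :=
  ev (runFor T c) (fun c' => if c'.1 = [] then F c'.2 else 0)

theorem reach_succ (T : ℕ) (F : Store → ℝ≥0∞) (c : Config) :
    reach (T + 1) F c = ev (step c) (reach T F) := by
  unfold reach
  rw [runFor, ev_bind]

theorem reach_nil (T : ℕ) (F : Store → ℝ≥0∞) (s : Store) : reach T F ([], s) = F s := by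
  induction T with
  | zero => simp [reach, runFor, ev_pure]
  | succ T ih => rw [reach_succ, step, ev_pure, ih]

theorem reach_zero_cons (F : Store → ℝ≥0∞) (P : Program) (K : List Program) (s : Store) :
    reach 0 F (P :: K, s) = 0 := by
  simp [reach, runFor, ev_pure]

/-- A halted configuration is a fixed point of `step`, so more time can only let more runs count. -/
theorem reach_le_succ (T : ℕ) (F : Store → ℝ≥0∞) (c : Config) :
    reach T F c ≤ reach (T + 1) F c := by
  induction T generalizing c with
  | zero =>
    obtain ⟨_ | ⟨P, K⟩, s⟩ := c
    · simp only [reach_nil, le_refl]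
    · simp [reach_zero_cons]
  | succ T ih =>
    rw [reach_succ, reach_succ (T + 1)]
    exact ev_mono _ ih

theorem reach_mono_time {T T' : ℕ} (h : T ≤ T') (F : Store → ℝ≥0∞) (c : Config) :
    reach T F c ≤ reach T' F c :=
  monotone_nat_of_le_succ (f := fun T => reach T F c) (fun T => reach_le_succ T F c) h

/-- A step inspects only the head of the stack, so a continuation below a nonempty stack is carried
along untouched. -/
theorem step_append (P : Program) (K K' : List Program) (s : Store) :
    step (P :: K ++ K', s) = (step (P :: K, s)).map (fun c => (c.1 ++ K', c.2)) := by
  classical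
  cases P <;> simp only [List.cons_append, step, PMF.pure_map, PMF.map_comp] <;>
    first | rfl | (split_ifs <;> rfl)

/-- A run of `K` that halts within `t` steps leaves at least `T` steps for `K'`. Only an inequality
is claimed, because an early halt leaves more. -/
theorem reach_append (t T : ℕ) (G : Store → ℝ≥0∞) (K K' : List Program) (s : Store) :
    reach t (fun s' => reach T G (K', s')) (K, s) ≤ reach (t + T) G (K ++ K', s) := by
  induction t generalizing K s with
  | zero =>
    cases K with
    | nil => simp [reach_nil]
    | cons P K => simp [reach_zero_cons]
  | succ t ih =>
    cases K with
    | nil =>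
      rw [reach_nil]
      exact reach_mono_time (by omega) _ _
    | cons P K =>
      rw [show t + 1 + T = t + T + 1 by omega, reach_succ, reach_succ, step_append, ev_map]
      exact ev_mono _ fun c => ih c.1 c.2

/-! ### Refinement of random computations by programs -/

section Refinement

variable {α β γ : Type*}

/-- From memory `s` the program `P` halts within `t` steps, having simulated a draw `a` from `p`
by a memory related to `a` by `R`. -/
def Run (P : Program) (t : ℕ) (s : Store) (p : PMF α) (R : α → Store → Prop) : Prop :=
  ∀ (y : α → ℝ≥0∞) (F : Store → ℝ≥0∞), (∀ a s', R a s' → y a ≤ F s') →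
    ev p y ≤ reach t F ([P], s)

/-- From memory `s` the program `P` always halts within `t` steps, with a memory satisfying `Q`. -/
def Det (P : Program) (t : ℕ) (s : Store) (Q : Store → Prop) : Prop :=
  Run P t s (PMF.pure ()) (fun _ => Q)

variable {P P' : Program} {t t' : ℕ} {s : Store} {p : PMF α} {R : α → Store → Prop}
  {Q Q' : Store → Prop}

theorem Run.mono (h : Run P t s p R) (ht : t ≤ t') {R' : α → Store → Prop}
    (hR : ∀ a s', R a s' → R' a s') : Run P t' s p R' := fun y F hF =>
  (h y F fun a s' ha => hF a s' (hR a s' ha)).trans (reach_mono_time ht _ _)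

theorem Run.map (h : Run P t s p R) (f : α → β) {R' : β → Store → Prop}
    (hR : ∀ a s', R a s' → R' (f a) s') : Run P t s (p.map f) R' := fun y F hF => by
  rw [ev_map]
  exact h _ F fun a s' ha => hF _ s' (hR a s' ha)

theorem Det.mono (h : Det P t s Q) (ht : t ≤ t') (hQ : ∀ s', Q s' → Q' s') : Det P t' s Q' :=
  Run.mono h ht fun _ => hQ

theorem Det.run (h : Det P t s Q) (a : α) (hR : ∀ s', Q s' → R a s') :
    Run P t s (PMF.pure a) R := by
  have := Run.map h (fun _ => a) (R' := R) fun _ s' hs => hR s' hs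
  rwa [PMF.pure_map] at this

/-- Refinement composes like weakest preconditions: the first program is tested against the
expectation that the second one guarantees from its starting memory. The quantification over all
pairs `y`, `F` in `Run` is what permits this choice. -/
theorem Run.seq {q : α → PMF β} {R' : β → Store → Prop} (h : Run P t s p R)
    (h' : ∀ a s', R a s' → Run P' t' s' (q a) R') :
    Run (.seq P P') (t + t' + 1) s (p.bind q) R' := fun y F hF => by
  rw [ev_bind, reach_succ, step, ev_pure]
  exact (h _ _ fun a s' ha => h' a s' ha y F hF).trans (reach_append t t' F [P] [P'] s)

theorem Det.seq_run {R' : β → Store → Prop} {q : PMF β} (h : Det P t s Q)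
    (h' : ∀ s', Q s' → Run P' t' s' q R') : Run (.seq P P') (t + t' + 1) s q R' := by
  have := Run.seq (q := fun _ => q) h fun _ => h'
  rwa [PMF.pure_bind] at this

theorem Run.seq_det {R' : α → Store → Prop} (h : Run P t s p R)
    (h' : ∀ a s', R a s' → Det P' t' s' (R' a)) : Run (.seq P P') (t + t' + 1) s p R' := by
  have := Run.seq (q := fun a => PMF.pure a) h fun a s' ha => (h' a s' ha).run a (R := R') fun _ h => h
  rwa [PMF.bind_pure] at this

theorem Det.seq (h : Det P t s Q) (h' : ∀ s', Q s' → Det P' t' s' Q') :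
    Det (.seq P P') (t + t' + 1) s Q' :=
  Det.seq_run h h'

theorem Run.ite {T : Test} (h : T.Holds s → Run P t s p R) (h' : ¬ T.Holds s → Run P' t s p R) :
    Run (.ite T P P') (t + 1) s p R := fun y F hF => by
  rw [reach_succ, step, ev_pure]
  split_ifs with hT
  · exact h hT y F hF
  · exact h' hT y F hF

theorem Det.ite {T : Test} (h : T.Holds s → Det P t s Q) (h' : ¬ T.Holds s → Det P' t s Q) :
    Det (.ite T P P') (t + 1) s Q :=
  Run.ite h h'

theorem Run.loop_exit {T : Test} {a : α} (hT : ¬ T.Holds s) (hR : R a s) :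
    Run (.loop T P) 1 s (PMF.pure a) R := fun y F hF => by
  rw [reach_succ, step, ev_pure, ev_pure, if_neg hT, reach_nil]
  exact hF a s hR

theorem Run.loop_step {T : Test} {q : α → PMF β} {R' : β → Store → Prop} (hT : T.Holds s)
    (h : Run P t s p R) (h' : ∀ a s', R a s' → Run (.loop T P) t' s' (q a) R') :
    Run (.loop T P) (t + t' + 1) s (p.bind q) R' := fun y F hF => by
  rw [ev_bind, reach_succ, step, ev_pure, if_pos hT]
  exact (h _ _ fun a s' ha => h' a s' ha y F hF).trans (reach_append t t' F [P] [.loop T P] s)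

theorem Run.coin {R' : Bool → Store → Prop} (x : ℕ)
    (hR : ∀ b : Bool, R' b (s.setNat x (if b then 1 else 0))) :
    Run (.coin x) 1 s (PMF.uniformOfFintype Bool) R' := fun y F hF => by
  rw [reach_succ, step, ev_map]
  refine ev_mono _ fun b => ?_
  rw [reach_nil]
  exact hF b _ (hR b)

theorem Det.instr {o : Instr} (h : Q (o.exec s)) : Det (.instr o) 1 s Q := fun y F hF => by
  rw [reach_succ, step, ev_pure, ev_pure, reach_nil]
  exact hF () _ h

/-- A program that does nothing. -/
def skip : Program := .instr (.natCopy 0 0)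

theorem Det.skip (h : Q s) : Det skip 1 s Q := by
  refine Det.instr ?_
  have : (Instr.natCopy 0 0).exec s = s := by
    simp [Instr.exec, Store.setNat, Function.update_eq_self]
  rwa [this]

/-- Straight-line programs. -/
def block : List Instr → Program
  | [] => skip
  | o :: l => .seq (.instr o) (block l)

theorem Det.block (l : List Instr) {s : Store} (h : Q (l.foldl (fun s o => o.exec s) s)) :
    Det (block l) (2 * l.length + 1) s Q := by
  induction l generalizing s with
  | nil => exact Det.skip h
  | cons o l ih =>
    refine (Det.seq (Q := fun s' => s' = o.exec s) (Det.instr rfl) (t' := 2 * l.length + 1) ?_).mono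
      (by simp only [List.length_cons]; omega) fun _ h => h
    rintro _ rfl
    exact ih h

/-- A loop with a known number `m` of rounds. -/
theorem Run.loop {T : Test} {body : Program} {κ : ℕ → α → PMF α} {J : ℕ → α → Store → Prop} (m : ℕ)
    (hbody : ∀ i a s, i < m → J i a s → T.Holds s ∧ Run body t s (κ i a) (J (i + 1)))
    (hexit : ∀ a s, J m a s → ¬ T.Holds s) (a : α) (s : Store) (hJ : J 0 a s) :
    Run (.loop T body) (m * (t + 1) + 1) s (iter κ 0 m a) (J m) := by
  -- The kernels depend on time, so the induction is on the number `r` of remaining rounds, for an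
  -- arbitrary starting round `i`.
  suffices H : ∀ r i, i + r = m → ∀ a s, J i a s →
      Run (.loop T body) (r * (t + 1) + 1) s (iter κ i r a) (J m) from H m 0 (by omega) a s hJ
  intro r
  induction r with
  | zero =>
    intro i hi a s hJ
    obtain rfl : i = m := by omega
    exact (Run.loop_exit (hexit a s hJ) hJ).mono (by omega) fun _ _ h => h
  | succ r ih =>
    intro i hi a s hJ
    obtain ⟨hT, hb⟩ := hbody i a s (by omega) hJ
    have h2 := Run.loop_step (q := iter κ (i + 1) r) hT hb
      fun a s' h => ih (i + 1) (by omega) a s' h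
    exact h2.mono (by ring_nf; omega) fun _ _ h => h

/-! ### Counting loops

Integer register `8` is meant to contain `1`. -/

/-- Run the body `r` times, counting register `r` down to `0`. -/
def forLoop (r : ℕ) (body : Program) : Program :=
  .loop (.natLe 8 r) (.seq (.instr (.natSub r r 8)) body)

/-- The counter is decremented before the body runs, so the body starts with `tot - i - 1` in
register `r`. It has to preserve that value and the constant `1` in register `8`. -/
theorem Run.forLoop {r : ℕ} {body : Program} {κ : ℕ → α → PMF α}
    {J : ℕ → α → Store → Prop} (tot : ℕ)
    (hbody : ∀ i a s, i < tot → J i a s → s.nat r = tot - i → s.nat 8 = 1 →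
      Run body t (s.setNat r (tot - i - 1)) (κ i a)
        (fun a' s' => J (i + 1) a' s' ∧ s'.nat r = tot - (i + 1) ∧ s'.nat 8 = 1))
    (a : α) (s : Store) (hJ : J 0 a s) (hr : s.nat r = tot) (h8 : s.nat 8 = 1) :
    Run (forLoop r body) (tot * (t + 3) + 1) s (iter κ 0 tot a)
      (fun a' s' => J tot a' s' ∧ s'.nat 8 = 1) := by
  refine (Run.loop (t := 1 + t + 1) (J := fun i a s => J i a s ∧ s.nat r = tot - i ∧ s.nat 8 = 1) tot
    ?_ ?_ a s ⟨hJ, hr, h8⟩).mono (by ring_nf; omega) fun a s h => ⟨h.1, h.2.2⟩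
  · rintro i a s hi ⟨hJ, hr, h8⟩
    refine ⟨by simp only [Test.Holds, h8, hr]; omega, ?_⟩
    refine Det.seq_run (Q := fun s' => s' = s.setNat r (tot - i - 1)) (Det.instr ?_) ?_
    · simp only [Instr.exec, hr, h8]
    · rintro _ rfl
      exact hbody i a s hi hJ hr h8
  · rintro a s ⟨hJ, hr, h8⟩
    simp only [Test.Holds, h8, hr]
    omega

/-- This makes deterministic loops a special case of random ones, with the trivial kernel on `Unit`.
-/
theorem iter_pure (m i : ℕ) : iter (fun _ (_ : Unit) => PMF.pure ()) i m () = PMF.pure () := by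
  induction m generalizing i with
  | zero => rfl
  | succ m ih => rw [iter, PMF.pure_bind, ih]

theorem Det.forLoop {r : ℕ} {body : Program} {J : ℕ → Store → Prop} (tot : ℕ)
    (hbody : ∀ i s, i < tot → J i s → s.nat r = tot - i → s.nat 8 = 1 →
      Det body t (s.setNat r (tot - i - 1))
        (fun s' => J (i + 1) s' ∧ s'.nat r = tot - (i + 1) ∧ s'.nat 8 = 1))
    (s : Store) (hJ : J 0 s) (hr : s.nat r = tot) (h8 : s.nat 8 = 1) :
    Det (forLoop r body) (tot * (t + 3) + 1) s (fun s' => J tot s' ∧ s'.nat 8 = 1) := by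
  have := Run.forLoop (κ := fun _ _ => PMF.pure ()) (J := fun i _ => J i) tot
    (fun i _ s => hbody i s) () s hJ hr h8
  rwa [iter_pure] at this

theorem Det.loop {T : Test} {body : Program} {J : ℕ → Store → Prop} (m : ℕ)
    (hbody : ∀ i s, i < m → J i s → T.Holds s ∧ Det body t s (J (i + 1)))
    (hexit : ∀ s, J m s → ¬ T.Holds s) (s : Store) (hJ : J 0 s) :
    Det (.loop T body) (m * (t + 1) + 1) s (J m) := by
  have := Run.loop (κ := fun _ _ => PMF.pure ()) (J := fun i _ => J i) m
    (fun i _ s => hbody i s) (fun _ => hexit) () s hJ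
  rwa [iter_pure] at this

/-! ### Halting and probabilities from refinement -/

open Classical in
theorem ev_indicator (p : PMF α) (S : Set α) :
    ev p (fun a => if a ∈ S then 1 else 0) = p.toOuterMeasure S := by
  rw [PMF.toOuterMeasure_apply]
  refine tsum_congr fun a => ?_
  simp [Set.indicator_apply]

/-- The lower bound with test function `1` already gives total mass one to the halted, related
configurations. Hence nothing else lies in the support, and halting is sure rather than almost sure.
-/
theorem Run.support (h : Run P t s p R) {c : Config} (hc : c ∈ (runFor t ([P], s)).support) :
    c.1 = [] ∧ ∃ a, R a c.2 := by
  classical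
  have h1 := h (fun _ => 1) (fun s' => if ∃ a, R a s' then 1 else 0) fun a s' ha => by
    rw [if_pos ⟨a, ha⟩]
  have h2 : (runFor t ([P], s)).toOuterMeasure {c | c.1 = [] ∧ ∃ a, R a c.2} = 1 := by
    refine le_antisymm ?_ ?_
    · rw [← ev_indicator]
      exact (ev_mono _ fun c => by split_ifs <;> simp).trans_eq (ev_const _ 1)
    · rw [ev_const, reach] at h1
      rw [← ev_indicator]
      refine h1.trans (le_of_eq ?_)
      congr 1
      ext c
      by_cases h1 : c.1 = [] <;> simp [h1]
  exact (PMF.toOuterMeasure_apply_eq_one_iff _ _).1 h2 hc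

open Classical in
theorem Run.prob (h : Run P t s p R) {S : Set α} {S' : Set Config}
    (hS : ∀ a ∈ S, ∀ s', R a s' → ([], s') ∈ S') :
    ev p (fun a => if a ∈ S then 1 else 0) ≤ (runFor t ([P], s)).toOuterMeasure S' := by
  rw [← ev_indicator]
  refine (h _ (fun s' => if ([], s') ∈ S' then 1 else 0) fun a s' ha => ?_).trans
    (ev_mono _ fun c => ?_)
  · split_ifs with h1 h2 h2
    · exact le_rfl
    · exact absurd (hS a h1 s' ha) h2
    · exact zero_le
    · exact le_rfl
  · obtain ⟨K, s'⟩ := c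
    by_cases hK : K = []
    · subst hK
      simp
    · simp [hK]

attribute [irreducible] Run Det

end Refinement

section Programs

attribute [local simp] Instr.exec Store.setNat Store.setReal Store.setRealArr

/-! ### Arithmetic and random numbers -/

/-- The registers with small numbers agree. -/
def Frame (a b : ℕ) (s s' : Store) : Prop :=
  (∀ x < a, s'.nat x = s.nat x) ∧ ∀ r < b, s'.real r = s.real r

/-- Registers are numbered roughly by nesting depth: an inner routine writes only high numbers. A
single pair of bounds then describes what its callers may rely on, and composition takes the smaller
bounds. -/
theorem Frame.trans {a b a' b' a'' b'' : ℕ} {s s' s'' : Store} (h : Frame a b s s')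
    (h' : Frame a' b' s' s'') (ha : a'' ≤ a := by omega) (hb : b'' ≤ b := by omega)
    (ha' : a'' ≤ a' := by omega) (hb' : b'' ≤ b' := by omega) : Frame a'' b'' s s'' :=
  ⟨fun x hx => (h'.1 x (by omega)).trans (h.1 x (by omega)),
    fun r hr => (h'.2 r (by omega)).trans (h.2 r (by omega))⟩

/-- Integer register `29` becomes the product of `x` and `y`. -/
def mul (x y : ℕ) : Program :=
  .seq (block [.natConst 29 0, .natCopy 30 y]) (forLoop 30 (block [.natAdd 29 29 x]))

/-- Integer register `29` becomes `2 ^ x`. -/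
def pow2 (x : ℕ) : Program :=
  .seq (block [.natConst 29 1, .natCopy 30 x]) (forLoop 30 (block [.natAdd 29 29 29]))

/-- Integer register `25` becomes a random number, uniform below `2 ^ size B`, where `B` is the
content of register `24`. -/
def rand : Program :=
  .seq (block [.natConst 25 0, .natConst 26 1])
    (.loop (.natLe 26 24)
      (.seq (.coin 27) (block [.natAdd 26 26 26, .natAdd 25 25 25, .natAdd 25 25 27])))

/-- A uniformly random number with `l` binary digits. -/
def bits (l : ℕ) : PMF ℕ :=
  iter (fun _ v => (PMF.uniformOfFintype Bool).map (fun b => v + v + if b then 1 else 0)) 0 l 0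

theorem mul_det (x y : ℕ) (s : Store) (hx : x < 29) (hy : y < 29) (b : ℕ) (hb : s.nat y = b)
    (h8 : s.nat 8 = 1) : Det (mul x y) (6 * b + 7) s
      (fun s' => s'.nat 29 = s.nat x * b ∧ Frame 29 8 s s' ∧ s'.realArr = s.realArr) := by
  refine (Det.seq (Q := fun s' => s'.nat 29 = 0 ∧ s'.nat 30 = b ∧ Frame 29 8 s s' ∧
    s'.realArr = s.realArr) (Det.block _ ?_) fun s' h => (Det.forLoop
      (J := fun i s' => s'.nat 29 = s.nat x * i ∧ Frame 29 8 s s' ∧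
      s'.realArr = s.realArr) b (fun i s1 hi h1 hr h8 => Det.block _ ?_) s'
      ⟨by simp [h.1], h.2.2⟩ h.2.1 ((h.2.2.1.1 8 (by norm_num)).trans h8))).mono ?_
      fun s' h => h.1
  · refine ⟨?_, ?_, ⟨fun z hz => ?_, fun r hr => ?_⟩, ?_⟩
    · simp
    · simp [hb, hy.ne]
    · simp [hz.ne, (show z ≠ 30 by omega)]
    · simp
    · simp
  · obtain ⟨h29, hf, ha⟩ := h1
    have hxx : x ≠ 29 := by omega
    have hxy : x ≠ 30 := by omega
    refine ⟨⟨?_, ⟨fun z hz => ?_, fun r hr => ?_⟩, ?_⟩, ?_, ?_⟩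
    · simp [h29, hxy, hf.1 x hx, mul_add]
    · simp [hz.ne, (show z ≠ 30 by omega), hf.1 z hz]
    · simp [hf.2 r hr]
    · simp [ha]
    · simp; omega
    · simp [h8]
  · simp; omega

theorem pow2_det (x : ℕ) (s : Store) (hx : x < 29) (b : ℕ) (hb : s.nat x = b)
    (h8 : s.nat 8 = 1) : Det (pow2 x) (6 * b + 7) s
      (fun s' => s'.nat 29 = 2 ^ b ∧ Frame 29 8 s s' ∧ s'.realArr = s.realArr) := by
  refine (Det.seq (Q := fun s' => s'.nat 29 = 1 ∧ s'.nat 30 = b ∧ Frame 29 8 s s' ∧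
    s'.realArr = s.realArr) (Det.block _ ?_) fun s' h => (Det.forLoop
      (J := fun i s' => s'.nat 29 = 2 ^ i ∧ Frame 29 8 s s' ∧
      s'.realArr = s.realArr) b (fun i s1 hi h1 hr h8 => Det.block _ ?_) s'
      ⟨by simp [h.1], h.2.2⟩ h.2.1 ((h.2.2.1.1 8 (by norm_num)).trans h8))).mono ?_
      fun s' h => h.1
  · refine ⟨?_, ?_, ⟨fun z hz => ?_, fun r hr => ?_⟩, ?_⟩
    · simp
    · simp [hb, hx.ne]
    · simp [hz.ne, (show z ≠ 30 by omega)]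
    · simp
    · simp
  · obtain ⟨h29, hf, ha⟩ := h1
    refine ⟨⟨?_, ⟨fun z hz => ?_, fun r hr => ?_⟩, ?_⟩, ?_, ?_⟩
    · simp [h29, pow_succ, mul_two]
    · simp [hz.ne, (show z ≠ 30 by omega), hf.1 z hz]
    · simp [hf.2 r hr]
    · simp [ha]
    · simp; omega
    · simp [h8]
  · simp; omega

theorem rand_run (s : Store) (B : ℕ) (hB : s.nat 24 = B) :
    Run rand (10 * B.size + 7) s (bits B.size)
      (fun v s' => s'.nat 25 = v ∧ Frame 25 8 s s' ∧ s'.realArr = s.realArr) := by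
  refine (Det.seq_run (Q := fun s' => s'.nat 25 = 0 ∧ s'.nat 26 = 1 ∧ Frame 25 8 s s' ∧
    s'.realArr = s.realArr) (Det.block _ ?_) fun s' h =>
    (Run.loop (t := 1 + 7 + 1)
      (J := fun i v s' => s'.nat 26 = 2 ^ i ∧ s'.nat 25 = v ∧ Frame 25 8 s s' ∧
      s'.realArr = s.realArr) B.size ?_ ?_ 0 s' ⟨by simp [h.2.1], h.1, h.2.2⟩)).mono ?_
      fun v s' h => h.2
  · refine ⟨?_, ?_, ⟨fun z hz => ?_, fun r hr => ?_⟩, ?_⟩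
    · simp
    · simp
    · simp [hz.ne, (show z ≠ 26 by omega)]
    · simp
    · simp
  · rintro i v s1 hi ⟨h26, h25, hf, ha⟩
    constructor
    · simp only [Test.Holds, h26, hf.1 24 (by norm_num), hB]
      -- `2 ^ i ≤ B` is equivalent to `i < B.size`, so the loop tosses exactly `B.size` coins.
      exact Nat.lt_size.1 hi
    · refine Run.seq_det (R := fun v' s' => ∃ b : Bool, v' = v + v + (if b then 1 else 0) ∧
        s' = s1.setNat 27 (if b then 1 else 0))
        (Run.map (Run.coin (R' := fun b s' => s' = s1.setNat 27 (if b then 1 else 0)) 27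
          fun b => rfl) _ fun b s' h => ⟨b, rfl, h⟩) ?_
      rintro _ _ ⟨b, rfl, rfl⟩
      refine Det.block _ ⟨?_, ?_, ⟨fun z hz => ?_, fun r hr => ?_⟩, ?_⟩
      · simp [h26, pow_succ, mul_two]
      · simp [h25]
      · simp [hz.ne, (show z ≠ 26 by omega), (show z ≠ 27 by omega),
          hf.1 z hz]
      · simp [hf.2 r hr]
      · simp [ha]
  · rintro v s1 ⟨h26, h25, hf, ha⟩
    simp only [Test.Holds, h26, hf.1 24 (by norm_num), hB]
    rw [← Nat.lt_size]
    exact lt_irrefl _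
  · simp; omega

/-! ### The selection of far points -/

/-- Squared distance of point `u` to the nearest of the points `n, …, n + max k 1 - 1`. -/
def minSqDist {d : ℕ} (X : ℕ → Point d) (n : ℕ) : ℕ → ℕ → ℝ
  | 0, u => ‖X u - X n‖ ^ 2
  | k + 1, u => min (minSqDist X n k u) (‖X u - X (n + k)‖ ^ 2)

/-- Real array `0` contains the points `X`. -/
def Stored {d : ℕ} (X : ℕ → Point d) (s : Store) : Prop :=
  ∀ i (c : Fin d), s.realArr 0 (i * d + c) = X i c

/-- Real register `5` becomes the squared distance of the points of array `0` that start in the cells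
given by the integer registers `20` and `19`. -/
def sqDist : Program :=
  .seq (block [.realConst 5 0, .natCopy 21 1, .natCopy 22 20, .natCopy 23 19])
    (forLoop 21 (block [.realLoad 6 0 22, .realLoad 7 0 23, .realSub 6 6 7, .realMul 6 6 6,
      .realAdd 5 5 6, .natAdd 22 22 8, .natAdd 23 23 8]))

theorem sqDist_det {d : ℕ} (X : ℕ → Point d) (s : Store) (hX : Stored X s) (h1 : s.nat 1 = d)
    (h8 : s.nat 8 = 1) (i j : ℕ) (hi : s.nat 20 = i * d) (hj : s.nat 19 = j * d) :
    Det sqDist (18 * d + 11) s (fun s' => s'.real 5 = ‖X i - X j‖ ^ 2 ∧ Frame 21 5 s s' ∧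
      s'.realArr = s.realArr) := by
  refine (Det.seq (Q := fun s' => s'.real 5 = 0 ∧ s'.nat 21 = d ∧ s'.nat 22 = i * d ∧
    s'.nat 23 = j * d ∧ Frame 21 5 s s' ∧ s'.realArr = s.realArr) (Det.block _ ?_)
    fun s' h => (Det.forLoop (J := fun c s' => s'.real 5 = ∑ c ∈ range c,
      (s.realArr 0 (i * d + c) - s.realArr 0 (j * d + c)) ^ 2 ∧ s'.nat 22 = i * d + c ∧
      s'.nat 23 = j * d + c ∧ Frame 21 5 s s' ∧ s'.realArr = s.realArr) d
      (fun c s1 hi h1 hr h8 => Det.block _ ?_) s' ⟨by simp [h.1], h.2.2⟩ h.2.1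
      ((h.2.2.2.2.1.1 8 (by norm_num)).trans h8))).mono ?_ ?_
  · refine ⟨?_, ?_, ?_, ?_, ⟨fun z hz => ?_, fun r hr => ?_⟩, ?_⟩
    · simp
    · simp [h1]
    · simp [hi]
    · simp [hj]
    · simp [hz.ne, (show z ≠ 22 by omega),
        (show z ≠ 23 by omega)]
    · simp [hr.ne]
    · simp
  · obtain ⟨h5, h22, h23, hf, ha⟩ := h1
    refine ⟨⟨?_, ?_, ?_, ⟨fun z hz => ?_, fun r hr => ?_⟩, ?_⟩, ?_, ?_⟩
    · simp [h5, h22, h23, ha, sum_range_succ, sq]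
    · simp [h22, h8, add_assoc]
    · simp [h23, h8, add_assoc]
    · simp [hz.ne, (show z ≠ 22 by omega),
        (show z ≠ 23 by omega), hf.1 z hz]
    · simp [hr.ne, (show r ≠ 6 by omega),
        (show r ≠ 7 by omega), hf.2 r hr]
    · simp [ha]
    · simp; omega
    · simp [h8]
  · simp; omega
  · rintro s' ⟨⟨h5, -, -, h⟩, -⟩
    refine ⟨?_, h⟩
    rw [h5, EuclideanSpace.real_norm_sq_eq, Finset.sum_range]
    exact Finset.sum_congr rfl fun c _ => by rw [hX, hX]; rfl

/-- The instruction writes no integer register below `a` and no real register below `b`. -/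
def Instr.above (a b : ℕ) : Instr → Bool
  | natConst x _ | natCopy x _ | natAdd x _ _ | natSub x _ _ | natLoad x _ _ => a ≤ x
  | realConst r _ | realOfNat r _ | realCopy r _ | realAdd r _ _ | realSub r _ _ | realMul r _ _
  | realDiv r _ _ | realLoad r _ _ => b ≤ r
  | natStore _ _ _ | realStore _ _ _ => true

theorem Frame.refl (a b : ℕ) (s : Store) : Frame a b s s := ⟨fun _ _ => rfl, fun _ _ => rfl⟩

theorem Frame.setNat {a b x : ℕ} (s : Store) (v : ℕ) (h : a ≤ x) : Frame a b s (s.setNat x v) :=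
  ⟨fun z hz => by simp [(show z ≠ x by omega)], fun _ _ => rfl⟩

theorem Frame.exec {a b : ℕ} (o : Instr) (s : Store) (h : o.above a b = true) :
    Frame a b s (o.exec s) := by
  cases o <;> simp only [Instr.above, decide_eq_true_eq] at h <;>
    refine ⟨fun z hz => ?_, fun z hz => ?_⟩ <;>
    first
    | rfl
    | exact Function.update_of_ne (by omega) _ _

/-- The hypothesis is a Boolean computation, so for a concrete block it is closed by `rfl`. -/
theorem Frame.execs {a b : ℕ} (l : List Instr) (s : Store)
    (h : l.all (Instr.above a b) = true) :
    Frame a b s (l.foldl (fun s o => o.exec s) s) := by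
  induction l generalizing s with
  | nil => exact Frame.refl _ _ _
  | cons o l ih =>
    simp only [List.all_cons, Bool.and_eq_true] at h
    exact (Frame.exec o s h.1).trans (ih _ h.2)

/-- The registers that are constant during the computation, and the points. -/
structure Env {d : ℕ} (n k m L : ℕ) (X : ℕ → Point d) (s : Store) : Prop where
  nat_n : s.nat 0 = n
  nat_d : s.nat 1 = d
  nat_k : s.nat 2 = k
  nat_m : s.nat 3 = m
  nat_L : s.nat 4 = L
  nat_kd : s.nat 6 = k * d
  nat_nd : s.nat 7 = n * d
  nat_one : s.nat 8 = 1
  real_m : s.real 2 = m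
  stored : Stored X s

/-! ### Nearest centers, tournaments and the draw of one point -/

section

variable {d n k m L : ℕ} {X : ℕ → Point d}

theorem Env.of_frame {X' : ℕ → Point d} {a b : ℕ} {s s' : Store} (h : Env n k m L X s)
    (hf : Frame a b s s') (hX : Stored X' s') (ha : 9 ≤ a := by omega) (hb : 3 ≤ b := by omega) :
    Env n k m L X' s' where
  nat_n := (hf.1 0 (by omega)).trans h.nat_n
  nat_d := (hf.1 1 (by omega)).trans h.nat_d
  nat_k := (hf.1 2 (by omega)).trans h.nat_k
  nat_m := (hf.1 3 (by omega)).trans h.nat_m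
  nat_L := (hf.1 4 (by omega)).trans h.nat_L
  nat_kd := (hf.1 6 (by omega)).trans h.nat_kd
  nat_nd := (hf.1 7 (by omega)).trans h.nat_nd
  nat_one := (hf.1 8 (by omega)).trans h.nat_one
  real_m := (hf.2 2 (by omega)).trans h.real_m
  stored := hX

theorem Env.of_frame_eq {a b : ℕ} {s s' : Store} (h : Env n k m L X s)
    (hf : Frame a b s s') (hX : s'.realArr = s.realArr) (ha : 9 ≤ a := by omega)
    (hb : 3 ≤ b := by omega) : Env n k m L X s' :=
  h.of_frame hf (by rw [Stored, hX]; exact h.stored) ha hb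

/-- Real register `4` becomes the squared distance to the nearest center of the point whose number
is in the integer register `17`. -/
def nearest : Program :=
  .seq (mul 17 1) (.seq (block [.natCopy 20 29, .natCopy 19 7]) (.seq sqDist
    (.seq (block [.realCopy 4 5, .natCopy 18 2])
      (forLoop 18 (.seq sqDist (.seq (.ite (.realLe 5 4) (block [.realCopy 4 5]) skip)
        (block [.natAdd 19 19 1])))))))

/-- The distance to the first center initializes the minimum, and the loop computes it once more.
`minSqDist` has the same redundancy, which avoids a minimum over an empty family. -/
theorem nearest_det (s : Store) (hE : Env n k m L X s) (u : ℕ) (hu : s.nat 17 = u) :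
    Det nearest ((k + 2) * (18 * d + 23)) s (fun s' => s'.real 4 = minSqDist X n k u ∧
      Frame 18 4 s s' ∧ s'.realArr = s.realArr) := by
  refine (Det.seq (mul_det 17 1 s (by norm_num) (by norm_num) d hE.nat_d hE.nat_one) fun s1 h1 =>
    Det.seq (Q := fun s' => s'.nat 20 = u * d ∧ s'.nat 19 = n * d ∧ Frame 18 4 s s' ∧
      s'.realArr = s.realArr) (Det.block _ ?_) fun s2 h2 =>
    Det.seq (sqDist_det X s2 (hE.of_frame_eq h2.2.2.1 h2.2.2.2).stored
      (hE.of_frame_eq h2.2.2.1 h2.2.2.2).nat_d (hE.of_frame_eq h2.2.2.1 h2.2.2.2).nat_one u n h2.1 h2.2.1)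
      fun s3 h3 =>
    Det.seq (Q := fun s' => s'.real 4 = ‖X u - X n‖ ^ 2 ∧ s'.nat 18 = k ∧ s'.nat 20 = u * d ∧
      s'.nat 19 = n * d ∧ Frame 18 4 s s' ∧ s'.realArr = s.realArr) (Det.block _ ?_) fun s4 h4 =>
    Det.forLoop (t := 18 * d + 20) (J := fun i s' => s'.real 4 = minSqDist X n i u ∧
      s'.nat 20 = u * d ∧ s'.nat 19 = (n + i) * d ∧ Frame 18 4 s s' ∧ s'.realArr = s.realArr) k
      (fun i s1 hi h1 hr h8 => ?_) s4 ⟨h4.1, h4.2.2.1, by simpa using h4.2.2.2.1, h4.2.2.2.2⟩ h4.2.1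
      ((h4.2.2.2.2.1.1 8 (by norm_num)).trans hE.nat_one)).mono ?_
      fun s' h => ⟨h.1.1, h.1.2.2.2⟩
  · refine ⟨?_, ?_, (h1.2.1.trans (Frame.execs (a := 18) (b := 4) _ s1 rfl)), ?_⟩
    · simp [h1.1, hu]
    · simp [h1.2.1.1 7 (by norm_num), hE.nat_nd]
    · simp [h1.2.2]
  · have hf : Frame 18 4 s s3 := h2.2.2.1.trans h3.2.1
    refine ⟨?_, ?_, ?_, ?_, hf.trans (Frame.execs (a := 18) (b := 4) _ s3 rfl), ?_⟩
    · simp [h3.1]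
    · simp [hf.1 2, hE.nat_k]
    · simp [h3.2.1.1 20, h2.1]
    · simp [h3.2.1.1 19, h2.2.1]
    · simp [h3.2.2, h2.2.2.2]
  · obtain ⟨h4, h20, h19, hf, ha⟩ := h1
    have hf' : Frame 18 4 s (s1.setNat 18 (k - i - 1)) :=
      hf.trans (Frame.setNat (a := 18) (b := 4) s1 (k - i - 1) le_rfl)
    have hE' := hE.of_frame_eq hf' (by simpa using ha)
    refine (Det.seq (sqDist_det X _ hE'.stored hE'.nat_d hE'.nat_one u (n + i) (by simpa using h20)
      (by simpa using h19)) fun s5 h5 => Det.seq (t := 4) (Q := fun s' =>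
        s'.real 4 = minSqDist X n (i + 1) u ∧ s'.nat 20 = u * d ∧ s'.nat 19 = (n + i) * d ∧
        s'.nat 18 = k - i - 1 ∧
        Frame 18 4 s s' ∧ s'.realArr = s.realArr) ?_ fun s6 h6 => Det.block _ ?_).mono ?_
        fun s' h => h
    · have e4 : s5.real 4 = minSqDist X n i u := by simp [h5.2.1.2 4, h4]
      have e18 : s5.nat 18 = k - i - 1 := by simp [h5.2.1.1 18]
      have e19 : s5.nat 19 = (n + i) * d := by simp [h5.2.1.1 19, h19]
      have e20 : s5.nat 20 = u * d := by simp [h5.2.1.1 20, h20]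
      have ea : s5.realArr = s.realArr := by simp [h5.2.2, ha]
      have ef : Frame 18 4 s s5 := hf'.trans h5.2.1
      refine Det.ite (fun hT => Det.block _ ?_) fun hT => (Det.skip ?_).mono (t' := 3) (by norm_num)
        fun _ h => h
      · simp only [Test.Holds, e4, h5.1] at hT
        refine ⟨?_, ?_, ?_, ?_, ef.trans (Frame.execs (a := 18) (b := 4) _ s5 rfl), ?_⟩
        · simp [h5.1, minSqDist, hT]
        · simpa using e20
        · simpa using e19
        · simpa using e18
        · simpa using ea
      · simp only [Test.Holds, e4, h5.1] at hT
        refine ⟨?_, e20, e19, e18, ef, ea⟩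
        rw [e4, minSqDist, min_eq_left (le_of_not_ge hT)]
    · obtain ⟨e4, e20, e19, e18, ef, ea⟩ := h6
      refine ⟨⟨?_, ?_, ?_, ef.trans (Frame.execs (a := 18) (b := 4) _ s6 rfl), ?_⟩, ?_, ?_⟩
      · simpa using e4
      · simpa using e20
      · simp [e19, ef.1 1, hE.nat_d]; ring
      · simpa using ea
      · simp [e18]; omega
      · simp [ef.1 8, hE.nat_one]
    · simp
  · simp; ring_nf; omega

/-- The effect on the current selection (a point number and a squared distance) of drawing `u`. -/
def challenge (X : ℕ → Point d) (n k u : ℕ) (σ : ℕ × ℝ) : ℕ × ℝ :=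
  open Classical in
  if u < n ∧ σ.2 ≤ minSqDist X n k u then (u, minSqDist X n k u) else σ

/-- Draw a random point and select it if it is as far from the centers as the selected one. -/
def tournamentStep : Program :=
  .seq (block [.natCopy 24 0]) (.seq rand (.seq (block [.natCopy 17 25])
    (.ite (.natLe 0 17) skip (.seq nearest
      (.ite (.realLe 3 4) (block [.natCopy 16 17, .realCopy 3 4]) skip)))))

theorem tournamentStep_run (s : Store) (hE : Env n k m L X s) (σ : ℕ × ℝ) (h16 : s.nat 16 = σ.1)
    (h0 : s.real 3 = σ.2) :
    Run tournamentStep ((k + 2) * (18 * d + 23) + 10 * n.size + 40) s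
      ((bits n.size).map (fun u => challenge X n k u σ)) (fun σ' s' => s'.nat 16 = σ'.1 ∧
        s'.real 3 = σ'.2 ∧ Frame 16 3 s s' ∧ s'.realArr = s.realArr) := by
  refine (Run.map (R := fun u s' => s'.nat 16 = (challenge X n k u σ).1 ∧
        s'.real 3 = (challenge X n k u σ).2 ∧ Frame 16 3 s s' ∧ s'.realArr = s.realArr)
      (Det.seq_run (Q := fun s' => s'.nat 24 = n ∧ Frame 17 4 s s' ∧ s'.realArr = s.realArr)
        (Det.block _ ?_) fun s1 h1 => Run.seq_det (rand_run s1 n h1.1) fun u s2 h2 =>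
        Det.seq (Q := fun s' => s'.nat 17 = u ∧ Frame 17 4 s s' ∧ s'.realArr = s.realArr)
          (Det.block _ ?_) fun s3 h3 =>
        Det.ite (t := (k + 2) * (18 * d + 23) + 7) (fun hT => (Det.skip ?_).mono ?_ fun _ h => h)
          fun hT => (Det.seq (nearest_det s3 (hE.of_frame_eq h3.2.1 h3.2.2) u h3.1) fun s4 h4 =>
            Det.ite (t := 5) (fun hT' => Det.block _ ?_) fun hT' => (Det.skip ?_).mono (by norm_num)
              fun _ h => h).mono ?_ fun _ h => h) _ ?_).mono ?_ fun _ _ h => h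
  · exact ⟨by simp [hE.nat_n], Frame.execs (a := 17) (b := 4) _ s rfl, by simp⟩
  · have hf : Frame 17 4 s s2 := h1.2.1.trans h2.2.1
    refine ⟨?_, hf.trans (Frame.execs (a := 17) (b := 4) _ s2 rfl), ?_⟩
    · simp [h2.1]
    · simp [h2.2.2, h1.2.2]
  · simp only [Test.Holds, h3.1, h3.2.1.1 0 (by norm_num), hE.nat_n] at hT
    -- Random numbers are uniform below a power of two; those that are not numbers of points count
    -- as void rounds.
    have : challenge X n k u σ = σ := if_neg fun h => absurd h.1 (by omega)
    rw [this]
    exact ⟨(h3.2.1.1 16 (by norm_num)).trans h16, (h3.2.1.2 3 (by norm_num)).trans h0,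
      h3.2.1.trans (Frame.refl 17 4 _), h3.2.2⟩
  · omega
  · simp only [Test.Holds, h3.1, h3.2.1.1 0 (by norm_num), hE.nat_n] at hT
    have e3 : s4.real 3 = σ.2 := by rw [h4.2.1.2 3 (by norm_num), h3.2.1.2 3 (by norm_num), h0]
    simp only [Test.Holds, h4.1, e3] at hT'
    rw [show challenge X n k u σ = _ from if_pos ⟨by omega, hT'⟩]
    refine ⟨?_, ?_, (h3.2.1.trans h4.2.1 (a'' := 17) (b'' := 4)).trans
      (Frame.execs (a := 16) (b := 3) _ s4 rfl), ?_⟩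
    · simp [h4.2.1.1 17, h3.1]
    · simp [h4.1]
    · simp [h4.2.2, h3.2.2]
  · have e3 : s4.real 3 = σ.2 := by rw [h4.2.1.2 3 (by norm_num), h3.2.1.2 3 (by norm_num), h0]
    simp only [Test.Holds, h4.1, e3] at hT'
    rw [show challenge X n k u σ = σ from if_neg fun h => hT' h.2]
    refine ⟨?_, e3, h3.2.1.trans h4.2.1, h4.2.2.trans h3.2.2⟩
    rw [h4.2.1.1 16 (by norm_num), h3.2.1.1 16 (by norm_num), h16]
  · omega
  · exact fun _ _ h => h
  · simp; omega

/-- The distribution of the selected point. -/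
def sampleDist (X : ℕ → Point d) (n k L : ℕ) : PMF ℕ :=
  (bits L.size).bind fun v => (bits k.size).bind fun c =>
    (iter (fun _ σ => (bits n.size).map (fun u => challenge X n k u σ)) 0
      (2 ^ (if v ≤ L then v else 0) - 1) (n + c, 0)).map Prod.fst

/-- Integer register `16` becomes the number of a randomly selected point or center. -/
def sample : Program :=
  .seq (block [.natCopy 24 4]) (.seq rand (.seq (.ite (.natLe 25 4) skip (block [.natConst 25 0]))
    (.seq (pow2 25) (.seq (block [.natSub 15 29 8, .natCopy 24 2]) (.seq rand
      (.seq (block [.natAdd 16 0 25, .realConst 3 0]) (forLoop 15 tournamentStep)))))))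

/-- A bound for the running time of `sample`. -/
def sampleTime (n d k : ℕ) : ℕ :=
  2 * n * ((k + 2) * (18 * d + 23) + 10 * n.size + 40 + 3) + 16 * n.size + 10 * k.size + 60

/-- Rounding a range up to a power of two at most doubles it. This costs a factor `2` in time and in
probability. -/
theorem two_pow_size_le {n : ℕ} (hn : 1 ≤ n) : 2 ^ n.size ≤ 2 * n := by
  have h : n.size - 1 < n.size := by
    have := Nat.size_pos.2 hn
    omega
  have := Nat.lt_size.1 h
  calc 2 ^ n.size = 2 ^ (n.size - 1 + 1) := by congr 1; omega
    _ = 2 * 2 ^ (n.size - 1) := by rw [pow_succ]; ring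
    _ ≤ 2 * n := by omega

theorem size_le_self (n : ℕ) : n.size ≤ n := Nat.size_le.2 Nat.lt_two_pow_self

theorem sample_run (s : Store) (hE : Env n k m n.size X s) (hn : 1 ≤ n) :
    Run sample (sampleTime n d k) s (sampleDist X n k n.size)
      (fun b s' => s'.nat 16 = b ∧ Frame 15 3 s s' ∧ s'.realArr = s.realArr) := by
  have hL := size_le_self n.size
  refine (Det.seq_run (t := 3) (Q := fun s' => s'.nat 24 = n.size ∧ Frame 15 3 s s' ∧
      s'.realArr = s.realArr) (Det.block _ ?_) fun s1 h1 =>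
    Run.seq (t := 10 * n.size.size + 7)
      (t' := 5 + n.size * 6 + 10 * k.size + 2 * n * ((k + 2) * (18 * d + 23) + 10 * n.size + 40 + 3) + 30)
      (rand_run s1 n.size h1.1) fun v s2 h2 => ?_).mono ?_ fun _ _ h => h
  · exact ⟨by simp [hE.nat_L], Frame.execs (a := 15) (b := 3) _ s rfl, by simp⟩
  · have hf2 : Frame 15 3 s s2 := h1.2.1.trans h2.2.1
    have ha2 : s2.realArr = s.realArr := h2.2.2.trans h1.2.2
    set w := if v ≤ n.size then v else 0 with hw
    have hwn : w ≤ n.size := by rw [hw]; split_ifs <;> omega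
    -- A tournament has at most `2 n` rounds. This is the source of the factor `n` in the running
    -- time.
    have hwp : 2 ^ w - 1 ≤ 2 * n :=
      (Nat.sub_le _ _).trans ((Nat.pow_le_pow_right two_pos hwn).trans (two_pow_size_le hn))
    refine (Det.seq_run (t := 4) (Q := fun s' => s'.nat 25 = w ∧ Frame 15 3 s s' ∧
      s'.realArr = s.realArr) (Det.ite (t := 3) (fun hT => (Det.skip ?_).mono (by norm_num)
        fun _ h => h) fun hT => Det.block _ ?_) fun s3 h3 =>
      Det.seq_run (pow2_det 25 s3 (by norm_num) w h3.1
        ((h3.2.1.1 8 (by norm_num)).trans hE.nat_one)) fun s4 h4 =>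
      Det.seq_run (Q := fun s' => s'.nat 15 = 2 ^ w - 1 ∧ s'.nat 24 = k ∧ Frame 15 3 s s' ∧
        s'.realArr = s.realArr) (Det.block _ ?_) fun s5 h5 =>
      Run.seq (rand_run s5 k h5.2.1) fun c s6 h6 =>
      Det.seq_run (Q := fun s' => s'.nat 15 = 2 ^ w - 1 ∧ s'.nat 16 = n + c ∧ s'.real 3 = 0 ∧
        Frame 15 3 s s' ∧ s'.realArr = s.realArr) (Det.block _ ?_) fun s7 h7 =>
      Run.map ((Run.forLoop (J := fun i σ s' => s'.nat 16 = σ.1 ∧ s'.real 3 = σ.2 ∧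
          Frame 15 3 s s' ∧ s'.realArr = s.realArr) (2 ^ w - 1)
          (fun i σ s1 hi h1 hr h8 => (tournamentStep_run (m := m) (L := n.size) _ ?_ σ ?_ ?_).mono le_rfl ?_)
          (n + c, 0) s7 ⟨h7.2.1, h7.2.2.1, h7.2.2.2⟩ h7.1
          ((h7.2.2.2.1.1 8 (by norm_num)).trans hE.nat_one)).mono
          (Nat.add_le_add_right (Nat.mul_le_mul_right _ hwp) 1) fun _ _ h => h) Prod.fst
          fun σ s' h => ⟨h.1.1, h.1.2.2⟩).mono ?_ fun _ _ h => h
    · simp only [Test.Holds, h2.1, hf2.1 4 (by norm_num), hE.nat_L] at hT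
      exact ⟨by rw [h2.1, hw, if_pos hT], hf2, ha2⟩
    · simp only [Test.Holds, h2.1, hf2.1 4 (by norm_num), hE.nat_L] at hT
      exact ⟨by simp [hw, hT], hf2.trans (Frame.execs (a := 15) (b := 3) _ s2 rfl), by simp [ha2]⟩
    · have hf : Frame 15 3 s s4 := h3.2.1.trans h4.2.1
      refine ⟨?_, ?_, hf.trans (Frame.execs (a := 15) (b := 3) _ s4 rfl), ?_⟩
      · simp [h4.1, hf.1 8, hE.nat_one]
      · simp [hf.1 2, hE.nat_k]
      · simp [h4.2.2, h3.2.2]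
    · have hf : Frame 15 3 s s6 := h5.2.2.1.trans h6.2.1
      refine ⟨?_, ?_, ?_, hf.trans (Frame.execs (a := 15) (b := 3) _ s6 rfl), ?_⟩
      · simp [h6.2.1.1 15, h5.1]
      · simp [hf.1 0, hE.nat_n, h6.1]
      · simp
      · simp [h6.2.2, h5.2.2.2]
    · exact (hE.of_frame_eq h1.2.2.1 h1.2.2.2).of_frame_eq
        (Frame.setNat (a := 15) (b := 3) s1 _ le_rfl) rfl
    · simpa using h1.1
    · exact h1.2.1
    · rintro σ' s' ⟨e16, e3, ef, ea⟩
      refine ⟨⟨e16, e3, ?_, ?_⟩, ?_, ?_⟩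
      · exact (h1.2.2.1.trans (Frame.setNat (a := 15) (b := 3) s1 _ le_rfl) (a'' := 15)
          (b'' := 3)).trans ef
      · simpa [ea] using h1.2.2.2
      · rw [ef.1 15 (by norm_num)]
        simp
        omega
      · simp [ef.1 8, h8]
    · have := Nat.mul_le_mul_left 6 hwn
      simp
      omega
  · simp [sampleTime]; omega

end

section

variable {d n k m L : ℕ} {X : ℕ → Point d}

theorem Frame.setNat_right {a b x v : ℕ} {s s' : Store} (h : Frame a b s s') (hx : a ≤ x) :
    Frame a b s (s'.setNat x v) :=
  h.trans (Frame.setNat (a := a) (b := b) s' v hx)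

/-! ### Finding one center -/

/-- Real array `2` contains the vector `z`. -/
def Acc (z : Point d) (s : Store) : Prop := ∀ c : Fin d, s.realArr 2 c = z c

theorem cell_eq_iff {i j a b d : ℕ} (ha : a < d) (hb : b < d) :
    i * d + a = j * d + b ↔ i = j ∧ a = b := by
  constructor
  · intro h
    have hd : 0 < d := by omega
    have h1 := congrArg (· / d) h
    have h2 := congrArg (· % d) h
    simp only [mul_comm _ d, Nat.mul_add_mod, Nat.mod_eq_of_lt ha, Nat.mod_eq_of_lt hb] at h2
    simp only [mul_comm _ d, Nat.mul_add_div hd, Nat.div_eq_of_lt ha, Nat.div_eq_of_lt hb] at h1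
    exact ⟨by simpa using h1, h2⟩
  · rintro ⟨rfl, rfl⟩
    rfl

/-- Array `2` becomes `0`. -/
def clearAcc : Program :=
  .seq (block [.natCopy 21 1, .natConst 22 0, .realConst 5 0])
    (forLoop 21 (block [.realStore 2 22 5, .natAdd 22 22 8]))

theorem clearAcc_det (s : Store) (h1 : s.nat 1 = d) (h8 : s.nat 8 = 1) :
    Det clearAcc (8 * d + 9) s (fun s' => Acc (0 : Point d) s' ∧ Frame 16 3 s s' ∧
      s'.realArr 0 = s.realArr 0 ∧ s'.realArr 1 = s.realArr 1) := by
  refine (Det.seq (Q := fun s' => s'.nat 21 = d ∧ s'.nat 22 = 0 ∧ s'.real 5 = 0 ∧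
    Frame 16 3 s s' ∧ s'.realArr 0 = s.realArr 0 ∧ s'.realArr 1 = s.realArr 1) (Det.block _ ?_)
    fun s1 h1 => Det.forLoop (J := fun i s' => (∀ c < i, s'.realArr 2 c = 0) ∧ s'.nat 22 = i ∧
      s'.real 5 = 0 ∧ Frame 16 3 s s' ∧ s'.realArr 0 = s.realArr 0 ∧ s'.realArr 1 = s.realArr 1) d
      (fun i s2 hi h2 hr h8 => Det.block _ ?_) s1
      ⟨fun c hc => absurd hc (by omega), h1.2⟩ h1.1 ((h1.2.2.2.1.1 8 (by norm_num)).trans h8)).mono ?_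
      fun s' h => ⟨fun c => h.1.1 c c.2, h.1.2.2.2⟩
  · refine ⟨?_, ?_, ?_, Frame.execs (a := 16) (b := 3) _ s rfl, ?_, ?_⟩ <;> simp [h1]
  · obtain ⟨hc, h22, h5, hf, ha, hb⟩ := h2
    have hf' : Frame 16 3 s (s2.setNat 21 (d - i - 1)) := hf.setNat_right (by norm_num)
    refine ⟨⟨fun c hci => ?_, ?_, ?_, hf'.trans (Frame.execs (a := 16) (b := 3) _ _ rfl), ?_, ?_⟩,
      ?_, ?_⟩
    · rcases (Nat.lt_succ_iff_lt_or_eq.1 hci) with hci | rfl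
      · simp [h22, h5, hci.ne, hc c hci]
      · simp [h22, h5]
    · simp [h22, h8]
    · simp [h5]
    · simp [ha]
    · simp [hb]
    · simp; omega
    · simp [h8]
  · simp; omega

/-- Add to array `2` the point whose number is in the integer register `16`. -/
def addAcc : Program :=
  .seq (mul 16 1) (.seq (block [.natCopy 21 1, .natCopy 22 29, .natConst 23 0])
    (forLoop 21 (block [.realLoad 5 0 22, .realLoad 6 2 23, .realAdd 6 6 5, .realStore 2 23 6,
      .natAdd 22 22 8, .natAdd 23 23 8])))

theorem addAcc_det (s : Store) (hE : Env n k m L X s) (b : ℕ) (h16 : s.nat 16 = b) (z : Point d)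
    (hz : Acc z s) :
    Det addAcc (22 * d + 17) s (fun s' => Acc (z + X b) s' ∧ Frame 15 3 s s' ∧
      s'.realArr 0 = s.realArr 0 ∧ s'.realArr 1 = s.realArr 1) := by
  refine (Det.seq (mul_det 16 1 s (by norm_num) (by norm_num) d hE.nat_d hE.nat_one) fun s0 h0 =>
    Det.seq (Q := fun s' => s'.nat 21 = d ∧ s'.nat 22 = b * d ∧ s'.nat 23 = 0 ∧ s'.realArr 2 = s.realArr 2 ∧
    Frame 15 3 s s' ∧ s'.realArr 0 = s.realArr 0 ∧ s'.realArr 1 = s.realArr 1) (Det.block _ ?_)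
    fun s1 h1 => Det.forLoop (J := fun i s' => (∀ c : Fin d, s'.realArr 2 c =
        if (c : ℕ) < i then z c + X b c else z c) ∧ s'.nat 22 = b * d + i ∧ s'.nat 23 = i ∧
      Frame 15 3 s s' ∧ s'.realArr 0 = s.realArr 0 ∧ s'.realArr 1 = s.realArr 1) d
      (fun i s2 hi h2 hr h8 => Det.block _ ?_) s1
      ⟨fun c => by simpa [h1.2.2.2.1] using hz c, h1.2.1, h1.2.2.1, h1.2.2.2.2⟩ h1.1
        ((h1.2.2.2.2.1.1 8 (by norm_num)).trans hE.nat_one)).mono ?_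
      fun s' h => ⟨fun c => by simp [h.1.1 c, c.2], h.1.2.2.2⟩
  · have hf : Frame 15 3 s s0 := h0.2.1.trans (Frame.refl 29 8 _)
    refine ⟨?_, ?_, ?_, ?_, hf.trans (Frame.execs (a := 15) (b := 3) _ s0 rfl), ?_, ?_⟩
    · simp [h0.2.1.1 1, hE.nat_d]
    · simp [h0.1, h16]
    · simp
    · simp [h0.2.2]
    · simp [h0.2.2]
    · simp [h0.2.2]
  · obtain ⟨hc, h22, h23, hf, ha, hb⟩ := h2
    have hf' : Frame 15 3 s (s2.setNat 21 (d - i - 1)) := hf.setNat_right (by norm_num)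
    refine ⟨⟨fun c => ?_, ?_, ?_, hf'.trans (Frame.execs (a := 15) (b := 3) _ _ rfl), ?_, ?_⟩,
      ?_, ?_⟩
    · by_cases hci : (c : ℕ) = i
      · subst hci
        have := hE.stored b c
        simp [h22, h23, ha, hc c, this]
      · have : (c : ℕ) < i + 1 ↔ (c : ℕ) < i := by omega
        simp only [this]
        rw [← hc c]
        simp [h23, hci]
    · simp [h22, h8, add_assoc]
    · simp [h23, h8]
    · simp [ha]
    · simp [hb]
    · simp; omega
    · simp [h8]
  · simp; omega

/-- Write array `2`, divided by the number of samples, to the cells of array `0` that start at the one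
given by the integer register `13`, and advance this register. -/
def storeMean : Program :=
  .seq (block [.natCopy 21 1, .natCopy 22 13, .natConst 23 0])
    (.seq (forLoop 21 (block [.realLoad 5 2 23, .realDiv 5 5 2, .realStore 0 22 5,
      .natAdd 22 22 8, .natAdd 23 23 8])) (block [.natAdd 13 13 1]))

theorem storeMean_det (s : Store) (hE : Env n k m L X s) (j : ℕ) (h13 : s.nat 13 = j * d)
    (z : Point d) (hz : Acc z s) :
    Det storeMean (14 * d + 13) s (fun s' => Env n k m L (Function.update X j ((m : ℝ)⁻¹ • z)) s' ∧
      s'.nat 13 = (j + 1) * d ∧ Frame 13 3 s s' ∧ s'.realArr 1 = s.realArr 1) := by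
  refine (Det.seq (Q := fun s' => s'.nat 21 = d ∧ s'.nat 22 = j * d ∧ s'.nat 23 = 0 ∧
    Frame 14 3 s s' ∧ s'.realArr = s.realArr) (Det.block _ ?_)
    fun s1 h1 => Det.seq (Det.forLoop (J := fun i s' => (∀ j' (c : Fin d), s'.realArr 0 (j' * d + c) =
        if j' = j ∧ (c : ℕ) < i then z c / m else X j' c) ∧ s'.nat 22 = j * d + i ∧ s'.nat 23 = i ∧
      Frame 14 3 s s' ∧ s'.realArr 1 = s.realArr 1 ∧ s'.realArr 2 = s.realArr 2) d
      (fun i s2 hi h2 hr h8 => Det.block _ ?_) s1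
      ⟨fun j' c => by simpa [h1.2.2.2.2] using hE.stored j' c, h1.2.1, h1.2.2.1, h1.2.2.2.1,
        by simp [h1.2.2.2.2], by simp [h1.2.2.2.2]⟩ h1.1
        ((h1.2.2.2.1.1 8 (by norm_num)).trans hE.nat_one)) fun s3 h3 => Det.block _ ?_).mono ?_
      fun s' h => h
  · refine ⟨?_, ?_, ?_, Frame.execs (a := 14) (b := 3) _ s rfl, ?_⟩ <;> simp [hE.nat_d, h13]
  · obtain ⟨hc, h22, h23, hf, ha, hb⟩ := h2
    have hf' : Frame 14 3 s (s2.setNat 21 (d - i - 1)) := hf.setNat_right (by norm_num)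
    refine ⟨⟨fun j' c => ?_, ?_, ?_, hf'.trans (Frame.execs (a := 14) (b := 3) _ _ rfl), ?_, ?_⟩,
      ?_, ?_⟩
    · have hr2 : s2.real 2 = m := (hf.2 2 (by norm_num)).trans hE.real_m
      by_cases hci : j' = j ∧ (c : ℕ) = i
      · obtain ⟨rfl, rfl⟩ := hci
        have := hz c
        simp [h22, h23, hb, this, hr2]
      · have h' : ¬ (j' * d + (c : ℕ) = j * d + i) := fun h => hci ((cell_eq_iff c.2 hi).1 h)
        have : (j' = j ∧ (c : ℕ) < i + 1) ↔ (j' = j ∧ (c : ℕ) < i) := by omega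
        simp only [this]
        rw [← hc j' c]
        simp [h22, h']
    · simp [h22, h8, add_assoc]
    · simp [h23, h8]
    · simp [ha]
    · simp [hb]
    · simp; omega
    · simp [h8]
  · obtain ⟨⟨hc, h22, h23, hf, ha, hb⟩, -⟩ := h3
    have hf' : Frame 13 3 s s3 := hf.trans (Frame.refl 14 3 s3)
    refine ⟨hE.of_frame (hf'.trans (Frame.execs (a := 13) (b := 3) _ _ rfl) : Frame 13 3 s _) ?_,
      ?_, hf'.trans (Frame.execs (a := 13) (b := 3) _ _ rfl), ?_⟩
    · intro j' c
      have := hc j' c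
      by_cases hj : j' = j
      · subst hj
        simp [this, div_eq_inv_mul]
      · simp [this, hj]
    · simp [hf.1 13, h13, hf.1 1, hE.nat_d, add_mul]
    · simp [ha]
  · simp; omega

/-- The mean of `m` random points. -/
def meanDist (X : ℕ → Point d) (n k m L : ℕ) : PMF (Point d) :=
  (iter (fun _ z => (sampleDist X n k L).map (fun b => z + X b)) 0 m 0).map
    (fun z => (m : ℝ)⁻¹ • z)

/-- The points after a new `j`-th center has been found. -/
def roundDist (X : ℕ → Point d) (n k m L j : ℕ) : PMF (ℕ → Point d) :=
  (meanDist X n k m L).map (Function.update X (n + j))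

/-- Find a new center. -/
def round : Program :=
  .seq clearAcc (.seq (block [.natCopy 14 3]) (.seq (forLoop 14 (.seq sample addAcc)) storeMean))

/-- A bound for the running time of `round`. -/
def roundTime (n d k m : ℕ) : ℕ := m * (sampleTime n d k + 22 * d + 21) + 22 * d + 40

theorem round_run (s : Store) (hE : Env n k m n.size X s) (hn : 1 ≤ n) (j : ℕ)
    (h13 : s.nat 13 = (n + j) * d) :
    Run round (roundTime n d k m) s (roundDist X n k m n.size j)
      (fun X' s' => Env n k m n.size X' s' ∧ s'.nat 13 = (n + (j + 1)) * d ∧ Frame 13 3 s s' ∧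
        s'.realArr 1 = s.realArr 1) := by
  rw [roundDist, meanDist, PMF.map_comp]
  rw [← PMF.bind_pure_comp]
  refine (Det.seq_run (clearAcc_det s hE.nat_d hE.nat_one) fun s1 h1 =>
    Det.seq_run (Q := fun s' => s'.nat 14 = m ∧ Acc (0 : Point d) s' ∧ Frame 14 3 s s' ∧
      s'.realArr 0 = s.realArr 0 ∧ s'.realArr 1 = s.realArr 1) (Det.block _ ?_) fun s2 h2 =>
    Run.seq (Run.forLoop (t := sampleTime n d k + (22 * d + 17) + 1) (J := fun i z s' => Acc z s' ∧
      Frame 14 3 s s' ∧ s'.realArr 0 = s.realArr 0 ∧ s'.realArr 1 = s.realArr 1) m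
      (fun i z s1 hi h1 hr h8 => ?_) 0 s2 h2.2 h2.1 ((h2.2.2.1.1 8 (by norm_num)).trans hE.nat_one))
      fun z s3 h3 => (storeMean_det s3 (hE.of_frame h3.1.2.1 ?_) (n + j) ?_ z h3.1.1).run _
        (R := fun X' s' => Env n k m n.size X' s' ∧ s'.nat 13 = (n + (j + 1)) * d ∧ Frame 13 3 s s' ∧
        s'.realArr 1 = s.realArr 1) fun s4 h4 =>
        ⟨h4.1, h4.2.1, h3.1.2.1.trans h4.2.2.1, h4.2.2.2.trans h3.1.2.2.2⟩).mono ?_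
    fun _ _ h => h
  · have hf : Frame 14 3 s s1 := h1.2.1.trans (Frame.refl 16 3 _)
    refine ⟨?_, fun c => ?_, hf.trans (Frame.execs (a := 14) (b := 3) _ _ rfl), ?_, ?_⟩
    · simp [hf.1 3, hE.nat_m]
    · simpa using h1.1 c
    · simp [h1.2.2.1]
    · simp [h1.2.2.2]
  · have hf : Frame 14 3 s (s1.setNat 14 (m - i - 1)) :=
      h1.2.1.trans (Frame.setNat (a := 14) (b := 3) s1 _ le_rfl)
    have hE' : Env n k m n.size X (s1.setNat 14 (m - i - 1)) :=
      hE.of_frame hf fun j c => (congrFun h1.2.2.1 (j * d + c)).trans (hE.stored j c)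
    rw [← PMF.bind_pure_comp]
    refine Run.seq (sample_run _ hE' hn) fun b s4 h4 =>
      (addAcc_det s4 (hE'.of_frame_eq h4.2.1 h4.2.2) b h4.1 z ?_).run _ fun s5 h5 =>
      ⟨⟨h5.1, ?_, ?_, ?_⟩, ?_, ?_⟩
    · intro c
      rw [h4.2.2]
      exact h1.1 c
    · exact hf.trans (h4.2.1.trans h5.2.1 : Frame 15 3 _ _)
    · rw [h5.2.2.1, h4.2.2]
      exact h1.2.2.1
    · rw [h5.2.2.2, h4.2.2]
      exact h1.2.2.2
    · rw [h5.2.1.1 14 (by norm_num), h4.2.1.1 14 (by norm_num)]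
      simp
      omega
    · rw [h5.2.1.1 8 (by norm_num), h4.2.1.1 8 (by norm_num)]
      simpa using h8
  · rw [Stored, h3.1.2.2.1]
    exact hE.stored
  · exact (h3.1.2.1.1 13 (by norm_num)).trans h13
  · simp [roundTime]; ring_nf; omega

/-! ### Finding all centers -/

/-- The points after all centers have been replaced. -/
def attemptDist (X : ℕ → Point d) (n k m L : ℕ) : PMF (ℕ → Point d) :=
  iter (fun j X => roundDist X n k m L j) 0 k X

/-- Find new centers. -/
def attempt : Program :=
  .seq (block [.natCopy 13 7, .natCopy 12 2]) (forLoop 12 round)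

theorem attempt_run (s : Store) (hE : Env n k m n.size X s) (hn : 1 ≤ n) :
    Run attempt (k * (roundTime n d k m + 3) + 7) s (attemptDist X n k m n.size)
      (fun X' s' => Env n k m n.size X' s' ∧ Frame 12 3 s s' ∧
        s'.realArr 1 = s.realArr 1) := by
  refine (Det.seq_run (Q := fun s' => s'.nat 13 = n * d ∧ s'.nat 12 = k ∧ Frame 12 3 s s' ∧
      s'.realArr = s.realArr) (Det.block _ ?_) fun s1 h1 =>
    Run.forLoop (J := fun j X' s' => Env n k m n.size X' s' ∧ s'.nat 13 = (n + j) * d ∧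
      Frame 12 3 s s' ∧ s'.realArr 1 = s.realArr 1) k (fun j X' s1 hj h1 hr h8 =>
      (round_run _ (h1.1.of_frame_eq (Frame.setNat (a := 12) (b := 3) s1 _ le_rfl) rfl) hn j ?_).mono
      le_rfl fun X'' s' h => ⟨⟨h.1, h.2.1, ?_, ?_⟩, ?_, ?_⟩)
      X s1 ⟨hE.of_frame_eq h1.2.2.1 h1.2.2.2, h1.1, h1.2.2.1, by rw [h1.2.2.2]⟩ h1.2.1
      ((h1.2.2.1.1 8 (by norm_num)).trans hE.nat_one)).mono ?_
    fun X' s' h => ⟨h.1.1, h.1.2.2⟩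
  · refine ⟨?_, ?_, Frame.execs (a := 12) (b := 3) _ s rfl, ?_⟩
    · simp [hE.nat_nd]
    · simp [hE.nat_k]
    · simp
  · simpa using h1.2.1
  · exact (h1.2.2.1.trans (Frame.setNat (a := 12) (b := 3) s1 _ le_rfl) (a'' := 12)
      (b'' := 3)).trans h.2.2.1
  · rw [h.2.2.2]
    exact h1.2.2.2
  · rw [h.2.2.1.1 12 (by norm_num)]
    simp
    omega
  · rw [h.2.2.1.1 8 (by norm_num)]
    simpa using h8
  · simp; omega

/-- Append the centers to the output. -/
def emit : Program :=
  .seq (block [.natCopy 21 6, .natCopy 22 7])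
    (forLoop 21 (block [.realLoad 5 0 22, .realStore 1 9 5, .natAdd 22 22 8, .natAdd 9 9 8]))

theorem emit_det (s : Store) (hE : Env n k m L X s) (q : ℕ) (h9 : s.nat 9 = q) :
    Det emit (12 * (k * d) + 7) s (fun s' => Env n k m L X s' ∧ s'.nat 9 = q + k * d ∧
      (∀ x < q, s'.realArr 1 x = s.realArr 1 x) ∧
      (∀ x < k * d, s'.realArr 1 (q + x) = s.realArr 0 (n * d + x)) ∧
      Frame 9 3 s s' ∧ s'.nat 11 = s.nat 11) := by
  refine (Det.seq (Q := fun s' => s'.nat 21 = k * d ∧ s'.nat 22 = n * d ∧ s'.nat 9 = q ∧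
      Frame 9 3 s s' ∧ s'.nat 11 = s.nat 11 ∧ s'.realArr = s.realArr) (Det.block _ ?_) fun s1 h1 =>
    Det.forLoop (J := fun i s' => s'.nat 22 = n * d + i ∧ s'.nat 9 = q + i ∧
      (∀ x < q, s'.realArr 1 x = s.realArr 1 x) ∧
      (∀ x < i, s'.realArr 1 (q + x) = s.realArr 0 (n * d + x)) ∧
      Frame 9 3 s s' ∧ s'.nat 11 = s.nat 11 ∧ s'.realArr 0 = s.realArr 0) (k * d)
      (fun i s2 hi h2 hr h8 => Det.block _ ?_) s1
      ⟨h1.2.1, h1.2.2.1, fun x hx => by rw [h1.2.2.2.2.2], fun x hx => absurd hx (by omega),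
        h1.2.2.2.1, h1.2.2.2.2.1, by rw [h1.2.2.2.2.2]⟩ h1.1
        ((h1.2.2.2.1.1 8 (by norm_num)).trans hE.nat_one)).mono ?_
      fun s' h => ⟨hE.of_frame h.1.2.2.2.2.1 ?_, h.1.2.1, h.1.2.2.1, h.1.2.2.2.1, h.1.2.2.2.2.1,
        h.1.2.2.2.2.2.1⟩
  · refine ⟨?_, ?_, ?_, Frame.execs (a := 9) (b := 3) _ s rfl, ?_, ?_⟩ <;>
      simp [hE.nat_kd, hE.nat_nd, h9]
  · obtain ⟨h22, h9, hx, hi', hf, h11, ha⟩ := h2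
    have hf' : Frame 9 3 s (s2.setNat 21 (k * d - i - 1)) :=
      hf.trans (Frame.setNat (a := 9) (b := 3) s2 _ (by omega))
    refine ⟨⟨?_, ?_, fun x hxq => ?_, fun x hxi => ?_,
      hf'.trans (Frame.execs (a := 9) (b := 3) _ _ rfl), ?_, ?_⟩, ?_, ?_⟩
    · simp [h22, h8, add_assoc]
    · simp [h9, h8, add_assoc]
    · rw [← hx x hxq]
      simp [h9, (show x ≠ q + i by omega)]
    · rcases (Nat.lt_succ_iff_lt_or_eq.1 hxi) with hxi | rfl
      · rw [← hi' x hxi]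
        simp [h9, hxi.ne]
      · simp [h9, h22, ha]
    · simp [h11]
    · simp [ha]
    · simp; omega
    · simp [h8]
  · simp; omega
  · rw [Stored, h.1.2.2.2.2.2.2]
    exact hE.stored

/-- The result of repeated attempts: the points at the end, and whether some attempt was `good`. -/
def searchDist (good : (ℕ → Point d) → Prop) (X : ℕ → Point d) (n k m L N : ℕ) :
    PMF ((ℕ → Point d) × Prop) :=
  iter (fun _ σ => (attemptDist σ.1 n k m L).map (fun X' => (X', σ.2 ∨ good X'))) 0 N (X, False)

/-- Repeated attempts. -/
def search : Program :=
  .seq (block [.natConst 9 0, .natCopy 11 5])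
    (.seq (forLoop 11 (.seq attempt emit)) (block [.natCopy 0 5]))

/-- A bound for the running time of `search`. -/
def searchTime (n d k m N : ℕ) : ℕ :=
  N * (k * (roundTime n d k m + 3) + 12 * (k * d) + 18) + 12

/-- The predicate `good` and the flag `σ.2` exist only in the analysis; the program cannot test
them. The relation therefore only says that if the flag is true, some block of the output array
holds the centers of a good attempt. -/
theorem search_run (good : (ℕ → Point d) → Prop) (s : Store) (hE : Env n k m n.size X s)
    (hn : 1 ≤ n) (N : ℕ) (hN : s.nat 5 = N) :
    Run search (searchTime n d k m N) s (searchDist good X n k m n.size N)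
      (fun σ s' => s'.nat 0 = N ∧ (σ.2 → ∃ l < N, ∃ X', good X' ∧ ∀ j < k, ∀ c : Fin d,
        s'.realArr 1 ((l * k + j) * d + c) = X' (n + j) c)) := by
  refine (Det.seq_run (Q := fun s' => s'.nat 9 = 0 ∧ s'.nat 11 = N ∧ Frame 9 3 s s' ∧
      s'.realArr = s.realArr) (Det.block _ ?_) fun s1 h1 =>
    Run.seq_det (Run.forLoop (J := fun i σ s' => Env n k m n.size σ.1 s' ∧ s'.nat 9 = i * (k * d) ∧
      s'.nat 5 = N ∧ (σ.2 → ∃ l < i, ∃ X', good X' ∧ ∀ j < k, ∀ c : Fin d,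
        s'.realArr 1 ((l * k + j) * d + c) = X' (n + j) c)) N (fun i σ s1 hi h1 hr h8 =>
      Run.seq_det (R := fun σ' s' => Env n k m n.size σ'.1 s' ∧ Frame 12 3 (s1.setNat 11 (N - i - 1)) s'
        ∧ s'.realArr 1 = s1.realArr 1 ∧ (σ'.2 → σ.2 ∨ good σ'.1)) (Run.map (attempt_run (X := σ.1)
        (s1.setNat 11 (N - i - 1))
        (h1.1.of_frame_eq (Frame.setNat (a := 11) (b := 3) s1 _ le_rfl) rfl) hn) _
        fun X' s' h => ⟨h.1, h.2.1, h.2.2, id⟩)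
        fun σ' s2 h2 => (emit_det s2 h2.1 (i * (k * d)) ?_).mono le_rfl fun s3 h3 =>
          ⟨⟨h3.1, ?_, ?_, ?_⟩, ?_, ?_⟩) (X, False) s1 ⟨hE.of_frame_eq h1.2.2.1 h1.2.2.2,
          by simpa using h1.1, (h1.2.2.1.1 5 (by norm_num)).trans hN, False.elim⟩ h1.2.1
          ((h1.2.2.1.1 8 (by norm_num)).trans hE.nat_one)) fun σ s2 h2 => Det.block _ ?_).mono ?_
    fun σ s' h => h
  · refine ⟨?_, ?_, Frame.execs (a := 9) (b := 3) _ s rfl, ?_⟩ <;> simp [hN]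
  · rw [h2.2.1.1 9 (by norm_num)]
    simpa using h1.2.1
  · rw [h3.2.1]
    ring
  · rw [h3.2.2.2.2.1.1 5 (by norm_num), h2.2.1.1 5 (by norm_num)]
    simpa using h1.2.2.1
  · intro h
    have hidx : ∀ l j : ℕ, ∀ c : Fin d, (l * k + j) * d + c = l * (k * d) + (j * d + c) := by
      intros; ring
    have hjc : ∀ j < k, ∀ c : Fin d, j * d + c < k * d := fun j hj c => by
      calc j * d + c < j * d + d := by omega
        _ = (j + 1) * d := by ring
        _ ≤ k * d := Nat.mul_le_mul_right _ hj
    rcases h2.2.2.2 h with h | h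
    · obtain ⟨l, hl, X', hX', hl'⟩ := h1.2.2.2 h
      refine ⟨l, by omega, X', hX', fun j hj c => ?_⟩
      rw [← hl' j hj c, h3.2.2.1, h2.2.2.1]
      rw [hidx]
      calc l * (k * d) + (j * d + c) < l * (k * d) + k * d := by have := hjc j hj c; omega
        _ = (l + 1) * (k * d) := by ring
        _ ≤ i * (k * d) := Nat.mul_le_mul_right _ hl
    · refine ⟨i, by omega, σ'.1, h, fun j hj c => ?_⟩
      rw [hidx, h3.2.2.2.1 _ (hjc j hj c), ← h2.1.stored, add_mul, add_assoc]
  · rw [h3.2.2.2.2.2, h2.2.1.1 11 (by norm_num)]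
    simp
    omega
  · rw [h3.2.2.2.2.1.1 8 (by norm_num), h2.2.1.1 8 (by norm_num)]
    simpa using h8
  · obtain ⟨⟨h1, h2, h5, h4⟩, -⟩ := h2
    exact ⟨by simp [h5], by simpa using h4⟩
  · simp [searchTime]; ring_nf; omega

end

section

variable {d n k m L : ℕ} {X : ℕ → Point d} {ε δ : ℝ}

/-! ### Parameters -/

/-- Integer register `y` becomes `v`; other low registers and the real arrays do not change. -/
def Assigned (y v : ℕ) (s s' : Store) : Prop :=
  s'.nat y = v ∧ (∀ z < 12, z ≠ y → s'.nat z = s.nat z) ∧ (∀ r < 2, s'.real r = s.real r) ∧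
    s'.realArr = s.realArr

/-- Every parameter is computed in registers from `12` upwards and then copied to its final place,
so that the stages of the setup do not disturb each other. -/
theorem Det.assign {P : Program} {t : ℕ} {s : Store} {x v : ℕ}
    (h : Det P t s (fun s' => s'.nat x = v ∧ Frame 12 2 s s' ∧ s'.realArr = s.realArr)) (y : ℕ) :
    Det (.seq P (MinSum.block [.natCopy y x])) (t + 4) s (Assigned y v s) := by
  refine (Det.seq (Q' := Assigned y v s) h fun s' h' => Det.block _ ⟨?_, fun z hz hy => ?_,
    fun r hr => ?_, ?_⟩).mono ?_ fun _ h => h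
  · simp [h'.1]
  · simp [hy, h'.2.1.1 z hz]
  · simp [h'.2.1.2 r hr]
  · simp [h'.2.2]
  · simp

/-- Integer register `12` becomes the least `m` with `8 < m ε`. -/
def countSamples : Program :=
  .seq (block [.natConst 12 0, .realConst 4 8, .realConst 5 0])
    (.loop (.realLe 5 4) (block [.natAdd 12 12 8, .realAdd 5 5 0]))

/-- Reals cannot be rounded to integers, so `m` is found by counting additions of `ε`. The other
real parameters are likewise found by counting doublings. -/
theorem countSamples_det (s : Store) (hε : s.real 0 = ε) (h8 : s.nat 8 = 1)
    (hm : ∀ i < m, i * ε ≤ 8) (hm' : 8 < m * ε) :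
    Det countSamples (6 * m + 9) s
      (fun s' => s'.nat 12 = m ∧ Frame 12 2 s s' ∧ s'.realArr = s.realArr) := by
  refine (Det.seq (Q := fun s' => s'.nat 12 = 0 ∧ s'.real 4 = 8 ∧ s'.real 5 = 0 ∧ Frame 12 2 s s' ∧
      s'.realArr = s.realArr) (Det.block _ ?_) fun s1 h1 => Det.loop (t := 5)
      (J := fun i s' => s'.nat 12 = i ∧
      s'.real 4 = 8 ∧ s'.real 5 = i * ε ∧ Frame 12 2 s s' ∧ s'.realArr = s.realArr) m
      (fun i s2 hi h2 => ⟨?_, Det.block _ ?_⟩) (fun s2 h2 => ?_) s1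
      ⟨h1.1, h1.2.1, by simp [h1.2.2.1], h1.2.2.2⟩).mono ?_ fun s' h => ⟨h.1, h.2.2.2⟩
  · refine ⟨?_, ?_, ?_, Frame.execs (a := 12) (b := 2) _ s rfl, ?_⟩ <;> simp
  · simpa [Test.Holds, h2.2.1, h2.2.2.1] using hm i hi
  · obtain ⟨h12, h4, h5, hf, ha⟩ := h2
    refine ⟨?_, ?_, ?_, hf.trans (Frame.execs (a := 12) (b := 2) _ _ rfl), ?_⟩
    · simp [h12, hf.1 8, h8]
    · simp [h4]
    · simp [h5, hf.2 0, hε]; ring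
    · simp [ha]
  · simpa [Test.Holds, h2.2.1, h2.2.2.1] using hm'
  · simp; omega

/-- Integer register `12` becomes the number of binary digits of the content of register `0`. -/
def countDigits : Program :=
  .seq (block [.natConst 12 0, .natConst 26 1])
    (.loop (.natLe 26 0) (block [.natAdd 26 26 26, .natAdd 12 12 8]))

theorem countDigits_det (s : Store) (hn : s.nat 0 = n) (h8 : s.nat 8 = 1) :
    Det countDigits (6 * n.size + 7) s
      (fun s' => s'.nat 12 = n.size ∧ Frame 12 2 s s' ∧ s'.realArr = s.realArr) := by
  refine (Det.seq (Q := fun s' => s'.nat 12 = 0 ∧ s'.nat 26 = 1 ∧ Frame 12 2 s s' ∧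
      s'.realArr = s.realArr) (Det.block _ ?_) fun s1 h1 => Det.loop (t := 5)
      (J := fun i s' => s'.nat 12 = i ∧
      s'.nat 26 = 2 ^ i ∧ Frame 12 2 s s' ∧ s'.realArr = s.realArr) n.size
      (fun i s2 hi h2 => ⟨?_, Det.block _ ?_⟩) (fun s2 h2 => ?_) s1
      ⟨h1.1, by simp [h1.2.1], h1.2.2⟩).mono ?_ fun s' h => ⟨h.1, h.2.2⟩
  · refine ⟨?_, ?_, Frame.execs (a := 12) (b := 2) _ s rfl, ?_⟩ <;> simp
  · simpa [Test.Holds, h2.2.1, h2.2.2.1.1 0, hn] using Nat.lt_size.1 hi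
  · obtain ⟨h12, h26, hf, ha⟩ := h2
    refine ⟨?_, ?_, hf.trans (Frame.execs (a := 12) (b := 2) _ _ rfl), ?_⟩
    · simp [h12, hf.1 8, h8]
    · simp [h26, pow_succ, mul_two]
    · simp [ha]
  · simp only [Test.Holds, h2.2.1, h2.2.2.1.1 0 (by norm_num), hn, ← Nat.lt_size]
    exact lt_irrefl _
  · simp; omega

/-- Integer register `12` becomes the number of doublings that real register `5` needs to exceed real
register `4`. -/
def countDoublings : Program :=
  .seq (block [.natConst 12 0]) (.loop (.realLe 5 4) (block [.realAdd 5 5 5, .natAdd 12 12 8]))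

theorem countDoublings_det (s : Store) {x R : ℝ} {e : ℕ} (h4 : s.real 4 = R) (h5 : s.real 5 = x)
    (h8 : s.nat 8 = 1) (he : ∀ i < e, 2 ^ i * x ≤ R) (he' : R < 2 ^ e * x) :
    Det countDoublings (6 * e + 5) s
      (fun s' => s'.nat 12 = e ∧ Frame 12 2 s s' ∧ s'.realArr = s.realArr) := by
  refine (Det.seq (Q := fun s' => s'.nat 12 = 0 ∧ s'.real 4 = R ∧ s'.real 5 = x ∧ Frame 12 2 s s' ∧
      s'.realArr = s.realArr) (Det.block _ ?_) fun s1 h1 => Det.loop (t := 5)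
      (J := fun i s' => s'.nat 12 = i ∧
      s'.real 4 = R ∧ s'.real 5 = 2 ^ i * x ∧ Frame 12 2 s s' ∧ s'.realArr = s.realArr) e
      (fun i s2 hi h2 => ⟨?_, Det.block _ ?_⟩) (fun s2 h2 => ?_) s1
      ⟨h1.1, h1.2.1, by simp [h1.2.2.1], h1.2.2.2⟩).mono ?_ fun s' h => ⟨h.1, h.2.2.2⟩
  · refine ⟨?_, ?_, ?_, Frame.execs (a := 12) (b := 2) _ s rfl, ?_⟩ <;> simp [h4, h5]
  · simpa [Test.Holds, h2.2.1, h2.2.2.1] using he i hi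
  · obtain ⟨h12, h4, h5, hf, ha⟩ := h2
    refine ⟨?_, ?_, ?_, hf.trans (Frame.execs (a := 12) (b := 2) _ _ rfl), ?_⟩
    · simp [h12, hf.1 8, h8]
    · simp [h4]
    · simp [h5]; ring
    · simp [ha]
  · simpa [Test.Holds, h2.2.1, h2.2.2.1] using he'
  · simp; omega

/-- The number of digits of the inverse of a lower bound for the probability that one random point is
as desired. -/
def countSampleDigits : Program :=
  .seq (block [.realConst 4 512, .realOfNat 5 4, .realMul 4 4 5, .realOfNat 5 2, .realMul 4 4 5,
    .realMul 4 4 5, .realCopy 5 0]) countDoublings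

theorem countSampleDigits_det (s : Store) {e : ℕ} (hε : s.real 0 = ε) (hL : s.nat 4 = L)
    (hk : s.nat 2 = k) (h8 : s.nat 8 = 1) (he : ∀ i < e, 2 ^ i * ε ≤ 512 * L * k * k)
    (he' : 512 * L * k * k < 2 ^ e * ε) :
    Det countSampleDigits (6 * e + 21) s
      (fun s' => s'.nat 12 = e ∧ Frame 12 2 s s' ∧ s'.realArr = s.realArr) := by
  refine (Det.seq (Q' := fun s' => s'.nat 12 = e ∧ Frame 12 2 s s' ∧ s'.realArr = s.realArr)
    (Q := fun s' => s'.real 4 = 512 * L * k * k ∧ s'.real 5 = ε ∧ Frame 12 2 s s' ∧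
      s'.realArr = s.realArr) (Det.block _ ?_) fun s1 h1 => (countDoublings_det s1 h1.1 h1.2.1
      ((h1.2.2.1.1 8 (by norm_num)).trans h8) he he').mono le_rfl fun s' h =>
      ⟨h.1, h1.2.2.1.trans h.2.1, h.2.2.trans h1.2.2.2⟩).mono ?_ fun _ h => h
  · refine ⟨?_, ?_, Frame.execs (a := 12) (b := 2) _ s rfl, ?_⟩ <;> simp [hL, hk, hε]
  · simp; omega

/-- The number of digits of the inverse of the failure probability. -/
def countFailureDigits : Program :=
  .seq (block [.realConst 4 1, .realCopy 5 1]) countDoublings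

theorem countFailureDigits_det (s : Store) {l : ℕ} (hδ : s.real 1 = δ) (h8 : s.nat 8 = 1)
    (hl : ∀ i < l, 2 ^ i * δ ≤ 1) (hl' : 1 < 2 ^ l * δ) :
    Det countFailureDigits (6 * l + 11) s
      (fun s' => s'.nat 12 = l ∧ Frame 12 2 s s' ∧ s'.realArr = s.realArr) := by
  refine (Det.seq (Q' := fun s' => s'.nat 12 = l ∧ Frame 12 2 s s' ∧ s'.realArr = s.realArr)
    (Q := fun s' => s'.real 4 = 1 ∧ s'.real 5 = δ ∧ Frame 12 2 s s' ∧
      s'.realArr = s.realArr) (Det.block _ ?_) fun s1 h1 => (countDoublings_det s1 h1.1 h1.2.1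
      ((h1.2.2.1.1 8 (by norm_num)).trans h8) hl hl').mono le_rfl fun s' h =>
      ⟨h.1, h1.2.2.1.trans h.2.1, h.2.2.trans h1.2.2.2⟩).mono ?_ fun _ h => h
  · refine ⟨?_, ?_, Frame.execs (a := 12) (b := 2) _ s rfl, ?_⟩ <;> simp [hδ]
  · simp; omega

/-- Compute all parameters. -/
def setup : Program :=
  .seq (.seq countSamples (block [.natCopy 3 12]))
  (.seq (.seq countDigits (block [.natCopy 4 12]))
  (.seq (.seq (mul 2 1) (block [.natCopy 6 29]))
  (.seq (.seq (mul 0 1) (block [.natCopy 7 29]))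
  (.seq (.seq countSampleDigits (block [.natCopy 10 12]))
  (.seq (.seq countFailureDigits (block [.natCopy 11 12]))
  (.seq (.seq (mul 10 3) (block [.natCopy 10 29]))
  (.seq (block [.natAdd 10 10 8])
  (.seq (.seq (mul 10 2) (block [.natCopy 10 29]))
  (.seq (block [.natAdd 10 10 11])
  (.seq (.seq (pow2 10) (block [.natCopy 5 29])) (block [.realOfNat 2 3])))))))))))

/-- The binary logarithm of the number of attempts. -/
def logAttempts (k m e l : ℕ) : ℕ := (e * m + 1) * k + l

/-- A bound for the running time of `setup`. -/
def setupTime (n d k m e l : ℕ) : ℕ :=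
  12 * m + 6 * n.size + 12 * d + 6 * e + 6 * l + 6 * k + 6 * logAttempts k m e l + 200

set_option maxHeartbeats 1000000 in
theorem setup_det (s : Store) {e l : ℕ} (hn : s.nat 0 = n) (hd : s.nat 1 = d) (hk : s.nat 2 = k)
    (h8 : s.nat 8 = 1) (hε : s.real 0 = ε) (hδ : s.real 1 = δ) (hX : Stored X s)
    (hm : ∀ i < m, i * ε ≤ 8) (hm' : 8 < m * ε)
    (he : ∀ i < e, 2 ^ i * ε ≤ 512 * n.size * k * k) (he' : 512 * n.size * k * k < 2 ^ e * ε)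
    (hl : ∀ i < l, 2 ^ i * δ ≤ 1) (hl' : 1 < 2 ^ l * δ) :
    Det setup (setupTime n d k m e l) s (fun s' => Env n k m n.size X s' ∧
      s'.nat 5 = 2 ^ logAttempts k m e l) := by
  refine (
    Det.seq ((countSamples_det s hε h8 hm hm').assign 3) fun s1 h1 =>
    Det.seq ((countDigits_det (n := n) s1 (by simp [h1.2.1, hn]) (by simp [h1.2.1, h8])).assign 4)
      fun s2 h2 =>
    Det.seq (Q := Assigned 6 (k * d) s2) (t := 6 * d + 7 + 4) (Det.assign (x := 29)
      ((mul_det 2 1 s2 (by norm_num) (by norm_num) d (by simp [h2.2.1, h1.2.1, hd])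
      (by simp [h2.2.1, h1.2.1, h8])).mono le_rfl fun s' h =>
      ⟨by simp [h.1, h2.2.1, h1.2.1, hk], h.2.1.trans (Frame.refl 29 8 _), h.2.2⟩) 6) fun s3 h3 =>
    Det.seq (Q := Assigned 7 (n * d) s3) (t := 6 * d + 7 + 4) (Det.assign (x := 29)
      ((mul_det 0 1 s3 (by norm_num) (by norm_num) d (by simp [h3.2.1, h2.2.1, h1.2.1, hd])
      (by simp [h3.2.1, h2.2.1, h1.2.1, h8])).mono le_rfl fun s' h =>
      ⟨by simp [h.1, h3.2.1, h2.2.1, h1.2.1, hn], h.2.1.trans (Frame.refl 29 8 _), h.2.2⟩) 7)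
      fun s4 h4 =>
    Det.seq ((countSampleDigits_det s4 (L := n.size) (k := k)
      (by simp [h4.2.2.1, h3.2.2.1, h2.2.2.1, h1.2.2.1, hε])
      (by simp [h4.2.1, h3.2.1, h2.1]) (by simp [h4.2.1, h3.2.1, h2.2.1, h1.2.1, hk])
      (by simp [h4.2.1, h3.2.1, h2.2.1, h1.2.1, h8]) he he').assign 10) fun s5 h5 =>
    Det.seq ((countFailureDigits_det s5
      (by simp [h5.2.2.1, h4.2.2.1, h3.2.2.1, h2.2.2.1, h1.2.2.1, hδ])
      (by simp [h5.2.1, h4.2.1, h3.2.1, h2.2.1, h1.2.1, h8]) hl hl').assign 11) fun s6 h6 =>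
    Det.seq (Q := Assigned 10 (e * m) s6) (t := 6 * m + 7 + 4) (Det.assign (x := 29)
      ((mul_det 10 3 s6 (by norm_num) (by norm_num) m
      (by simp [h6.2.1, h5.2.1, h4.2.1, h3.2.1, h2.2.1, h1.1])
      (by simp [h6.2.1, h5.2.1, h4.2.1, h3.2.1, h2.2.1, h1.2.1, h8])).mono le_rfl fun s' h =>
      ⟨by simp [h.1, h6.2.1, h5.1], h.2.1.trans (Frame.refl 29 8 _), h.2.2⟩) 10) fun s7 h7 =>
    Det.seq (Q := Assigned 10 (e * m + 1) s7) (Det.block _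
      ⟨?_, fun z hz hzy => ?_, fun r hr => ?_, ?_⟩) fun s8 h8' =>
    Det.seq (Q := Assigned 10 ((e * m + 1) * k) s8) (t := 6 * k + 7 + 4) (Det.assign (x := 29)
      ((mul_det 10 2 s8 (by norm_num) (by norm_num) k
      (by simp [h8'.2.1, h7.2.1, h6.2.1, h5.2.1, h4.2.1, h3.2.1, h2.2.1, h1.2.1, hk])
      (by simp [h8'.2.1, h7.2.1, h6.2.1, h5.2.1, h4.2.1, h3.2.1, h2.2.1, h1.2.1, h8])).mono le_rfl
      fun s' h => ⟨by simp [h.1, h8'.1], h.2.1.trans (Frame.refl 29 8 _), h.2.2⟩) 10) fun s9 h9 =>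
    Det.seq (Q := Assigned 10 (logAttempts k m e l) s9) (Det.block _
      ⟨?_, fun z hz hzy => ?_, fun r hr => ?_, ?_⟩) fun s10 h10 =>
    Det.seq (Q := Assigned 5 (2 ^ logAttempts k m e l) s10) (t := 6 * logAttempts k m e l + 7 + 4)
      (Det.assign (x := 29)
      ((pow2_det 10 s10 (by norm_num) (logAttempts k m e l) h10.1
      (by simp [h10.2.1, h9.2.1, h8'.2.1, h7.2.1, h6.2.1, h5.2.1, h4.2.1, h3.2.1, h2.2.1, h1.2.1,
        h8])).mono le_rfl
      fun s' h => ⟨h.1, h.2.1.trans (Frame.refl 29 8 _), h.2.2⟩) 5) fun s11 h11 =>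
    Det.block (Q := fun s' => Env n k m n.size X s' ∧ s'.nat 5 = 2 ^ logAttempts k m e l) _
      ⟨?_, ?_⟩).mono ?_ fun _ h => h
  · simp [h7.1, h7.2.1, h6.2.1, h5.2.1, h4.2.1, h3.2.1, h2.2.1, h1.2.1, h8]
  · simp [hzy]
  · simp
  · simp
  · simp [h9.1, h9.2.1, h8'.2.1, h7.2.1, h6.1, logAttempts]
  · simp [hzy]
  · simp
  · simp
  · constructor
    · simp [h11.2.1, h10.2.1, h9.2.1, h8'.2.1, h7.2.1, h6.2.1, h5.2.1, h4.2.1, h3.2.1, h2.2.1,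
        h1.2.1, hn]
    · simp [h11.2.1, h10.2.1, h9.2.1, h8'.2.1, h7.2.1, h6.2.1, h5.2.1, h4.2.1, h3.2.1, h2.2.1,
        h1.2.1, hd]
    · simp [h11.2.1, h10.2.1, h9.2.1, h8'.2.1, h7.2.1, h6.2.1, h5.2.1, h4.2.1, h3.2.1, h2.2.1,
        h1.2.1, hk]
    · simp [h11.2.1, h10.2.1, h9.2.1, h8'.2.1, h7.2.1, h6.2.1, h5.2.1, h4.2.1, h3.2.1, h2.2.1,
        h1.1]
    · simp [h11.2.1, h10.2.1, h9.2.1, h8'.2.1, h7.2.1, h6.2.1, h5.2.1, h4.2.1, h3.2.1, h2.1]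
    · simp [h11.2.1, h10.2.1, h9.2.1, h8'.2.1, h7.2.1, h6.2.1, h5.2.1, h4.2.1, h3.1]
    · simp [h11.2.1, h10.2.1, h9.2.1, h8'.2.1, h7.2.1, h6.2.1, h5.2.1, h4.1]
    · simp [h11.2.1, h10.2.1, h9.2.1, h8'.2.1, h7.2.1, h6.2.1, h5.2.1, h4.2.1, h3.2.1, h2.2.1,
        h1.2.1, h8]
    · simp [h11.2.1, h10.2.1, h9.2.1, h8'.2.1, h7.2.1, h6.2.1, h5.2.1, h4.2.1, h3.2.1, h2.2.1,
        h1.1]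
    · intro i c
      rw [← hX i c, ← h1.2.2.2, ← h2.2.2.2, ← h3.2.2.2, ← h4.2.2.2, ← h5.2.2.2, ← h6.2.2.2,
        ← h7.2.2.2, ← h8'.2.2.2, ← h9.2.2.2, ← h10.2.2.2, ← h11.2.2.2]
      simp
  · simp [h11.1]
  · simp [setupTime]
    omega

/-! ### The algorithm -/

/-- The algorithm. -/
def algorithm : Program :=
  .seq (block [.realConst 3 1, .natConst 8 1])
    (.ite (.realLe 3 1) (block [.natConst 0 0]) (.seq setup search))

/-- The points at the beginning. -/
def inputPoints (A : Fin n → Point d) (i : ℕ) : Point d := if h : i < n then A ⟨i, h⟩ else 0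

theorem stored_input (A : Fin n → Point d) : Stored (inputPoints A) (input k ε δ A) := by
  intro i c
  simp only [input, if_pos, inputPoints]
  by_cases hi : i < n
  · have h : i * d + c < n * d := by
      calc i * d + (c : ℕ) < i * d + d := by omega
        _ = (i + 1) * d := by ring
        _ ≤ n * d := Nat.mul_le_mul_right _ hi
    -- `finProdFinEquiv` is the row-major enumeration, so cell `i * d + c` decodes to point `i` and
    -- coordinate `c`.
    have hp : (finProdFinEquiv.symm ⟨i * d + c, h⟩ : Fin n × Fin d) = (⟨i, hi⟩, c) := by
      rw [Equiv.symm_apply_eq]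
      ext
      simp [finProdFinEquiv]
      ring
    rw [dif_pos h, dif_pos hi, hp]
  · have h : ¬ i * d + c < n * d := by
      have := Nat.mul_le_mul_right d (not_lt.1 hi)
      omega
    rw [dif_neg h, dif_neg hi]
    rfl

/-- For `1 ≤ δ` nothing has to be covered, but the exponential factor may be as small as `1` (when
`δ = k / ε`). The time must then not grow with `k`, so the empty list is output at once. -/
theorem algorithm_det_of_one_le (hδ : 1 ≤ δ) (A : Fin n → Point d) :
    Det algorithm 10 (input k ε δ A) (fun s' => s'.nat 0 = 0) := by
  refine (Det.seq (Q := fun s' => s'.real 3 = 1 ∧ s'.real 1 = δ) (Det.block _ ?_) fun s1 h1 =>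
    Det.ite (t := 3) (fun _ => Det.block _ ?_) fun hT => absurd hδ ?_).mono ?_ fun _ h => h
  · simp [input]
  · simp
  · simpa [Test.Holds, h1] using hT
  · simp

theorem algorithm_run (hn : 1 ≤ n) (hδ : δ < 1) (A : Fin n → Point d) {e l : ℕ}
    (hm : ∀ i < m, i * ε ≤ 8) (hm' : 8 < m * ε)
    (he : ∀ i < e, 2 ^ i * ε ≤ 512 * n.size * k * k) (he' : 512 * n.size * k * k < 2 ^ e * ε)
    (hl : ∀ i < l, 2 ^ i * δ ≤ 1) (hl' : 1 < 2 ^ l * δ) (good : (ℕ → Point d) → Prop) :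
    Run algorithm (setupTime n d k m e l + searchTime n d k m (2 ^ logAttempts k m e l) + 8)
      (input k ε δ A)
      (searchDist good (inputPoints A) n k m n.size (2 ^ logAttempts k m e l))
      (fun σ s' => s'.nat 0 = 2 ^ logAttempts k m e l ∧
        (σ.2 → ∃ l' < 2 ^ logAttempts k m e l, ∃ X', good X' ∧ ∀ j < k, ∀ c : Fin d,
        s'.realArr 1 ((l' * k + j) * d + c) = X' (n + j) c)) := by
  refine (Det.seq_run (Q := fun s' => s'.real 3 = 1 ∧ s'.nat 8 = 1 ∧ s'.real 1 = δ ∧ s'.real 0 = ε ∧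
      s'.nat 0 = n ∧ s'.nat 1 = d ∧ s'.nat 2 = k ∧ s'.realArr = (input k ε δ A).realArr)
      (Det.block _ ?_) fun s1 h1 => Run.ite
      (t := setupTime n d k m e l + searchTime n d k m (2 ^ logAttempts k m e l) + 1)
      (fun hT => absurd hδ ?_) fun _ =>
        Det.seq_run (setup_det (X := inputPoints A) s1 h1.2.2.2.2.1 h1.2.2.2.2.2.1 h1.2.2.2.2.2.2.1
          h1.2.1 h1.2.2.2.1 h1.2.2.1 ?_ hm hm' he he' hl hl') fun s2 h2 =>
          search_run good s2 h2.1 hn _ h2.2).mono ?_ fun _ _ h => h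
  · simp [input]
  · simpa [Test.Holds, h1] using hT
  · rw [Stored, h1.2.2.2.2.2.2.2]
    exact stored_input A
  · simp; omega

end

end Programs

/-! ### Probabilities of single selections -/

theorem ev_bool (y : Bool → ℝ≥0∞) :
    ev (PMF.uniformOfFintype Bool) y = 2⁻¹ * (y false + y true) := by
  simp [ev, tsum_fintype, mul_add, add_comm]

theorem ev_bits_from (y : ℕ → ℝ≥0∞) (m i v : ℕ) :
    ev (iter (fun _ v => (PMF.uniformOfFintype Bool).map (fun b => v + v + if b then 1 else 0))
      i m v) y = 2⁻¹ ^ m * ∑ w ∈ range (2 ^ m), y (v * 2 ^ m + w) := by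
  induction m generalizing i v with
  | zero => simp [iter, ev_pure]
  | succ m ih =>
    rw [iter, ev_bind, ev_map, ev_bool]
    simp only [ih]
    rw [pow_succ 2 m, mul_two, sum_range_add, pow_succ, ← mul_add, ← mul_assoc, mul_comm 2⁻¹]
    congr 2
    · refine sum_congr rfl fun w _ => ?_
      congr 1
      simp only [Bool.false_eq_true, if_false]
      ring
    · refine sum_congr rfl fun w _ => ?_
      congr 1
      simp only [if_true]
      ring

theorem ev_bits (l : ℕ) (y : ℕ → ℝ≥0∞) :
    ev (bits l) y = 2⁻¹ ^ l * ∑ w ∈ range (2 ^ l), y w := by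
  rw [bits, ev_bits_from]
  simp

theorem le_ev_bits {l v : ℕ} (hv : v < 2 ^ l) (y : ℕ → ℝ≥0∞) : 2⁻¹ ^ l * y v ≤ ev (bits l) y := by
  rw [ev_bits]
  exact mul_le_mul_right (single_le_sum (f := y) (fun _ _ => zero_le) (mem_range.2 hv)) _

theorem inv_two_pow_eq_ofReal (l : ℕ) : (2⁻¹ : ℝ≥0∞) ^ l = ENNReal.ofReal ((2 ^ l)⁻¹) := by
  rw [ENNReal.ofReal_inv_of_pos (by positivity), ENNReal.ofReal_pow (by norm_num), ENNReal.inv_pow]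
  norm_num

theorem ofReal_inv_two_mul_le {B : ℕ} (hB : 1 ≤ B) :
    ENNReal.ofReal ((2 * B : ℝ)⁻¹) ≤ 2⁻¹ ^ B.size := by
  rw [inv_two_pow_eq_ofReal]
  refine ENNReal.ofReal_le_ofReal (inv_anti₀ (by positivity) ?_)
  exact_mod_cast two_pow_size_le hB

section

variable {d n k : ℕ} {X : ℕ → Point d} {ρ : ℝ}

open Classical in
/-- The points whose squared distance to the centers exceeds `ρ`. -/
def far (X : ℕ → Point d) (n k : ℕ) (ρ : ℝ) : Finset ℕ :=
  (range n).filter fun u => ρ < minSqDist X n k u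

theorem mem_far {u : ℕ} : u ∈ far X n k ρ ↔ u < n ∧ ρ < minSqDist X n k u := by
  classical
  simp [far]

theorem far_subset : far X n k ρ ⊆ range (2 ^ n.size) := fun _ hu =>
  mem_range.2 ((mem_far.1 hu).1.trans (Nat.lt_size_self n))

theorem challenge_of_notMem {u : ℕ} {σ : ℕ × ℝ} (hu : u ∉ far X n k ρ) (hσ : σ.2 ≤ ρ) :
    (challenge X n k u σ).2 ≤ ρ := by
  unfold challenge
  split_ifs with h
  · exact not_lt.1 fun h' => hu (mem_far.2 ⟨h.1, h'⟩)
  · exact hσ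

/-- As long as the selected value is at most `ρ`, any far point beats it. -/
theorem challenge_of_mem {u : ℕ} {σ : ℕ × ℝ} (hu : u ∈ far X n k ρ) (hσ : σ.2 ≤ ρ) :
    challenge X n k u σ = (u, minSqDist X n k u) :=
  if_pos ⟨(mem_far.1 hu).1, hσ.trans (mem_far.1 hu).2.le⟩

theorem challenge_eq_self {u p : ℕ} (hp : p ∈ far X n k ρ) (hu : u ∉ far X n k ρ) :
    challenge X n k u (p, minSqDist X n k p) = (p, minSqDist X n k p) :=
  if_neg fun h => hu (mem_far.2 ⟨h.1, (mem_far.1 hp).2.trans_le h.2⟩)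

/-- A tournament. -/
def tournament (X : ℕ → Point d) (n k m i : ℕ) (σ : ℕ × ℝ) : PMF (ℕ × ℝ) :=
  iter (fun _ σ => (bits n.size).map (fun u => challenge X n k u σ)) i m σ

/-- The probability that a random number is not that of a far point. -/
def nearProb (X : ℕ → Point d) (n k : ℕ) (ρ : ℝ) : ℝ≥0∞ :=
  2⁻¹ ^ n.size * ((2 ^ n.size - #(far X n k ρ) : ℕ) : ℝ≥0∞)

/-- The expectation is split into far draws and all others, the latter including void ones. -/
theorem ev_bits_ge_near {y : ℕ → ℝ≥0∞} {x : ℝ≥0∞} (hy : ∀ u ∉ far X n k ρ, x ≤ y u) :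
    nearProb X n k ρ * x + 2⁻¹ ^ n.size * ∑ u ∈ far X n k ρ, y u ≤ ev (bits n.size) y := by
  classical
  rw [ev_bits, nearProb, mul_assoc, ← mul_add, ← sum_sdiff (far_subset (X := X) (k := k) (ρ := ρ))]
  gcongr
  have hc : #(range (2 ^ n.size) \ far X n k ρ) = 2 ^ n.size - #(far X n k ρ) := by
    rw [card_sdiff_of_subset far_subset, card_range]
  rw [← hc, ← nsmul_eq_mul]
  exact card_nsmul_le_sum _ _ _ fun u hu => hy u (mem_sdiff.1 hu).2

-- Once selected, the far point `p` is safe if no later round draws a far point, since near points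
-- are strictly closer.
open Classical in
theorem tournament_keep {p : ℕ} (hp : p ∈ far X n k ρ) (m i : ℕ) :
    nearProb X n k ρ ^ m ≤ ev (tournament X n k m i (p, minSqDist X n k p))
      (fun σ => if σ.1 = p then 1 else 0) := by
  induction m generalizing i with
  | zero => simp [tournament, iter, ev_pure]
  | succ m ih =>
    rw [tournament, iter, ev_bind, ev_map]
    refine le_trans ?_ (ev_bits_ge_near (X := X) (k := k) (ρ := ρ) (x := nearProb X n k ρ ^ m)
      fun u hu => ?_)
    · rw [pow_succ, mul_comm]
      exact le_self_add
    · rw [challenge_eq_self hp hu]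
      exact ih (i + 1)

-- The events "round `r` draws `p` and all other rounds draw no far point" are disjoint for the `m`
-- values of `r`. Each makes `p` the winner and has probability `2⁻¹ ^ n.size * nearProb X n k ρ ^
-- (m - 1)`. The induction adds them up by conditioning on the first round.
open Classical in
theorem tournament_find {p : ℕ} (hp : p ∈ far X n k ρ) (m i : ℕ) (σ : ℕ × ℝ) (hσ : σ.2 ≤ ρ) :
    m * (2⁻¹ ^ n.size * nearProb X n k ρ ^ (m - 1)) ≤ ev (tournament X n k m i σ)
      (fun σ => if σ.1 = p then 1 else 0) := by
  induction m generalizing i σ with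
  | zero => simp
  | succ m ih =>
    rw [tournament, iter, ev_bind, ev_map]
    refine le_trans ?_ (ev_bits_ge_near (X := X) (k := k) (ρ := ρ)
      (x := m * (2⁻¹ ^ n.size * nearProb X n k ρ ^ (m - 1)))
      fun u hu => ih (i + 1) _ (challenge_of_notMem hu hσ))
    have h1 : nearProb X n k ρ ^ m ≤ ∑ u ∈ far X n k ρ, ev (tournament X n k m (i + 1)
        (challenge X n k u σ)) (fun σ => if σ.1 = p then 1 else 0) := by
      refine le_trans ?_ (single_le_sum (fun _ _ => zero_le) hp)
      rw [challenge_of_mem hp hσ]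
      exact tournament_keep hp m (i + 1)
    refine le_trans (le_of_eq ?_) (add_le_add_right (mul_le_mul_right h1 _) _)
    cases m with
    | zero => simp
    | succ m =>
      simp only [Nat.add_sub_cancel]
      push_cast
      ring

theorem nearProb_eq : nearProb X n k ρ =
    ENNReal.ofReal (1 - (#(far X n k ρ) : ℝ) / 2 ^ n.size) := by
  have hle : #(far X n k ρ) ≤ 2 ^ n.size := by
    simpa using card_le_card (far_subset (X := X) (n := n) (k := k) (ρ := ρ))
  rw [nearProb, inv_two_pow_eq_ofReal, ← ENNReal.ofReal_natCast,
    ← ENNReal.ofReal_mul (by positivity), Nat.cast_sub hle]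
  congr 1
  push_cast
  field_simp

/-- The number of rounds of a tournament that finds one of `f` far points. -/
theorem exists_rounds {f L : ℕ} (hf : 1 ≤ f) (hL : 1 ≤ L) :
    ∃ v, 1 ≤ v ∧ v ≤ L ∧ 2 * (2 ^ v - 2) * f ≤ 2 ^ L ∧ 2 ^ L < 4 * (2 ^ v - 1) * f := by
  classical
  -- The greatest admissible `v` is taken. `2 ^ v - 2` is the number of rounds other than the
  -- winning one; it keeps the expected number of further far draws at most `1 / 2`, and maximality
  -- keeps `2 ^ v - 1` of order `2 ^ L / f`.
  set p : ℕ → Prop := fun v => 2 * (2 ^ v - 2) * f ≤ 2 ^ L with hp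
  have h1 : p 1 := by simp [hp]
  refine ⟨Nat.findGreatest p L, Nat.le_findGreatest hL h1, Nat.findGreatest_le L,
    Nat.findGreatest_spec (P := p) hL h1, ?_⟩
  set v := Nat.findGreatest p L with hv
  have hnot : ¬ p (v + 1) := by
    rcases (Nat.findGreatest_le (P := p) L).lt_or_eq with h | h
    · exact Nat.findGreatest_is_greatest (Nat.lt_succ_self _) h
    · rw [← hv] at h
      intro h'
      -- If the search stops at the boundary `v = L`, the next exponent still fails, because `1 ≤ f`
      -- and `2 ≤ 2 ^ L`.
      have h2 : 2 * (2 ^ (v + 1) - 2) * 1 ≤ 2 ^ L := (Nat.mul_le_mul_left _ hf).trans h'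
      rw [h, pow_succ] at h2
      have : 2 ^ 1 ≤ 2 ^ L := Nat.pow_le_pow_right (by norm_num) hL
      omega
  have h2 : 2 ^ L < 2 * (2 ^ (v + 1) - 2) * f := not_le.1 hnot
  rwa [show 2 * (2 ^ (v + 1) - 2) = 4 * (2 ^ v - 1) by rw [pow_succ]; omega] at h2

/-- By Bernoulli's inequality no other far point is drawn with probability at least `1 - m f / W ≥ 1
/ 2`, and `h / W > 1 / (4 f)`. -/
theorem tournament_prob {f h W : ℝ} (hf : 0 < f) (hW : 0 < W) (m : ℕ) (hm : h = m + 1)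
    (h1 : 2 * m * f ≤ W) (h2 : W < 4 * h * f) (hfW : f ≤ W) :
    (8 * f)⁻¹ ≤ h * (W⁻¹ * (1 - f / W) ^ m) := by
  have hb : 1 / 2 ≤ (1 - f / W) ^ m := by
    have h0 : f / W ≤ 1 := (div_le_one hW).2 hfW
    have := one_add_mul_le_pow (show (-2 : ℝ) ≤ -(f / W) by linarith) m
    have h3 : m * (f / W) ≤ 1 / 2 := by
      rw [← mul_div_assoc, div_le_iff₀ hW]
      linarith
    calc (1 : ℝ) / 2 ≤ 1 + m * -(f / W) := by linarith
      _ ≤ (1 + -(f / W)) ^ m := this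
      _ = _ := by ring_nf
  have hh : 0 < h := by rw [hm]; positivity
  calc (8 * f)⁻¹ = 1 / (8 * f) := by rw [one_div]
    _ ≤ h / W * (1 / 2) := by
        rw [div_mul_div_comm, div_le_div_iff₀ (by positivity) (by positivity)]
        linarith
    _ ≤ h / W * (1 - f / W) ^ m := by gcongr
    _ = _ := by ring

/-- The right exponent is guessed with probability at least `1 / (2 n.size)`; given it, `p` wins
with probability at least `1 / (8 f)`, where `f` is the number of far points. The initial center is
irrelevant, since its recorded distance `0` is at most `ρ`. -/
theorem sampleDist_far {p : ℕ} (hp : p ∈ far X n k ρ) (hρ : 0 ≤ ρ) (hn : 1 ≤ n) :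
    ENNReal.ofReal ((16 * n.size * #(far X n k ρ) : ℝ)⁻¹) ≤ sampleDist X n k n.size p := by
  classical
  have hL : 1 ≤ n.size := Nat.size_pos.2 hn
  have hf : 1 ≤ #(far X n k ρ) := card_pos.2 ⟨p, hp⟩
  obtain ⟨v, hv1, hvL, h1, h2⟩ := exists_rounds hf hL
  have h2v : 2 ≤ 2 ^ v := by
    calc 2 = 2 ^ 1 := rfl
      _ ≤ 2 ^ v := Nat.pow_le_pow_right (by norm_num) hv1
  rw [apply_eq_ev, sampleDist, ev_bind]
  refine le_trans ?_ (le_ev_bits (v := v) ?_ _)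
  swap
  · exact hvL.trans_lt (Nat.lt_size_self _)
  simp only [if_pos hvL, ev_bind, ev_map]
  have key : ENNReal.ofReal ((8 * #(far X n k ρ) : ℝ)⁻¹) ≤
      ((2 ^ v - 1 : ℕ) : ℝ≥0∞) * (2⁻¹ ^ n.size * nearProb X n k ρ ^ (2 ^ v - 1 - 1)) := by
    have hle : #(far X n k ρ) ≤ 2 ^ n.size := by
      simpa using card_le_card (far_subset (X := X) (n := n) (k := k) (ρ := ρ))
    have hle' : (#(far X n k ρ) : ℝ) ≤ 2 ^ n.size := by exact_mod_cast hle
    rw [nearProb_eq, inv_two_pow_eq_ofReal, ← ENNReal.ofReal_pow, ← ENNReal.ofReal_mul,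
      ← ENNReal.ofReal_natCast, ← ENNReal.ofReal_mul]
    · refine ENNReal.ofReal_le_ofReal (tournament_prob (by exact_mod_cast hf) (by positivity) _
        ?_ ?_ ?_ hle')
      · have : 2 ^ v - 1 = (2 ^ v - 1 - 1) + 1 := by omega
        exact_mod_cast this
      · have : 2 * (2 ^ v - 1 - 1) * #(far X n k ρ) ≤ 2 ^ n.size := by
          rwa [show 2 ^ v - 1 - 1 = 2 ^ v - 2 by omega]
        exact_mod_cast this
      · exact_mod_cast h2
    · positivity
    · positivity
    · rw [sub_nonneg, div_le_one (by positivity)]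
      exact hle'
  calc ENNReal.ofReal ((16 * n.size * #(far X n k ρ) : ℝ)⁻¹)
      = ENNReal.ofReal ((2 * n.size : ℝ)⁻¹) * ENNReal.ofReal ((8 * #(far X n k ρ) : ℝ)⁻¹) := by
        rw [← ENNReal.ofReal_mul (by positivity), ← mul_inv]
        ring_nf
    _ ≤ 2⁻¹ ^ n.size.size * _ := mul_le_mul' (ofReal_inv_two_mul_le hL) key
    _ ≤ _ := by
        refine mul_le_mul_right ?_ _
        refine le_trans (le_of_eq (ev_const (bits k.size) _).symm) (ev_mono _ fun c => ?_)
        exact tournament_find hp _ 0 (n + c, 0) hρ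

/-- The exponent `0` means no rounds, so the initial random center is returned. -/
theorem sampleDist_center {c : ℕ} (hc : c < k) (hn : 1 ≤ n) :
    ENNReal.ofReal ((4 * n.size * k : ℝ)⁻¹) ≤ sampleDist X n k n.size (n + c) := by
  classical
  have hL : 1 ≤ n.size := Nat.size_pos.2 hn
  rw [apply_eq_ev, sampleDist, ev_bind]
  refine le_trans ?_ (le_ev_bits (v := 0) (by positivity) _)
  rw [ev_bind]
  refine le_trans ?_ (mul_le_mul_right (le_ev_bits (v := c) (hc.trans (Nat.lt_size_self _)) _) _)
  rw [ev_map]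
  simp only [zero_le, if_true, pow_zero, Nat.sub_self, iter, ev_pure, mul_one]
  calc ENNReal.ofReal ((4 * n.size * k : ℝ)⁻¹)
      = ENNReal.ofReal ((2 * n.size : ℝ)⁻¹) * ENNReal.ofReal ((2 * k : ℝ)⁻¹) := by
        rw [← ENNReal.ofReal_mul (by positivity), ← mul_inv]
        ring_nf
    _ ≤ _ := mul_le_mul' (ofReal_inv_two_mul_le hL) (ofReal_inv_two_mul_le (by omega))

end

/-! ### Means of random samples -/

section

variable {ι E : Type*} [NormedAddCommGroup E]

/-- Expectation of `F` at `z` plus the sum of `m` independent uniform samples of the family `x`. -/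
def avgIter (C : Finset ι) (x : ι → E) (F : E → ℝ≥0∞) : ℕ → E → ℝ≥0∞
  | 0, z => F z
  | m + 1, z => (#C : ℝ≥0∞)⁻¹ * ∑ p ∈ C, avgIter C x F m (z + x p)

/-- Domination by a factor `θ` for one draw becomes `θ ^ m` for `m` independent draws. -/
theorem avgIter_le_ev {β : Type*} {C : Finset ι} {x : ι → E} {q : PMF β} {X : β → E} {θ : ℝ≥0∞}
    (h : ∀ G : E → ℝ≥0∞, θ * ((#C : ℝ≥0∞)⁻¹ * ∑ p ∈ C, G (x p)) ≤ ev q (fun b => G (X b)))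
    (F : E → ℝ≥0∞) (m i : ℕ) (z : E) :
    θ ^ m * avgIter C x F m z ≤ ev (iter (fun _ z => q.map (fun b => z + X b)) i m z) F := by
  induction m generalizing i z with
  | zero => simp [iter, avgIter, ev_pure]
  | succ m ih =>
    rw [iter, ev_bind, ev_map, avgIter]
    refine le_trans ?_ (h fun y => ev (iter (fun _ z => q.map (fun b => z + X b)) (i + 1) m
      (z + y)) F)
    rw [pow_succ', mul_assoc]
    refine mul_le_mul_right ?_ _
    rw [mul_left_comm, mul_sum]
    exact mul_le_mul_right (sum_le_sum fun p _ => ih _ _) _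

variable [InnerProductSpace ℝ E]

/-- The parallel axis identity: the mixed terms cancel because the deviations from `c` sum to zero.
-/
theorem sum_norm_add_sq (C : Finset ι) (x : ι → E) (c u : E) (hc : ∑ p ∈ C, (x p - c) = 0) :
    ∑ p ∈ C, ‖u + (x p - c)‖ ^ 2 = #C * ‖u‖ ^ 2 + ∑ p ∈ C, ‖x p - c‖ ^ 2 := by
  simp only [norm_add_sq_real, sum_add_distrib, ← mul_sum, ← inner_sum, hc, inner_zero_right,
    mul_zero, add_zero, sum_const, nsmul_eq_mul]

theorem ofReal_sum_le {C : Finset ι} (f : ι → ℝ) :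
    ENNReal.ofReal (∑ p ∈ C, f p) ≤ ∑ p ∈ C, ENNReal.ofReal (f p) := by
  classical
  induction C using Finset.induction_on with
  | empty => simp
  | insert a C ha ih =>
    rw [sum_insert ha, sum_insert ha]
    exact ENNReal.ofReal_add_le.trans (by gcongr)

-- This is Markov's inequality for the squared distance to `a`. The quantity `‖z + m c - a‖² + m V`
-- is the second moment after the remaining draws. Averaging over one draw preserves it, by the
-- parallel axis identity, so the induction needs no moments of the whole sample.
open Classical in
theorem one_sub_le_avgIter {C : Finset ι} (hC : C.Nonempty) (x : ι → E) (c a : E) {B V : ℝ}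
    (hc : ∑ p ∈ C, (x p - c) = 0) (hV : ∑ p ∈ C, ‖x p - c‖ ^ 2 = #C * V) (hB : 0 < B)
    (m : ℕ) (z : E) :
    ENNReal.ofReal (1 - (‖z + (m : ℝ) • c - a‖ ^ 2 + m * V) / B) ≤
      avgIter C x (fun y => if ‖y - a‖ ^ 2 ≤ B then 1 else 0) m z := by
  have hN : (0 : ℝ) < #C := by exact_mod_cast hC.card_pos
  induction m generalizing z with
  | zero =>
    simp only [avgIter, Nat.cast_zero, zero_smul, add_zero, zero_mul]
    split_ifs with h
    · refine ENNReal.ofReal_le_one.2 ?_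
      have : 0 ≤ ‖z - a‖ ^ 2 / B := by positivity
      linarith
    · rw [not_le] at h
      rw [ENNReal.ofReal_eq_zero.2]
      rw [sub_nonpos, one_le_div hB]
      exact h.le
  | succ m ih =>
    rw [avgIter]
    have h1 : ENNReal.ofReal (∑ p ∈ C, (1 - (‖z + x p + (m : ℝ) • c - a‖ ^ 2 + m * V) / B)) ≤
        ∑ p ∈ C, avgIter C x (fun y => if ‖y - a‖ ^ 2 ≤ B then 1 else 0) m (z + x p) :=
      (ofReal_sum_le _).trans (sum_le_sum fun p _ => ih (z + x p))
    refine le_trans (le_of_eq ?_) (mul_le_mul_right h1 _)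
    have h2 : ∑ p ∈ C, ‖z + x p + (m : ℝ) • c - a‖ ^ 2 =
        #C * ‖z + ((m + 1 : ℕ) : ℝ) • c - a‖ ^ 2 + #C * V := by
      rw [← hV, ← sum_norm_add_sq C x c _ hc]
      refine sum_congr rfl fun p _ => ?_
      congr 2
      push_cast
      module
    rw [sum_sub_distrib, ← sum_div, sum_add_distrib, h2, ← ENNReal.ofReal_natCast #C,
      ← ENNReal.ofReal_inv_of_pos hN, ← ENNReal.ofReal_mul (by positivity)]
    congr 1
    simp only [sum_const, nsmul_eq_mul, mul_one]
    push_cast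
    field_simp
    ring

theorem avgIter_of_forall_eq {C : Finset ι} (hC : C.Nonempty) (x : ι → E) (c : E)
    (hx : ∀ p ∈ C, x p = c) (F : E → ℝ≥0∞) (m : ℕ) (z : E) :
    avgIter C x F m z = F (z + (m : ℝ) • c) := by
  induction m generalizing z with
  | zero => simp [avgIter]
  | succ m ih =>
    rw [avgIter, sum_congr rfl fun p hp => by rw [hx p hp, ih], sum_const, nsmul_eq_mul, ← mul_assoc,
      ENNReal.inv_mul_cancel (by simpa using hC.ne_empty) (ENNReal.natCast_ne_top _), one_mul]
    congr 1
    push_cast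
    module

open Classical in
theorem half_le_avgIter {C : Finset ι} (hC : C.Nonempty) (x : ι → E) (c a : E) {B V : ℝ}
    (hc : ∑ p ∈ C, (x p - c) = 0) (hV : ∑ p ∈ C, ‖x p - c‖ ^ 2 = #C * V) (m : ℕ) (hm : 1 ≤ m) (z : E)
    (hB : 2 * (‖z + (m : ℝ) • c - a‖ ^ 2 + m * V) ≤ B) :
    2⁻¹ ≤ avgIter C x (fun y => if ‖y - a‖ ^ 2 ≤ B then 1 else 0) m z := by
  have hN : (0 : ℝ) < #C := by exact_mod_cast hC.card_pos
  have hV0 : 0 ≤ V := nonneg_of_mul_nonneg_right (hV ▸ sum_nonneg fun p _ => sq_nonneg _) hN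
  have hB0 : 0 ≤ B := le_trans (by positivity) hB
  -- Markov's inequality needs `0 < B`. If `B = 0`, the variance vanishes, all samples equal `c`,
  -- and the event is certain.
  rcases hB0.eq_or_lt with rfl | hB0
  · have hV1 : m * V = 0 := le_antisymm (by nlinarith [sq_nonneg ‖z + (m : ℝ) • c - a‖])
      (by positivity)
    have hV2 : V = 0 := (mul_eq_zero.1 hV1).resolve_left (by positivity)
    rw [hV2, mul_zero, sum_eq_zero_iff_of_nonneg fun p _ => sq_nonneg _] at hV
    rw [avgIter_of_forall_eq hC x c (fun p hp => by simpa [sub_eq_zero] using hV p hp), if_pos]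
    · norm_num
    · linarith
  · refine le_trans ?_ (one_sub_le_avgIter hC x c a hc hV hB0 m z)
    rw [show (2⁻¹ : ℝ≥0∞) = ENNReal.ofReal (1 / 2) by
      rw [one_div, ENNReal.ofReal_inv_of_pos (by norm_num)]; norm_num]
    refine ENNReal.ofReal_le_ofReal ?_
    have : (‖z + (m : ℝ) • c - a‖ ^ 2 + m * V) / B ≤ 1 / 2 := by
      rw [div_le_iff₀ hB0]
      linarith
    linarith

end

/-! ### The probability that a center is good -/

section

variable {d n k m : ℕ} {X : ℕ → Point d} {ρ : ℝ}

theorem exists_center_of_minSqDist_le (hk : 1 ≤ k) {u : ℕ} (h : minSqDist X n k u ≤ ρ) :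
    ∃ c < k, ‖X u - X (n + c)‖ ^ 2 ≤ ρ := by
  induction k, hk using Nat.le_induction with
  | base =>
    refine ⟨0, one_pos, ?_⟩
    simpa [minSqDist] using h
  | succ k hk ih =>
    rw [minSqDist, min_le_iff] at h
    rcases h with h | h
    · obtain ⟨c, hc, h⟩ := ih h
      exact ⟨c, by omega, h⟩
    · exact ⟨k, by omega, h⟩

theorem minSqDist_le {c : ℕ} (hc : c < k) (u : ℕ) : minSqDist X n k u ≤ ‖X u - X (n + c)‖ ^ 2 := by
  induction k with
  | zero => omega
  | succ k ih =>
    rw [minSqDist]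
    rcases Nat.lt_succ_iff_lt_or_eq.1 hc with hc | rfl
    · exact (min_le_left _ _).trans (ih hc)
    · exact min_le_right _ _

/-- The map `π` fixes far points and moves near ones to centers. The fibre of a far point has one
element, so its weight `θ / #C` only has to be below a multiple of `1 / #far`, which the bound on
`#far` gives. The fibre of a center may be all of `C`, but a center has probability at least `1 / (4
n.size k)`. -/
theorem sampleDist_dominates {C : Finset (Fin n)} (hC : C.Nonempty) (hn : 1 ≤ n) (hk : 1 ≤ k)
    (hρ : 0 ≤ ρ) {K θ : ℝ} (hfar : (#(far X n k ρ) : ℝ) ≤ K * #C)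
    (hθK : θ * (16 * n.size * K) ≤ 1) (hθk : θ * (4 * n.size * k) ≤ 1) (hθ : 0 ≤ θ)
    {π : Fin n → ℕ}
    (hπ : ∀ p ∈ C, ((p : ℕ) ∈ far X n k ρ ∧ π p = p) ∨ ∃ c < k, π p = n + c)
    (G : Point d → ℝ≥0∞) :
    ENNReal.ofReal θ * ((#C : ℝ≥0∞)⁻¹ * ∑ p ∈ C, G (X (π p))) ≤
      ev (sampleDist X n k n.size) (fun b => G (X b)) := by
  classical
  have hN : (0 : ℝ) < #C := by exact_mod_cast hC.card_pos
  have hL : (0 : ℝ) < n.size := by exact_mod_cast Nat.size_pos.2 hn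
  have hk' : (0 : ℝ) < k := by exact_mod_cast hk
  refine le_trans ?_ (sum_le_ev _ (C.image π) _)
  rw [sum_comp (fun b => G (X b)) π, mul_sum, mul_sum]
  refine sum_le_sum fun b hb => ?_
  rw [nsmul_eq_mul, ← mul_assoc, ← mul_assoc]
  refine mul_le_mul_left ?_ _
  obtain ⟨p, hp, rfl⟩ := mem_image.1 hb
  rw [← ENNReal.ofReal_natCast #C, ← ENNReal.ofReal_inv_of_pos hN,
    ← ENNReal.ofReal_natCast #(filter _ _), ← ENNReal.ofReal_mul hθ,
    ← ENNReal.ofReal_mul (by positivity)]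
  rcases hπ p hp with ⟨hpf, hπp⟩ | ⟨c, hc, hπp⟩
  · rw [hπp]
    refine le_trans (ENNReal.ofReal_le_ofReal ?_) (sampleDist_far hpf hρ hn)
    have hcard : #{a ∈ C | π a = p} ≤ 1 := by
      refine card_le_one.2 fun a ha b hb => ?_
      have aux : ∀ a ∈ filter (fun a => π a = (p : ℕ)) C, a = p := fun a ha => by
        obtain ⟨haC, ha⟩ := mem_filter.1 ha
        rcases hπ a haC with ⟨-, h⟩ | ⟨c, -, h⟩
        · exact Fin.ext (h.symm.trans ha)
        · have := p.2
          omega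
      rw [aux a ha, aux b hb]
    have hcard' : (#{a ∈ C | π a = p} : ℝ) ≤ 1 := by exact_mod_cast hcard
    have hf : (0 : ℝ) < #(far X n k ρ) := by exact_mod_cast card_pos.2 ⟨_, hpf⟩
    calc θ * (#C : ℝ)⁻¹ * #{a ∈ C | π a = p} ≤ θ * (#C : ℝ)⁻¹ * 1 := by gcongr
      _ ≤ (16 * n.size * #(far X n k ρ) : ℝ)⁻¹ := by
        rw [mul_one, ← div_eq_mul_inv, ← one_div, div_le_div_iff₀ hN (by positivity), one_mul]
        calc θ * (16 * n.size * #(far X n k ρ)) ≤ θ * (16 * n.size * (K * #C)) := by gcongr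
          _ = θ * (16 * n.size * K) * #C := by ring
          _ ≤ 1 * #C := by gcongr
          _ = #C := one_mul _
  · rw [hπp]
    refine le_trans (ENNReal.ofReal_le_ofReal ?_) (sampleDist_center hc hn)
    have hcard : (#{a ∈ C | π a = n + c} : ℝ) ≤ #C := by exact_mod_cast card_filter_le _ _
    calc θ * (#C : ℝ)⁻¹ * #{a ∈ C | π a = n + c} ≤ θ * (#C : ℝ)⁻¹ * #C := by gcongr
      _ = θ := by field_simp
      _ ≤ (4 * n.size * k : ℝ)⁻¹ := by
        rw [← one_div, le_div_iff₀ (by positivity)]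
        exact hθk

open Classical in
theorem meanDist_prob {C : Finset (Fin n)} (hC : C.Nonempty) (hn : 1 ≤ n) (hk : 1 ≤ k) (hm : 1 ≤ m)
    (hρ : 0 ≤ ρ) {K θ : ℝ} (hfar : (#(far X n k ρ) : ℝ) ≤ K * #C)
    (hθK : θ * (16 * n.size * K) ≤ 1) (hθk : θ * (4 * n.size * k) ≤ 1) (hθ : 0 ≤ θ)
    {μ : Point d} {Δ : ℝ} (hμ : ∑ p ∈ C, (X p - μ) = 0) (hΔ : ∑ p ∈ C, ‖X p - μ‖ ^ 2 = #C * Δ) :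
    ENNReal.ofReal θ ^ m * 2⁻¹ ≤ ev (meanDist X n k m n.size)
      (fun y => if ‖y - μ‖ ^ 2 ≤ 2 * ρ + 4 * (Δ + ρ) / m then 1 else 0) := by
  have hN : (0 : ℝ) < #C := by exact_mod_cast hC.card_pos
  have hm' : (0 : ℝ) < m := by exact_mod_cast hm
  have hex : ∀ p : Fin n, ∃ b : ℕ, (((p : ℕ) ∈ far X n k ρ ∧ b = p) ∨ ∃ c < k, b = n + c) ∧
      ‖X b - X p‖ ^ 2 ≤ ρ := by
    intro p
    by_cases hp : (p : ℕ) ∈ far X n k ρ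
    · exact ⟨p, Or.inl ⟨hp, rfl⟩, by simpa using hρ⟩
    · obtain ⟨c, hc, h⟩ := exists_center_of_minSqDist_le hk
        (not_lt.1 fun h => hp (mem_far.2 ⟨p.2, h⟩))
      exact ⟨n + c, Or.inr ⟨c, hc, rfl⟩, by rwa [norm_sub_rev]⟩
  choose π hπ hπρ using hex
  set c : Point d := (#C : ℝ)⁻¹ • ∑ p ∈ C, X (π p) with hc
  have hNc : (#C : ℝ) • c = ∑ p ∈ C, X (π p) := by rw [hc, smul_inv_smul₀ hN.ne']
  have hc0 : ∑ p ∈ C, (X (π p) - c) = 0 := by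
    rw [sum_sub_distrib, ← hNc, sum_const, ← Nat.cast_smul_eq_nsmul ℝ, sub_self]
  -- The mean moves by at most the average displacement, and each displacement is at most `√ρ`.
  have hcμ : ‖c - μ‖ ^ 2 ≤ ρ := by
    have h1 : (#C : ℝ) • (c - μ) = ∑ p ∈ C, (X (π p) - X p) := by
      rw [sum_sub_distrib, smul_sub, hNc]
      rw [sum_sub_distrib, sub_eq_zero] at hμ
      rw [hμ, sum_const, Nat.cast_smul_eq_nsmul]
    have h2 : #C * ‖c - μ‖ ≤ #C * √ρ := by
      calc #C * ‖c - μ‖ = ‖(#C : ℝ) • (c - μ)‖ := by rw [norm_smul, Real.norm_natCast]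
        _ ≤ ∑ p ∈ C, ‖X (π p) - X p‖ := by
          rw [h1]
          exact norm_sum_le _ _
        _ ≤ ∑ p ∈ C, √ρ := sum_le_sum fun p _ => Real.le_sqrt_of_sq_le (hπρ p)
        _ = #C * √ρ := by simp
    calc ‖c - μ‖ ^ 2 ≤ √ρ ^ 2 := by
          gcongr
          exact le_of_mul_le_mul_left h2 hN
      _ = ρ := Real.sq_sqrt hρ
  set V : ℝ := (∑ p ∈ C, ‖X (π p) - c‖ ^ 2) / #C with hV
  have hNV : ∑ p ∈ C, ‖X (π p) - c‖ ^ 2 = #C * V := by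
    rw [hV]
    field_simp
  -- The variance about `c` is at most the mean square about `μ`, which is bounded by `‖x + y‖² ≤ 2
  -- ‖x‖² + 2 ‖y‖²` from displacement and original deviation.
  have hVle : V ≤ 2 * (Δ + ρ) := by
    have h1 := sum_norm_add_sq C (fun p => X (π p)) c (c - μ) hc0
    have h2 : ∑ p ∈ C, ‖(c - μ) + (X (π p) - c)‖ ^ 2 ≤ ∑ p ∈ C, (2 * ‖X p - μ‖ ^ 2 + 2 * ρ) := by
      refine sum_le_sum fun p _ => ?_
      rw [show (c - μ) + (X (π p) - c) = (X (π p) - X p) + (X p - μ) by abel]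
      have h3 := parallelogram_law_with_norm ℝ (X (π p) - X p) (X p - μ)
      nlinarith [hπρ p, sq_nonneg ‖X (π p) - X p - (X p - μ)‖]
    rw [sum_add_distrib, ← mul_sum, hΔ, sum_const, nsmul_eq_mul, h1, hNV] at h2
    have h3 : (#C : ℝ) * V ≤ #C * (2 * (Δ + ρ)) := by
      nlinarith [mul_nonneg hN.le (sq_nonneg ‖c - μ‖)]
    exact le_of_mul_le_mul_left h3 hN
  rw [meanDist, ev_map]
  have hind : ∀ z : Point d, (‖(m : ℝ)⁻¹ • z - μ‖ ^ 2 ≤ 2 * ρ + 4 * (Δ + ρ) / m) ↔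
      ‖z - (m : ℝ) • μ‖ ^ 2 ≤ (m : ℝ) ^ 2 * (2 * ρ + 4 * (Δ + ρ) / m) := by
    intro z
    rw [show z - (m : ℝ) • μ = (m : ℝ) • ((m : ℝ)⁻¹ • z - μ) by
      rw [smul_sub, smul_inv_smul₀ hm'.ne'], norm_smul, mul_pow, Real.norm_natCast,
      mul_le_mul_iff_right₀ (by positivity)]
  simp only [hind]
  refine le_trans (mul_le_mul_right ?_ _) (avgIter_le_ev (C := C) (x := fun p => X (π p))
    (X := X) (θ := ENNReal.ofReal θ) (fun G => sampleDist_dominates hC hn hk hρ hfar hθK hθk hθ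
      (fun p _ => hπ p) G) _ m 0 0)
  refine half_le_avgIter hC _ c _ hc0 hNV m hm 0 ?_
  rw [zero_add, ← smul_sub, norm_smul, mul_pow, Real.norm_natCast]
  have h1 : (m : ℝ) ^ 2 * (2 * ρ + 4 * (Δ + ρ) / m) = 2 * (m ^ 2 * ρ + m * (2 * (Δ + ρ))) := by
    field_simp
    ring
  rw [h1]
  gcongr

end

/-! ### Iterations with invariants -/

section

variable {α : Type*} {κ : ℕ → α → PMF α}

open Classical in
theorem pow_le_ev_iter {I : ℕ → α → Prop} {q : ℝ≥0∞} {tot : ℕ}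
    (h : ∀ i < tot, ∀ a, I i a → q ≤ ev (κ i a) (fun a => if I (i + 1) a then 1 else 0)) (m i : ℕ)
    (hi : i + m = tot) (a : α) (ha : I i a) :
    q ^ m ≤ ev (iter κ i m a) (fun a => if I tot a then 1 else 0) := by
  induction m generalizing i a with
  | zero =>
    obtain rfl : i = tot := by omega
    simp [iter, ev_pure, ha]
  | succ m ih =>
    rw [iter, ev_bind, pow_succ]
    calc q ^ m * q ≤ q ^ m * ev (κ i a) (fun a => if I (i + 1) a then 1 else 0) :=
          mul_le_mul_right (h i (by omega) a ha) _
      _ = ev (κ i a) (fun a => q ^ m * if I (i + 1) a then 1 else 0) := (ev_const_mul _ _ _).symm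
      _ ≤ _ := ev_mono _ fun a' => ?_
    split_ifs with ha'
    · rw [mul_one]
      exact ih (i + 1) (by omega) a' ha'
    · simp

end

section

variable {d n k m L : ℕ}

open Classical in
theorem ev_iter_true (good : (ℕ → Point d) → Prop) (N i : ℕ) (X : ℕ → Point d) :
    1 ≤ ev (iter (fun _ σ => (attemptDist σ.1 n k m L).map (fun X' => (X', σ.2 ∨ good X'))) i N
      (X, True)) (fun σ => if σ.2 then 1 else 0) := by
  have := pow_le_ev_iter (I := fun _ σ => σ.2) (q := 1) (tot := i + N)
    (κ := fun _ (σ : (ℕ → Point d) × Prop) =>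
      (attemptDist σ.1 n k m L).map (fun X' => (X', σ.2 ∨ good X')))
    (fun i _ σ hσ => ?_) N i rfl (X, True) trivial
  · simpa using this
  · rw [ev_map]
    simp [hσ, ev_const]

-- The attempts are not independent, since each inherits the centers of the previous one. So the
-- success bound is required from every state in `same`, a property that is almost surely kept, and
-- the claim is `1 - (1 - p) ^ (N + 1) = y + (1 - y) p` with `y` the bound for `N` attempts.
open Classical in
theorem searchDist_prob {good same : (ℕ → Point d) → Prop} {p : ℝ} (hp0 : 0 ≤ p) (hp1 : p ≤ 1)
    (hgood : ∀ X, good X → same X)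
    (hsame : ∀ X, same X → 1 ≤ ev (attemptDist X n k m L) (fun X => if same X then 1 else 0))
    (hp : ∀ X, same X → ENNReal.ofReal p ≤
      ev (attemptDist X n k m L) (fun X => if good X then 1 else 0))
    (N i : ℕ) (X : ℕ → Point d) (hX : same X) :
    ENNReal.ofReal (1 - (1 - p) ^ N) ≤
      ev (iter (fun _ σ => (attemptDist σ.1 n k m L).map (fun X' => (X', σ.2 ∨ good X'))) i N
      (X, False)) (fun σ => if σ.2 then 1 else 0) := by
  induction N generalizing i X with
  | zero => simp
  | succ N ih =>
    rw [iter, ev_bind, ev_map]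
    set y : ℝ := 1 - (1 - p) ^ N with hy
    have hz0 : 0 ≤ (1 - p) ^ N := pow_nonneg (by linarith) _
    have hz1 : (1 - p) ^ N ≤ 1 := pow_le_one₀ (by linarith) (by linarith)
    have hy0 : 0 ≤ y := by linarith
    calc ENNReal.ofReal (1 - (1 - p) ^ (N + 1))
        = ENNReal.ofReal y * 1 + ENNReal.ofReal (1 - y) * ENNReal.ofReal p := by
          rw [mul_one, ← ENNReal.ofReal_mul (by linarith), ← ENNReal.ofReal_add hy0
            (mul_nonneg (by linarith) hp0), hy, pow_succ]
          ring_nf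
      _ ≤ ENNReal.ofReal y * ev (attemptDist X n k m L) (fun X => if same X then 1 else 0) +
          ENNReal.ofReal (1 - y) *
            ev (attemptDist X n k m L) (fun X => if good X then 1 else 0) := by
          gcongr
          · exact hsame X hX
          · exact hp X hX
      _ = ev (attemptDist X n k m L) (fun X => ENNReal.ofReal y * (if same X then 1 else 0) +
          ENNReal.ofReal (1 - y) * (if good X then 1 else 0)) := by
          rw [ev_add, ev_const_mul, ev_const_mul]
      _ ≤ _ := ev_mono _ fun X' => ?_
    by_cases hg : good X'
    · simp only [hg, hgood X' hg, if_true, mul_one, or_true]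
      rw [← ENNReal.ofReal_add hy0 (by linarith), add_sub_cancel, ENNReal.ofReal_one]
      exact ev_iter_true good N (i + 1) X'
    · by_cases hs : same X'
      · simp only [hg, hs, if_true, if_false, mul_one, mul_zero, add_zero, or_false]
        exact ih (i + 1) X' hs
      · simp [hg, hs]

end

/-! ### Costs of clusterings -/

theorem half_sum_sum_norm_sub_sq {ι E : Type*} [NormedAddCommGroup E] [InnerProductSpace ℝ E]
    (C : Finset ι) (x : ι → E) (c : E) (hc : ∑ p ∈ C, (x p - c) = 0) :
    (1 / 2 : ℝ) * ∑ p ∈ C, ∑ q ∈ C, ‖x p - x q‖ ^ 2 = #C * ∑ p ∈ C, ‖x p - c‖ ^ 2 := by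
  have h : ∀ q ∈ C, ∑ p ∈ C, ‖x q - x p‖ ^ 2 = #C * ‖x q - c‖ ^ 2 + ∑ p ∈ C, ‖x p - c‖ ^ 2 := by
    intro q _
    rw [← norm_neg (x q - c), ← sum_norm_add_sq C x c _ hc]
    refine sum_congr rfl fun p _ => ?_
    rw [norm_sub_rev]
    congr 2
    abel
  rw [sum_congr rfl h, sum_add_distrib, ← mul_sum, sum_const, nsmul_eq_mul]
  ring

section

variable {n d k : ℕ} {ε : ℝ} (A : Fin n → Point d) (C : Fin n → Fin k)

theorem sum_sub_mean (i : Fin k) : ∑ p ∈ cluster C i, (A p - mean A C i) = 0 := by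
  rcases (cluster C i).eq_empty_or_nonempty with h | h
  · simp [h]
  · have : (#(cluster C i) : ℝ) ≠ 0 := by exact_mod_cast h.card_pos.ne'
    rw [sum_sub_distrib, sum_const, ← Nat.cast_smul_eq_nsmul ℝ, mean, smul_inv_smul₀ this, sub_self]

theorem sum_norm_sub_mean_sq (i : Fin k) :
    ∑ p ∈ cluster C i, ‖A p - mean A C i‖ ^ 2 = #(cluster C i) * avgSqDist A C i := by
  rcases (cluster C i).eq_empty_or_nonempty with h | h
  · simp [h]
  · have : (#(cluster C i) : ℝ) ≠ 0 := by exact_mod_cast h.card_pos.ne'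
    rw [avgSqDist]
    field_simp

theorem avgSqDist_nonneg (i : Fin k) : 0 ≤ avgSqDist A C i :=
  div_nonneg (sum_nonneg fun _ _ => sq_nonneg _) (Nat.cast_nonneg _)

theorem cost_eq : cost A C = ∑ i, (#(cluster C i) : ℝ) ^ 2 * avgSqDist A C i := by
  refine sum_congr rfl fun i _ => ?_
  rw [half_sum_sum_norm_sub_sq _ A _ (sum_sub_mean A C i), sum_norm_sub_mean_sq]
  ring

variable {A C}

theorem IsOptimal.le_opt (h : IsOptimal A C) (i : Fin k) :
    (#(cluster C i) : ℝ) ^ 2 * avgSqDist A C i ≤ opt A k := by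
  rw [← h, cost_eq]
  exact single_le_sum (f := fun i => (#(cluster C i) : ℝ) ^ 2 * avgSqDist A C i)
    (fun i _ => mul_nonneg (sq_nonneg _) (avgSqDist_nonneg A C i)) (mem_univ i)

theorem opt_nonneg (A : Fin n → Point d) (k : ℕ) : 0 ≤ opt A k :=
  Real.iInf_nonneg fun C => by
    rw [cost_eq]
    exact sum_nonneg fun i _ => mul_nonneg (sq_nonneg _) (avgSqDist_nonneg A C i)

/-- The center `m` covers the `i`-th cluster. -/
def CoveredBy (ε : ℝ) (A : Fin n → Point d) (C : Fin n → Fin k) (i : Fin k) (m : Point d) : Prop :=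
  (#(cluster C i) : ℝ) ^ 2 * ‖mean A C i - m‖ ^ 2 ≤
    ε / 2 * (1 / (k : ℝ) * opt A k + (#(cluster C i) : ℝ) ^ 2 * avgSqDist A C i)

/-- By the parallel axis identity the left side is the covering error plus the cost of the cluster.
The former is at most `OPT`, because `ε < 1` and `1 / k ≤ 1`, and so is the latter. -/
theorem CoveredBy.sum_le (hC : IsOptimal A C) (hk : 1 ≤ k) (hε : ε < 1) {i : Fin k}
    {m : Point d} (h : CoveredBy ε A C i m) :
    #(cluster C i) * ∑ p ∈ cluster C i, ‖A p - m‖ ^ 2 ≤ 2 * opt A k := by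
  have h1 : ∑ p ∈ cluster C i, ‖A p - m‖ ^ 2 =
      #(cluster C i) * ‖mean A C i - m‖ ^ 2 + #(cluster C i) * avgSqDist A C i := by
    rw [← sum_norm_sub_mean_sq, ← sum_norm_add_sq _ A _ _ (sum_sub_mean A C i)]
    refine sum_congr rfl fun p _ => ?_
    congr 2
    abel
  have h2 := hC.le_opt i
  have h3 := opt_nonneg A k
  have h4 : 1 / (k : ℝ) * opt A k ≤ opt A k := by
    refine mul_le_of_le_one_left h3 ?_
    rw [div_le_one (by positivity)]
    exact_mod_cast hk
  have h5 : ε / 2 * (1 / (k : ℝ) * opt A k + (#(cluster C i) : ℝ) ^ 2 * avgSqDist A C i) ≤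
      1 / 2 * (opt A k + opt A k) := by
    have := avgSqDist_nonneg A C i
    gcongr
  rw [CoveredBy] at h
  rw [h1]
  nlinarith

/-- The invariant of the rounds: the points are intact, and the clusters with numbers
`σ 0, …, σ (j - 1)` are covered by the respective centers. -/
def Invariant (ε : ℝ) (A : Fin n → Point d) (C : Fin n → Fin k) (σ : Equiv.Perm (Fin k)) (j : ℕ)
    (X : ℕ → Point d) : Prop :=
  (∀ p : Fin n, X p = A p) ∧ ∀ j' : Fin k, (j' : ℕ) < j → CoveredBy ε A C (σ j') (X (n + j'))

theorem card_far_eq (X : ℕ → Point d) (ρ : ℝ) : #(far X n k ρ) =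
    ∑ i, #((cluster C i).filter fun p : Fin n => (p : ℕ) ∈ far X n k ρ) := by
  have h : far X n k ρ = ((univ : Finset (Fin n)).filter fun p : Fin n => (p : ℕ) ∈ far X n k ρ).map
      Fin.valEmbedding := by
    ext u
    simp only [Finset.mem_map, mem_filter, mem_univ, true_and, Fin.valEmbedding_apply]
    exact ⟨fun hu => ⟨⟨u, (mem_far.1 hu).1⟩, hu, rfl⟩, fun ⟨p, hp, h⟩ => h ▸ hp⟩
  conv_lhs => rw [h, card_map]
  rw [card_eq_sum_card_fiberwise (f := C) (t := univ) fun _ _ => by simp]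
  refine sum_congr rfl fun i _ => ?_
  congr 1
  ext p
  simp [cluster, and_comm]

/-- Each cluster contributes at most `24 k N / ε` far points. An uncovered one has at most `N`
points by the ordering. A covered one has size at least `N` and total squared distance at most `2
OPT / N` to its center, while each far point in it accounts for more than `ρ = ε OPT / (12 k N²)`.
-/
theorem card_far_le (hC : IsOptimal A C) (hk : 1 ≤ k) (hε0 : 0 < ε) (hε : ε < 1)
    {σ : Equiv.Perm (Fin k)} (hσ : ∀ j j', j ≤ j' → #(cluster C (σ j')) ≤ #(cluster C (σ j)))
    {j : Fin k} {X : ℕ → Point d} (hX : Invariant ε A C σ j X) (hN : 0 < #(cluster C (σ j)))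
    {ρ : ℝ} (hρ : ρ * (#(cluster C (σ j)) : ℝ) ^ 2 = ε / (12 * k) * opt A k) :
    (#(far X n k ρ) : ℝ) ≤ 24 * k ^ 2 / ε * #(cluster C (σ j)) := by
  set N := #(cluster C (σ j)) with hNdef
  have hN' : (0 : ℝ) < N := by exact_mod_cast hN
  have hk' : (1 : ℝ) ≤ k := by exact_mod_cast hk
  have hO := opt_nonneg A k
  have key : ∀ i, (#((cluster C i).filter fun p : Fin n => (p : ℕ) ∈ far X n k ρ) : ℝ) ≤
      24 * k / ε * N := by
    intro i
    obtain ⟨j', rfl⟩ := σ.surjective i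
    set S := (cluster C (σ j')).filter fun p : Fin n => (p : ℕ) ∈ far X n k ρ with hS
    rcases le_or_gt j j' with hj | hj
    · have h1 : (#S : ℝ) ≤ N := by
        exact_mod_cast (card_filter_le _ _).trans (hσ j j' hj)
      have h2 : (1 : ℝ) ≤ 24 * k / ε := by
        rw [le_div_iff₀ hε0]
        linarith
      nlinarith
    · have hcov := (hX.2 j' hj).sum_le hC hk hε
      have hNi : (N : ℝ) ≤ #(cluster C (σ j')) := by exact_mod_cast hσ j' j hj.le
      have hfar : ∀ p ∈ S, ρ < ‖A p - X (n + j')‖ ^ 2 := fun p hp => by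
        rw [← hX.1 p]
        exact (mem_far.1 (mem_filter.1 hp).2).2.trans_le (minSqDist_le j'.2 p)
      have hsum : ∑ p ∈ S, ‖A p - X (n + j')‖ ^ 2 ≤
          ∑ p ∈ cluster C (σ j'), ‖A p - X (n + j')‖ ^ 2 :=
        sum_le_sum_of_subset_of_nonneg (filter_subset _ _) fun _ _ _ => sq_nonneg _
      have hsum0 : 0 ≤ ∑ p ∈ S, ‖A p - X (n + j')‖ ^ 2 := sum_nonneg fun _ _ => sq_nonneg _
      have hle : N * ∑ p ∈ S, ‖A p - X (n + j')‖ ^ 2 ≤ 2 * opt A k :=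
        (mul_le_mul hNi hsum hsum0 (by positivity)).trans hcov
      -- If `OPT = 0`, nothing can be divided by it; but then covered clusters lie exactly on their
      -- centers and have no far points.
      rcases hO.eq_or_lt with hO | hO
      · have hρ0 : ρ = 0 := by
          rw [← hO, mul_zero] at hρ
          exact (mul_eq_zero.1 hρ).resolve_right (by positivity)
        have hSe : S = ∅ := by
          by_contra hSe
          have : 0 < ∑ p ∈ S, ‖A p - X (n + j')‖ ^ 2 :=
            sum_pos (fun p hp => hρ0 ▸ hfar p hp) (nonempty_iff_ne_empty.2 hSe)
          rw [← hO, mul_zero] at hle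
          nlinarith [mul_pos hN' this]
        rw [hSe]
        simp only [card_empty, Nat.cast_zero]
        positivity
      · have h1 : #S * ρ ≤ ∑ p ∈ S, ‖A p - X (n + j')‖ ^ 2 := by
          rw [← nsmul_eq_mul]
          exact card_nsmul_le_sum _ _ _ fun p hp => (hfar p hp).le
        have h2 : N * (#S * ρ) ≤ 2 * opt A k := (mul_le_mul_of_nonneg_left h1 hN'.le).trans hle
        have h3 : (#S * (ε / (12 * k))) * opt A k ≤ (2 * N) * opt A k := by
          calc (#S * (ε / (12 * k))) * opt A k = #S * (ρ * N ^ 2) := by rw [hρ]; ring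
            _ = N * (N * (#S * ρ)) := by ring
            _ ≤ N * (2 * opt A k) := by gcongr
            _ = _ := by ring
        have h4 := le_of_mul_le_mul_right h3 hO
        calc (#S : ℝ) = (#S * (ε / (12 * k))) * (12 * k / ε) := by field_simp
          _ ≤ (2 * N) * (12 * k / ε) := by gcongr
          _ = _ := by ring
  rw [card_far_eq (C := C)]
  push_cast
  calc ∑ i, (#((cluster C i).filter fun p : Fin n => (p : ℕ) ∈ far X n k ρ) : ℝ)
      ≤ ∑ _i : Fin k, 24 * k / ε * N := sum_le_sum fun i _ => key i
    _ = _ := by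
      simp only [sum_const, card_univ, Fintype.card_fin, nsmul_eq_mul]
      ring

/-! ### The probability that an attempt succeeds -/

theorem Invariant.update {σ : Equiv.Perm (Fin k)} {j : Fin k} {X : ℕ → Point d}
    (hX : Invariant ε A C σ j X) {y : Point d} (hy : CoveredBy ε A C (σ j) y) :
    Invariant ε A C σ (j + 1) (Function.update X (n + j) y) := by
  refine ⟨fun p => ?_, fun j' hj' => ?_⟩
  · have := p.2
    rw [Function.update_of_ne (by omega), hX.1]
  · rcases Nat.lt_succ_iff_lt_or_eq.1 hj' with h | h
    · rw [Function.update_of_ne (by omega)]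
      exact hX.2 j' h
    · obtain rfl := Fin.ext h
      rw [Function.update_self]
      exact hy

/-- A lower bound for the probability that a random point is a certain useful one, relative to
uniform sampling from a cluster. -/
def sampleProb (n k : ℕ) (ε : ℝ) : ℝ := ε / (512 * n.size * k * k)

-- With `m ε > 8` the sampling error is at most `6 ρ + ε Δ / 2`. The constant `12` in `ρ` turns `6 ρ
-- N²` into exactly the allowance `ε OPT / (2 k)`.
open Classical in
theorem roundDist_prob (hC : IsOptimal A C) (hn : 1 ≤ n) (hk : 1 ≤ k) (hε0 : 0 < ε) (hε : ε < 1)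
    {σ : Equiv.Perm (Fin k)} (hσ : ∀ j j', j ≤ j' → #(cluster C (σ j')) ≤ #(cluster C (σ j)))
    {m : ℕ} (hm : 8 < m * ε) (j : Fin k) (X : ℕ → Point d) (hX : Invariant ε A C σ j X) :
    ENNReal.ofReal (sampleProb n k ε) ^ m * 2⁻¹ ≤ ev (roundDist X n k m n.size j)
      (fun X' => if Invariant ε A C σ (j + 1) X' then 1 else 0) := by
  have hL : (1 : ℝ) ≤ n.size := by exact_mod_cast Nat.size_pos.2 hn
  have hk' : (1 : ℝ) ≤ k := by exact_mod_cast hk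
  have hθ : 0 ≤ sampleProb n k ε := by rw [sampleProb]; positivity
  have hkk : (k : ℝ) ≤ k * k := by nlinarith
  have hLkk : (1 : ℝ) ≤ n.size * (k * k) := by nlinarith
  have hθ1 : sampleProb n k ε ≤ 1 := by
    rw [sampleProb, div_le_one (by positivity)]
    nlinarith
  have hO := opt_nonneg A k
  rw [roundDist, ev_map]
  by_cases hN : #(cluster C (σ j)) = 0
  · have hall : ∀ y, Invariant ε A C σ (j + 1) (Function.update X (n + j) y) := fun y => by
      refine hX.update ?_
      rw [CoveredBy, hN]
      have : 0 ≤ ε / 2 * (1 / (k : ℝ) * opt A k) := by positivity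
      simpa using this
    simp only [hall, if_true, ev_const]
    refine mul_le_one₀ (pow_le_one₀ zero_le (ENNReal.ofReal_le_one.2 hθ1)) zero_le ?_
    norm_num
  · have hN0 : 0 < #(cluster C (σ j)) := Nat.pos_of_ne_zero hN
    have hN' : (0 : ℝ) < #(cluster C (σ j)) := by exact_mod_cast hN0
    set N := #(cluster C (σ j)) with hNdef
    set ρ : ℝ := ε / (12 * k) * opt A k / N ^ 2 with hρ
    have hρN : ρ * (N : ℝ) ^ 2 = ε / (12 * k) * opt A k := by
      rw [hρ]
      field_simp
    have hρ0 : 0 ≤ ρ := by rw [hρ]; positivity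
    have hm0 : 0 < m := by
      rcases Nat.eq_zero_or_pos m with rfl | h
      · norm_num at hm
      · exact h
    have hm1 : (1 : ℝ) ≤ m := by exact_mod_cast hm0
    have hfar := card_far_le hC hk hε0 hε hσ hX hN0 hρN
    have hXA : ∀ p : Fin n, X p = A p := hX.1
    refine (meanDist_prob (μ := mean A C (σ j)) (Δ := avgSqDist A C (σ j)) (card_pos.1 hN0) hn hk hm0
      hρ0 hfar ?_ ?_ hθ ?_ ?_).trans (ev_mono _ fun y => ?_)
    · rw [sampleProb]
      rw [div_mul_eq_mul_div, div_le_one (by positivity)]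
      -- Here `16 * 24 = 384` explains the constant `512` in `sampleProb`, the next power of two.
      calc ε * (16 * n.size * (24 * k ^ 2 / ε)) = 384 * (n.size * (k * k)) := by
            field_simp
            ring
        _ ≤ 512 * n.size * k * k := by nlinarith
    · rw [sampleProb]
      rw [div_mul_eq_mul_div, div_le_one (by positivity)]
      calc ε * (4 * n.size * k) ≤ 1 * (4 * n.size * (k * k)) := by gcongr
        _ ≤ 512 * n.size * k * k := by nlinarith
    · simp only [hXA]
      exact sum_sub_mean A C (σ j)
    · simp only [hXA]
      exact sum_norm_sub_mean_sq A C (σ j)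
    · split_ifs with h1 h2 h2
      · exact le_rfl
      · refine absurd (hX.update ?_) h2
        rw [CoveredBy, norm_sub_rev]
        have hΔ := avgSqDist_nonneg A C (σ j)
        have e1 : 4 * (avgSqDist A C (σ j) + ρ) / m ≤ ε / 2 * avgSqDist A C (σ j) + 4 * ρ := by
          rw [div_le_iff₀ (by positivity)]
          nlinarith [mul_nonneg hΔ (show 0 ≤ m * ε - 8 by linarith),
            mul_nonneg hρ0 (show (0 : ℝ) ≤ m - 1 by linarith)]
        calc (N : ℝ) ^ 2 * ‖y - mean A C (σ j)‖ ^ 2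
            ≤ (N : ℝ) ^ 2 * (6 * ρ + ε / 2 * avgSqDist A C (σ j)) := by
              gcongr
              linarith
          _ = 6 * (ρ * N ^ 2) + ε / 2 * (N ^ 2 * avgSqDist A C (σ j)) := by ring
          _ = _ := by
              rw [hρN]
              field_simp
              ring
      · exact zero_le
      · exact le_rfl

/-- A lower bound for the probability that an attempt succeeds. -/
def attemptProb (n k m : ℕ) (ε : ℝ) : ℝ := (sampleProb n k ε ^ m / 2) ^ k

/-- The points are intact, and every cluster is covered. -/
def Good (ε : ℝ) (A : Fin n → Point d) (C : Fin n → Fin k) (X : ℕ → Point d) : Prop :=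
  (∀ p : Fin n, X p = A p) ∧ ∀ i, ∃ j < k, CoveredBy ε A C i (X (n + j))

open Classical in
theorem attemptDist_prob (hC : IsOptimal A C) (hn : 1 ≤ n) (hk : 1 ≤ k) (hε0 : 0 < ε) (hε : ε < 1)
    {m : ℕ} (hm : 8 < m * ε) (X : ℕ → Point d) (hX : ∀ p : Fin n, X p = A p) :
    ENNReal.ofReal (attemptProb n k m ε) ≤ ev (attemptDist X n k m n.size)
      (fun X' => if Good ε A C X' then 1 else 0) := by
  -- Clusters are sorted by decreasing size. The order is used only in the analysis: coverage does
  -- not depend on which position holds which center.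
  set f : Fin k → ℤ := fun i => -(#(cluster C i) : ℤ) with hf
  set σ := Tuple.sort f with hσdef
  have hσ : ∀ j j', j ≤ j' → #(cluster C (σ j')) ≤ #(cluster C (σ j)) := fun j j' h => by
    have := Tuple.monotone_sort f h
    simp only [Function.comp_apply, hf, neg_le_neg_iff] at this
    exact_mod_cast this
  have hθ : 0 ≤ sampleProb n k ε := by rw [sampleProb]; positivity
  have h := pow_le_ev_iter (κ := fun j X => roundDist X n k m n.size j)
    (I := fun j X => Invariant ε A C σ j X) (q := ENNReal.ofReal (sampleProb n k ε) ^ m * 2⁻¹)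
    (tot := k) (fun j hj X hX => roundDist_prob hC hn hk hε0 hε hσ hm ⟨j, hj⟩ X hX) k 0
    (by omega) X ⟨hX, fun j' h => absurd h (by omega)⟩
  refine le_trans (le_of_eq ?_) (h.trans (ev_mono _ fun X' => ?_))
  · rw [attemptProb, ENNReal.ofReal_pow (by positivity), div_eq_mul_inv,
      ENNReal.ofReal_mul (by positivity), ENNReal.ofReal_pow hθ,
      ENNReal.ofReal_inv_of_pos (by norm_num)]
    norm_num
  · split_ifs with h1 h2 h2
    · exact le_rfl
    · refine absurd ⟨h1.1, fun i => ?_⟩ h2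
      obtain ⟨j, rfl⟩ := σ.surjective i
      exact ⟨j, j.2, h1.2 j j.2⟩
    · exact zero_le
    · exact le_rfl

/-- The points are intact. -/
def Intact (A : Fin n → Point d) (X : ℕ → Point d) : Prop := ∀ p : Fin n, X p = A p

open Classical in
theorem attemptDist_intact (m L : ℕ) (X : ℕ → Point d) (hX : Intact A X) :
    1 ≤ ev (attemptDist X n k m L) (fun X' => if Intact A X' then 1 else 0) := by
  have h := pow_le_ev_iter (κ := fun j X => roundDist X n k m L j)
    (I := fun _ X => Intact A X) (q := 1) (tot := k) (fun j hj X hX => ?_) k 0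
    (by omega) X hX
  · rw [one_pow] at h
    exact h
  · rw [roundDist, ev_map]
    have : ∀ y, Intact A (Function.update X (n + j) y) := fun y p => by
      have := p.2
      rw [Function.update_of_ne (by omega), hX]
    simp only [this, if_true, ev_const, le_refl]

/-! ### The number of attempts -/

theorem one_sub_pow_le {p δ : ℝ} (hp0 : 0 < p) (hp1 : p ≤ 1) (hδ : 0 < δ) (N : ℕ)
    (hN : 1 ≤ N * p * δ) : (1 - p) ^ N ≤ δ := by
  have h1 : 1 + N * p ≤ (1 + p) ^ N := one_add_mul_le_pow (by linarith) N
  have h2 : (1 - p) ^ N * (1 + p) ^ N ≤ 1 := by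
    rw [← mul_pow]
    exact pow_le_one₀ (by nlinarith) (by nlinarith)
  have h3 : 0 ≤ (1 - p) ^ N := pow_nonneg (by linarith) _
  have h4 : (1 - p) ^ N * (N * p) ≤ 1 := by nlinarith
  have h5 : 0 ≤ (N : ℝ) * p := by positivity
  by_contra! h
  nlinarith

-- `2 ^ e` exceeds the inverse of `sampleProb`, so `2 ^ ((e m + 1) k)` is at least the inverse of
-- the success probability of one attempt; the further factor `2 ^ l > 1 / δ` gives the confidence.
open Classical in
theorem searchDist_good (hC : IsOptimal A C) (hn : 1 ≤ n) (hk : 1 ≤ k) (hε0 : 0 < ε) (hε : ε < 1)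
    {m : ℕ} (hm : 8 < m * ε) {δ : ℝ} (hδ : 0 < δ) {e l : ℕ}
    (he : 512 * n.size * k * k < 2 ^ e * ε) (hl : 1 < 2 ^ l * δ) :
    ENNReal.ofReal (1 - δ) ≤ ev (searchDist (Good ε A C) (inputPoints A) n k m n.size
      (2 ^ logAttempts k m e l)) (fun σ => if σ.2 then 1 else 0) := by
  have hL : (1 : ℝ) ≤ n.size := by exact_mod_cast Nat.size_pos.2 hn
  have hk' : (1 : ℝ) ≤ k := by exact_mod_cast hk
  have hθ : 0 < sampleProb n k ε := by rw [sampleProb]; positivity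
  have hLkk : (1 : ℝ) ≤ n.size * k * k := by
    have : (1 : ℝ) ≤ n.size * k := one_le_mul_of_one_le_of_one_le hL hk'
    exact one_le_mul_of_one_le_of_one_le this hk'
  have hθ1 : sampleProb n k ε ≤ 1 := by
    rw [sampleProb, div_le_one (by positivity)]
    nlinarith
  have hp0 : 0 < attemptProb n k m ε := by rw [attemptProb]; positivity
  have hp1 : attemptProb n k m ε ≤ 1 := by
    rw [attemptProb]
    refine pow_le_one₀ (by positivity) ?_
    have := pow_le_one₀ hθ.le hθ1 (n := m)
    linarith
  refine le_trans (ENNReal.ofReal_le_ofReal ?_) (searchDist_prob (same := Intact A)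
    hp0.le hp1 (fun X h => h.1) (fun X hX => attemptDist_intact m _ X hX)
    (fun X hX => attemptDist_prob hC hn hk hε0 hε hm X hX) _ 0 _ fun p => by simp [inputPoints])
  have h1 : 1 ≤ 2 ^ e * sampleProb n k ε := by
    rw [sampleProb, ← mul_div_assoc, le_div_iff₀ (by positivity), one_mul]
    exact he.le
  have h2 : 1 ≤ 2 ^ ((e * m + 1) * k) * attemptProb n k m ε := by
    rw [attemptProb, pow_mul, ← mul_pow, pow_succ, pow_mul]
    refine one_le_pow₀ ?_
    calc (1 : ℝ) ≤ (2 ^ e * sampleProb n k ε) ^ m := one_le_pow₀ h1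
      _ = _ := by rw [mul_pow]; ring
  have h3 := one_sub_pow_le hp0 hp1 hδ (2 ^ logAttempts k m e l) ?_
  · linarith
  · rw [logAttempts]
    push_cast
    rw [pow_add]
    calc (1 : ℝ) ≤ (2 ^ ((e * m + 1) * k) * attemptProb n k m ε) * (2 ^ l * δ) :=
          one_le_mul_of_one_le_of_one_le h2 hl.le
      _ = _ := by ring

end

/-! ### Estimates -/

/-- A function of growth `n ^ o(1)`. -/
def subpoly (a : ℝ) (n : ℕ) : ℝ := (2 : ℝ) ^ (a * (1 + √(Real.log n)))

theorem isPowAddLittleO_subpoly (c a : ℝ) :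
    IsPowAddLittleO c (fun n => (n : ℝ) ^ c * subpoly a n) := by
  -- Multiplied by `log n`, this exponent becomes `a log 2 (1 + √(log n))`.
  refine ⟨fun n => a * Real.log 2 * ((Real.log n)⁻¹ + (√(Real.log n))⁻¹), ?_, ?_⟩
  · have h1 : Tendsto (fun n : ℕ => Real.log n) atTop atTop :=
      Real.tendsto_log_atTop.comp tendsto_natCast_atTop_atTop
    have h2 : Tendsto (fun n : ℕ => √(Real.log n)) atTop atTop := Real.tendsto_sqrt_atTop.comp h1
    have h3 := ((tendsto_inv_atTop_zero.comp h1).add (tendsto_inv_atTop_zero.comp h2)).const_mul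
      (a * Real.log 2)
    simpa using h3
  · filter_upwards [eventually_ge_atTop 2] with n hn
    have hn' : (1 : ℝ) < n := by exact_mod_cast hn
    have hl : 0 < Real.log n := Real.log_pos hn'
    have hs : 0 < √(Real.log n) := Real.sqrt_pos.2 hl
    rw [Real.rpow_add (by linarith), subpoly]
    congr 1
    rw [Real.rpow_def_of_pos (by norm_num), Real.rpow_def_of_pos (by linarith)]
    congr 1
    have h : Real.log n * (√(Real.log n))⁻¹ = √(Real.log n) := by
      rw [← div_eq_mul_inv, Real.div_sqrt]
    calc Real.log 2 * (a * (1 + √(Real.log n)))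
        = a * Real.log 2 * (1 + √(Real.log n)) := by ring
      _ = a * Real.log 2 * (Real.log n * (Real.log n)⁻¹ + Real.log n * (√(Real.log n))⁻¹) := by
          rw [h, mul_inv_cancel₀ hl.ne']
      _ = _ := by ring

theorem one_le_subpoly {a : ℝ} (ha : 0 ≤ a) (n : ℕ) : 1 ≤ subpoly a n :=
  Real.one_le_rpow (by norm_num) (by positivity)

/-- The logarithm is four times that of the fourth root, and a logarithm is below its argument. -/
theorem log_sq_le_sqrt {x : ℝ} (hx : 1 ≤ x) : Real.log x ^ 2 ≤ 16 * √x := by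
  have hy : 1 ≤ √√x := by
    rw [Real.one_le_sqrt, Real.one_le_sqrt]
    exact hx
  have h1 : Real.log x = 4 * Real.log √√x := by
    rw [Real.log_sqrt (Real.sqrt_nonneg _), Real.log_sqrt (by linarith)]
    ring
  have h2 : Real.log √√x ≤ √√x := (Real.log_le_sub_one_of_pos (by linarith)).trans (by linarith)
  have h3 : 0 ≤ Real.log √√x := Real.log_nonneg hy
  calc Real.log x ^ 2 = 16 * Real.log √√x ^ 2 := by rw [h1]; ring
    _ ≤ 16 * √√x ^ 2 := by gcongr
    _ = 16 * √x := by rw [Real.sq_sqrt (Real.sqrt_nonneg _)]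

theorem half_le_log_two : 1 / 2 ≤ Real.log 2 := by
  have := Real.log_two_gt_d9
  linarith

theorem nat_le_of_two_pow_le {i : ℕ} {x : ℝ} (h : (2 : ℝ) ^ i ≤ x) : (i : ℝ) ≤ 2 * Real.log x := by
  have h1 := Real.log_le_log (by positivity) h
  rw [Real.log_pow] at h1
  have : (i : ℝ) * (1 / 2) ≤ i * Real.log 2 := by
    gcongr
    exact half_le_log_two
  linarith

/-- `n.size` is of order `log n`, so this bounds `(log log n)²` by `√(log n)`, which makes its
exponential subpolynomial. -/
theorem log_size_sq_le {n : ℕ} (hn : 1 ≤ n) :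
    Real.log n.size ^ 2 ≤ 32 * (1 + √(Real.log n)) := by
  have hL : 1 ≤ n.size := Nat.size_pos.2 hn
  have h1 : (2 : ℝ) ^ (n.size - 1) ≤ n := by
    have := Nat.lt_size.1 (show n.size - 1 < n.size by omega)
    exact_mod_cast this
  have h2 := nat_le_of_two_pow_le h1
  rw [Nat.cast_sub hL, Nat.cast_one] at h2
  have hx : 0 ≤ Real.log n := Real.log_nonneg (by exact_mod_cast hn)
  have h3 : √(n.size : ℝ) ≤ 1 + 2 * √(Real.log n) := by
    rw [Real.sqrt_le_left (by positivity)]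
    nlinarith [Real.sq_sqrt hx, Real.sqrt_nonneg (Real.log n)]
  have h4 := log_sq_le_sqrt (x := n.size) (by exact_mod_cast hL)
  linarith

/-- Here `u = k / ε`, `D = log (1 / δ)` and `lam = log n.size`. Every term is charged to `Q = u² (w
+ D)²`, to `lam²` or to a constant. The danger is a factor `u` without a logarithm: if `w ≥ 1 / 2`
then `u² ≤ 4 Q`, and otherwise `u < 2` is itself a constant. -/
theorem exponent_le {u w D lam E : ℝ} (hw : w = Real.log u) (hu : 1 ≤ u) (hD : 0 ≤ D) (hlam : 0 ≤ lam)
    (hE : E ≤ 9 * u * (10 + 2 * lam + 4 * w) + u + 1 + 2 * D) :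
    E ≤ 239 + 18 * lam ^ 2 + 474 * (u ^ 2 * (w + D) ^ 2) := by
  have hw0 : 0 ≤ w := hw ▸ Real.log_nonneg hu
  have hQ1 : (u * w) ^ 2 ≤ u ^ 2 * (w + D) ^ 2 := by
    rw [mul_pow]
    gcongr
    linarith
  have hQ2 : D ^ 2 ≤ u ^ 2 * (w + D) ^ 2 := by
    calc D ^ 2 = 1 ^ 2 * D ^ 2 := by ring
      _ ≤ u ^ 2 * (w + D) ^ 2 := by
        gcongr
        linarith
  set Q := u ^ 2 * (w + D) ^ 2 with hQ
  have h3 : u * w ≤ 1 + Q := by nlinarith [sq_nonneg (u * w - 1)]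
  have h4 : D ≤ 1 + Q := by nlinarith [sq_nonneg (D - 1)]
  have h12 : u ≤ 2 + 4 * Q ∧ u * lam ≤ 1 + lam ^ 2 + 4 * Q := by
    rcases le_or_gt (1 / 2) w with h | h
    · have h5 : u ^ 2 ≤ 4 * Q := by
        have : u ^ 2 * (1 / 2) ^ 2 ≤ u ^ 2 * w ^ 2 := by gcongr
        nlinarith
      constructor
      · nlinarith
      · nlinarith [sq_nonneg (u - lam)]
    · have h5 : u < 2 := by
        rw [hw] at h
        have h6 := (Real.log_lt_iff_lt_exp (by linarith)).1 (h.trans_le half_le_log_two)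
        rwa [Real.exp_log (by norm_num)] at h6
      have hQ0 : 0 ≤ Q := by positivity
      constructor
      · linarith
      · nlinarith [sq_nonneg (lam - 1), mul_le_mul_of_nonneg_right h5.le hlam]
  nlinarith [h12.1, h12.2]

/-! ### Bounds for the number of attempts and the running time -/

section

variable {n d k m e l : ℕ} {ε δ : ℝ}

theorem logAttempts_le (hn : 1 ≤ n) (hk : 1 ≤ k) (hε0 : 0 < ε) (hε : ε < 1) (hδ0 : 0 < δ)
    (hδ : δ < 1) (hm : ∀ i < m, i * ε ≤ 8)
    (he : ∀ i < e, 2 ^ i * ε ≤ 512 * n.size * k * k) (hl : ∀ i < l, 2 ^ i * δ ≤ 1) :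
    (logAttempts k m e l : ℝ) ≤ 815 * (1 + √(Real.log n)) +
      474 * (k : ℝ) ^ 2 * (ε ^ 12)⁻¹ * Real.log ((k : ℝ) / (ε * δ)) ^ 2 := by
  have hL : (1 : ℝ) ≤ n.size := by exact_mod_cast Nat.size_pos.2 hn
  have hk' : (1 : ℝ) ≤ k := by exact_mod_cast hk
  set u : ℝ := k / ε with hu
  have hu1 : 1 ≤ u := by
    rw [hu, le_div_iff₀ hε0]
    linarith
  have hku : (k : ℝ) ≤ u := by
    rw [hu, le_div_iff₀ hε0]
    nlinarith
  have hw0 : 0 ≤ Real.log u := Real.log_nonneg hu1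
  have hlam0 : 0 ≤ Real.log n.size := Real.log_nonneg hL
  have hD0 : 0 ≤ Real.log δ⁻¹ := Real.log_nonneg ((one_le_inv₀ hδ0).2 hδ.le)
  have hm9 : (m : ℝ) * ε ≤ 9 := by
    rcases Nat.eq_zero_or_pos m with rfl | hm0
    · norm_num
    · have := hm (m - 1) (by omega)
      rw [Nat.cast_sub hm0, Nat.cast_one] at this
      linarith
  have hmk : (m : ℝ) * k ≤ 9 * u := by
    rw [hu, mul_div_assoc', le_div_iff₀ hε0]
    nlinarith
  have hel : (e : ℝ) ≤ 10 + 2 * Real.log n.size + 4 * Real.log u := by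
    rcases Nat.eq_zero_or_pos e with rfl | he0
    · simp only [Nat.cast_zero]
      positivity
    · have h1 := he (e - 1) (by omega)
      -- Minimality of `e` bounds `2 ^ (e - 1)`; nine doublings pay for the factor `512 = 2 ^ 9`.
      rcases Nat.lt_or_ge (e - 1) 9 with h9 | h9
      · have : (e : ℝ) ≤ 9 := by exact_mod_cast (show e ≤ 9 by omega)
        linarith
      · have h2 : (2 : ℝ) ^ (e - 1 - 9) ≤ n.size * u ^ 2 := by
          have h3 : (2 : ℝ) ^ (e - 1) = 512 * 2 ^ (e - 1 - 9) := by
            rw [show (512 : ℝ) = 2 ^ 9 by norm_num, ← pow_add]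
            congr 1
            omega
          rw [h3] at h1
          have h4 : (2 : ℝ) ^ (e - 1 - 9) ≤ n.size * k * k / ε := by
            rw [le_div_iff₀ hε0]
            linarith
          refine h4.trans ?_
          rw [hu, div_pow, mul_div_assoc', div_le_div_iff₀ hε0 (by positivity)]
          have : ε ^ 2 ≤ ε := by nlinarith
          calc (n.size : ℝ) * k * k * ε ^ 2 ≤ n.size * k * k * ε := by gcongr
            _ = _ := by ring
        have h5 := nat_le_of_two_pow_le h2
        rw [Real.log_mul (by positivity) (by positivity), Real.log_pow] at h5
        rw [show e - 1 - 9 = e - 10 by omega, Nat.cast_sub (by omega)] at h5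
        push_cast at h5
        linarith
  have hll : (l : ℝ) ≤ 1 + 2 * Real.log δ⁻¹ := by
    rcases Nat.eq_zero_or_pos l with rfl | hl0
    · simp only [Nat.cast_zero]
      positivity
    · have h1 := hl (l - 1) (by omega)
      have h2 : (2 : ℝ) ^ (l - 1) ≤ δ⁻¹ := by
        rw [← one_div, le_div_iff₀ hδ0]
        exact h1
      have h3 := nat_le_of_two_pow_le h2
      rw [Nat.cast_sub hl0, Nat.cast_one] at h3
      linarith
  have hE : (logAttempts k m e l : ℝ) ≤
      9 * u * (10 + 2 * Real.log n.size + 4 * Real.log u) + u + 1 + 2 * Real.log δ⁻¹ := by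
    rw [logAttempts]
    push_cast
    calc ((e : ℝ) * m + 1) * k + l = (m * k) * e + k + l := by ring
      _ ≤ 9 * u * (10 + 2 * Real.log n.size + 4 * Real.log u) + u + (1 + 2 * Real.log δ⁻¹) := by
        gcongr
      _ = _ := by ring
  have hfin := exponent_le rfl hu1 hD0 hlam0 hE
  have hΛ : Real.log u + Real.log δ⁻¹ = Real.log (k / (ε * δ)) := by
    rw [← Real.log_mul (by positivity) (by positivity), hu]
    congr 1
    field_simp
  rw [hΛ] at hfin
  have hQ : u ^ 2 * Real.log (k / (ε * δ)) ^ 2 ≤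
      (k : ℝ) ^ 2 * (ε ^ 12)⁻¹ * Real.log (k / (ε * δ)) ^ 2 := by
    rw [hu, div_pow, div_eq_mul_inv]
    gcongr ?_ * ?_ * ?_
    refine inv_anti₀ (by positivity) ?_
    -- The argument needs only `ε⁻²`, which is at most `ε⁻¹²`.
    exact pow_le_pow_of_le_one hε0.le hε.le (by norm_num)
  have hsize := log_size_sq_le hn
  have hsq := Real.sqrt_nonneg (Real.log n)
  linarith

theorem two_pow_logAttempts_le (hn : 1 ≤ n) (hk : 1 ≤ k) (hε0 : 0 < ε) (hε : ε < 1) (hδ0 : 0 < δ)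
    (hδ : δ < 1) (hm : ∀ i < m, i * ε ≤ 8)
    (he : ∀ i < e, 2 ^ i * ε ≤ 512 * n.size * k * k) (hl : ∀ i < l, 2 ^ i * δ ≤ 1) :
    (2 : ℝ) ^ logAttempts k m e l ≤ subpoly 815 n * expFactor 474 k ε δ := by
  rw [subpoly, expFactor, ← Real.rpow_add (by norm_num), ← Real.rpow_natCast]
  exact Real.rpow_le_rpow_of_exponent_le (by norm_num)
    (logAttempts_le hn hk hε0 hε hδ0 hδ hm he hl)

theorem one_le_expFactor {η : ℝ} (hη : 0 ≤ η) (k : ℕ) (hε0 : 0 < ε) (δ : ℝ) :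
    1 ≤ expFactor η k ε δ :=
  Real.one_le_rpow (by norm_num) (by positivity)

theorem expFactor_mono {η η' : ℝ} (h : η ≤ η') (k : ℕ) (hε0 : 0 < ε) (δ : ℝ) :
    expFactor η k ε δ ≤ expFactor η' k ε δ :=
  Real.rpow_le_rpow_of_exponent_le (by norm_num) (by gcongr)

/-- The number of attempts bounds all other parameters, so each level of nesting costs one factor
`N`: centers per distance, draws per round, rounds per attempt, attempts. -/
theorem time_le {N : ℕ} (hn : 1 ≤ n) (hd : 1 ≤ d) (hN : 1 ≤ N) (hk : k ≤ N) (hm : m ≤ N)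
    (he : e ≤ N) (hl : l ≤ N) (hL : n.size ≤ N) (hlog : logAttempts k m e l ≤ N) :
    setupTime n d k m e l + searchTime n d k m N + 8 ≤ 1024 * (n * d * N ^ 4) := by
  have hks : k.size ≤ N := (size_le_self k).trans hk
  have hP : ∀ i j, i ≤ j → n * d * N ^ i ≤ n * d * N ^ j := fun i j h =>
    Nat.mul_le_mul_left _ (Nat.pow_le_pow_right hN h)
  have hNle : ∀ i, 1 ≤ i → N ≤ n * d * N ^ i := fun i hi => by
    calc N = 1 * 1 * N ^ 1 := by ring
      _ ≤ n * d * N ^ i := Nat.mul_le_mul (Nat.mul_le_mul hn hd) (Nat.pow_le_pow_right hN hi)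
  have hdle : ∀ i, d ≤ n * d * N ^ i := fun i => by
    calc d = 1 * d * 1 := by ring
      _ ≤ n * d * N ^ i := Nat.mul_le_mul (Nat.mul_le_mul_right d hn) (Nat.one_le_pow _ _ hN)
  have hS : sampleTime n d k ≤ 500 * (n * d * N ^ 1) := by
    have h1 : (k + 2) * (18 * d + 23) + 10 * n.size + 40 + 3 ≤ 176 * (d * N) := by
      have h2 : (k + 2) * (18 * d + 23) ≤ (3 * N) * (41 * d) :=
        Nat.mul_le_mul (by omega) (by omega)
      have h3 : N ≤ d * N := Nat.le_mul_of_pos_left _ hd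
      have h4 : (3 * N) * (41 * d) = 123 * (d * N) := by ring
      omega
    have h5 := Nat.mul_le_mul_left (2 * n) h1
    have h6 : 2 * n * (176 * (d * N)) = 352 * (n * d * N ^ 1) := by ring
    have h7 := hNle 1 le_rfl
    rw [sampleTime]
    omega
  have hR : roundTime n d k m ≤ 700 * (n * d * N ^ 2) := by
    have h1 : m * (sampleTime n d k + 22 * d + 21) ≤ N * (543 * (n * d * N ^ 1)) := by
      refine Nat.mul_le_mul hm ?_
      have := hdle 1
      have := hNle 1 le_rfl
      omega
    have h2 : N * (543 * (n * d * N ^ 1)) = 543 * (n * d * N ^ 2) := by ring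
    have := hdle 2
    have := hNle 2 (by norm_num)
    rw [roundTime]
    omega
  have hSe : searchTime n d k m N ≤ 745 * (n * d * N ^ 4) := by
    have h1 : k * (roundTime n d k m + 3) ≤ N * (703 * (n * d * N ^ 2)) := by
      refine Nat.mul_le_mul hk ?_
      have := hNle 2 (by norm_num)
      omega
    have h2 : N * (703 * (n * d * N ^ 2)) = 703 * (n * d * N ^ 3) := by ring
    have h3 : k * d ≤ n * d * N ^ 3 := by
      calc k * d ≤ N * d := Nat.mul_le_mul_right _ hk
        _ = 1 * d * N ^ 1 := by ring
        _ ≤ n * d * N ^ 3 := Nat.mul_le_mul (Nat.mul_le_mul_right d hn)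
          (Nat.pow_le_pow_right hN (by norm_num))
    have h4 := hNle 3 (by norm_num)
    have h5 : N * (k * (roundTime n d k m + 3) + 12 * (k * d) + 18) ≤
        N * (733 * (n * d * N ^ 3)) := Nat.mul_le_mul_left _ (by omega)
    have h6 : N * (733 * (n * d * N ^ 3)) = 733 * (n * d * N ^ 4) := by ring
    have h7 : 1 ≤ n * d * N ^ 4 := hN.trans (hNle 4 (by norm_num))
    rw [searchTime]
    have h8 : N * (k * (roundTime n d k m + 3) + 12 * (k * d) + 18) + 12 ≤
        745 * (n * d * N ^ 4) := by omega
    omega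
  have := hdle 4
  have := hNle 4 (by norm_num)
  rw [setupTime]
  omega

theorem exists_first_double {x : ℝ} (hx : 0 < x) (R : ℝ) :
    ∃ e : ℕ, (∀ i < e, 2 ^ i * x ≤ R) ∧ R < 2 ^ e * x := by
  classical
  have h : ∃ e : ℕ, R < 2 ^ e * x := by
    obtain ⟨e, he⟩ := pow_unbounded_of_one_lt (R / x) (one_lt_two : (1 : ℝ) < 2)
    exact ⟨e, (div_lt_iff₀ hx).1 he⟩
  exact ⟨Nat.find h, fun i hi => not_lt.1 (Nat.find_min h hi), Nat.find_spec h⟩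

theorem exists_first_multiple {x : ℝ} (hx : 0 < x) (R : ℝ) :
    ∃ m : ℕ, (∀ i < m, i * x ≤ R) ∧ R < m * x := by
  classical
  have h : ∃ m : ℕ, R < m * x := by
    obtain ⟨m, hm⟩ := exists_nat_gt (R / x)
    exact ⟨m, (div_lt_iff₀ hx).1 hm⟩
  exact ⟨Nat.find h, fun i hi => not_lt.1 (Nat.find_min h hi), Nat.find_spec h⟩

theorem card_le_of_mem_output {s : Store} {M : Finset (Point d)} (hM : M ∈ output k d s) :
    M.card ≤ k := by
  simp only [output, List.mem_map] at hM
  obtain ⟨l, -, rfl⟩ := hM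
  exact card_image_le.trans (by simp)

end

end MinSum

end

/-! ### Assembly -/

theorem mainTheorem5 :
    ∃ (P : MinSum.Program) (η : ℝ) (g f : ℕ → ℝ),
      0 < η ∧ MinSum.IsPowAddLittleO 0 g ∧ MinSum.IsPowAddLittleO 1 f ∧
      ∀ (n d k : ℕ) (ε δ : ℝ), 1 ≤ n → 1 ≤ d → 1 ≤ k → 0 < ε → ε < 1 → 0 < δ →
      ∀ A : Fin n → MinSum.Point d,
      ∃ T : ℕ, (T : ℝ) ≤ f n * (d : ℝ) * MinSum.expFactor η k ε δ ∧
        (∀ c ∈ (MinSum.runFor T ([P], MinSum.input k ε δ A)).support,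
          c.1 = [] ∧
          ((MinSum.output k d c.2).length : ℝ) ≤ g n * MinSum.expFactor η k ε δ ∧
          ∀ M ∈ MinSum.output k d c.2, M.card ≤ k) ∧
        ∀ C : Fin n → Fin k, MinSum.IsOptimal A C →
          ENNReal.ofReal (1 - δ) ≤
            (MinSum.runFor T ([P], MinSum.input k ε δ A)).toOuterMeasure
              {c | ∃ M ∈ MinSum.output k d c.2, ∀ i : Fin k, MinSum.Covers ε A C M i} := by
  classical
  -- The running time is of order `n d N⁴`, hence the factor `4` in both exponents; the summand `10`
  -- absorbs the constant `1024 = 2 ^ 10`.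
  refine ⟨MinSum.algorithm, 4 * 474, fun n => (n : ℝ) ^ (0 : ℝ) * MinSum.subpoly 815 n,
    fun n => (n : ℝ) ^ (1 : ℝ) * MinSum.subpoly (10 + 4 * 815) n, by norm_num,
    MinSum.isPowAddLittleO_subpoly _ _, MinSum.isPowAddLittleO_subpoly _ _, ?_⟩
  intro n d k ε δ hn hd hk hε0 hε hδ0 A
  simp only [Real.rpow_zero, Real.rpow_one, one_mul]
  have hn' : (1 : ℝ) ≤ n := by exact_mod_cast hn
  have hd' : (1 : ℝ) ≤ d := by exact_mod_cast hd
  have hexp := MinSum.one_le_expFactor (η := 4 * 474) (by norm_num) k hε0 δ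
  have hsub := MinSum.one_le_subpoly (a := 815) (by norm_num) n
  have hsub10 : 1024 ≤ MinSum.subpoly 10 n := by
    calc (1024 : ℝ) = 2 ^ (10 : ℝ) := by norm_num
      _ ≤ _ := Real.rpow_le_rpow_of_exponent_le (by norm_num)
        (by nlinarith [Real.sqrt_nonneg (Real.log n)])
  have hsubf : MinSum.subpoly (10 + 4 * 815) n = MinSum.subpoly 10 n * MinSum.subpoly 815 n ^ 4 := by
    rw [MinSum.subpoly, MinSum.subpoly, MinSum.subpoly, ← Real.rpow_natCast, ← Real.rpow_mul
      (by norm_num), ← Real.rpow_add (by norm_num)]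
    congr 1
    push_cast
    ring
  rcases le_or_gt 1 δ with hδ | hδ
  · have hrun := MinSum.algorithm_det_of_one_le (k := k) (ε := ε) hδ A
    unfold MinSum.Det at hrun
    refine ⟨10, ?_, fun c hc => ?_, fun C _ => ?_⟩
    · have h1 : (1024 : ℝ) ≤ MinSum.subpoly 10 n * MinSum.subpoly 815 n ^ 4 := by
        nlinarith [one_le_pow₀ hsub (n := 4)]
      rw [hsubf]
      calc ((10 : ℕ) : ℝ) ≤ 1 * 1024 * 1 * 1 := by norm_num
        _ ≤ _ := by gcongr
    · obtain ⟨h1, -, h2⟩ := hrun.support hc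
      refine ⟨h1, ?_, fun M hM => MinSum.card_le_of_mem_output hM⟩
      rw [MinSum.output, h2]
      simp only [List.range_zero, List.map_nil, List.length_nil, Nat.cast_zero]
      positivity
    · rw [ENNReal.ofReal_eq_zero.2 (by linarith)]
      exact zero_le
  · obtain ⟨m, hm, hm'⟩ := MinSum.exists_first_multiple hε0 8
    obtain ⟨e, he, he'⟩ := MinSum.exists_first_double hε0 (512 * n.size * k * k)
    obtain ⟨l, hl, hl'⟩ := MinSum.exists_first_double hδ0 1
    set N := 2 ^ MinSum.logAttempts k m e l with hN
    have hbound : (N : ℝ) ≤ MinSum.subpoly 815 n * MinSum.expFactor 474 k ε δ := by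
      rw [hN]
      push_cast
      exact MinSum.two_pow_logAttempts_le hn hk hε0 hε hδ0 hδ hm he hl
    have hk' : (1 : ℝ) ≤ k := by exact_mod_cast hk
    have hL : (1 : ℝ) ≤ n.size := by exact_mod_cast Nat.size_pos.2 hn
    have hm0 : 1 ≤ m := by
      rcases Nat.eq_zero_or_pos m with rfl | h
      · norm_num at hm'
      · exact h
    have he0 : 1 ≤ e := by
      rcases Nat.eq_zero_or_pos e with rfl | h
      · have h1 : (1 : ℝ) ≤ n.size * k := one_le_mul_of_one_le_of_one_le hL hk'
        have h2 : (1 : ℝ) ≤ n.size * k * k := one_le_mul_of_one_le_of_one_le h1 hk'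
        rw [pow_zero, one_mul] at he'
        linarith
      · exact h
    have hlogN : MinSum.logAttempts k m e l ≤ N := Nat.lt_two_pow_self.le
    have hem : e ≤ e * m := Nat.le_mul_of_pos_right _ hm0
    have hme : m ≤ e * m := Nat.le_mul_of_pos_left _ he0
    have hemk : e * m + 1 ≤ (e * m + 1) * k := Nat.le_mul_of_pos_right _ hk
    have hkk : k ≤ (e * m + 1) * k := Nat.le_mul_of_pos_left _ (Nat.succ_pos _)
    have hlog : MinSum.logAttempts k m e l = (e * m + 1) * k + l := rfl
    -- `n.size` does not occur in `logAttempts` directly, but `512 n.size k² < 2 ^ e ε` puts it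
    -- below `2 ^ e`.
    have hLN : n.size ≤ N := by
      have h1 : (n.size : ℝ) ≤ 2 ^ e := by
        have h2 : (2 : ℝ) ^ e * ε ≤ 2 ^ e * 1 := by gcongr
        nlinarith [one_le_mul_of_one_le_of_one_le hk' hk']
      have h3 : n.size ≤ 2 ^ e := by exact_mod_cast h1
      exact h3.trans (Nat.pow_le_pow_right two_pos (by omega))
    have htime := MinSum.time_le hn hd (Nat.one_le_two_pow) (by omega) (by omega) (by omega)
      (by omega) hLN hlogN
    refine ⟨MinSum.setupTime n d k m e l + MinSum.searchTime n d k m N + 8, ?_, fun c hc => ?_,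
      fun C hC => ?_⟩
    · have h1 : ((MinSum.setupTime n d k m e l + MinSum.searchTime n d k m N + 8 : ℕ) : ℝ) ≤
          1024 * (n * d * N ^ 4) := by exact_mod_cast htime
      refine h1.trans ?_
      have h2 : MinSum.expFactor 474 k ε δ ^ 4 = MinSum.expFactor (4 * 474) k ε δ := by
        rw [MinSum.expFactor, MinSum.expFactor, ← Real.rpow_natCast, ← Real.rpow_mul (by norm_num)]
        congr 1
        push_cast
        ring
      rw [hsubf, ← h2]
      calc (1024 : ℝ) * (n * d * N ^ 4)
          ≤ MinSum.subpoly 10 n *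
            (n * d * (MinSum.subpoly 815 n * MinSum.expFactor 474 k ε δ) ^ 4) := by
            gcongr
        _ = _ := by ring
    -- Halting and the length of the output do not involve any clustering, so the ghost predicate
    -- can be taken to be false.
    · obtain ⟨h1, -, h2, -⟩ := (MinSum.algorithm_run hn hδ A hm hm' he he' hl hl'
        (fun _ => False)).support hc
      refine ⟨h1, ?_, fun M hM => MinSum.card_le_of_mem_output hM⟩
      rw [MinSum.output, List.length_map, List.length_range, h2]
      refine hbound.trans ?_
      gcongr
      exact MinSum.expFactor_mono (by norm_num) k hε0 δ
    · refine (MinSum.searchDist_good hC hn hk hε0 hε hm' hδ0 he' hl').trans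
        ((MinSum.algorithm_run hn hδ A hm hm' he he' hl hl' (MinSum.Good ε A C)).prob
          (S := {σ | σ.2}) fun σ hσ s' h => ?_)
      obtain ⟨h0, h⟩ := h
      obtain ⟨l', hl', X', hX', hout⟩ := h hσ
      refine ⟨MinSum.outputSet k d s' l', List.mem_map.2 ⟨l', List.mem_range.2 ?_, rfl⟩, fun i => ?_⟩
      · rw [h0]
        exact hl'
      · obtain ⟨j, hj, hcov⟩ := hX'.2 i
        refine ⟨X' (n + j), mem_image.2 ⟨⟨j, hj⟩, mem_univ _, ?_⟩, hcov⟩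
        ext c
        exact hout j hj c
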